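/- Let $c>0$, let $m\ge 1$ and $k\ge 0$ be integers, and let $\mathbb{C}_m$ be the complex Clifford algebra with generators $e_1,\dots,e_m$, $e_j^2=-1$, $e_ie_j=-e_je_i$ ($i\ne j$); identify $x\in\mathbb{R}^m$ with $\sum_j x_je_j$. Let $\partial_x=\sum_j e_j\partial_{x_j}$ be the Dirac operator and $B$ the closed unit ball of $\mathbb{R}^m$. Let $Y_k\neq 0$ be a spherical monogenic of degree $k$, that is, a $\mathbb{C}_m$-valued homogeneous polynomial of degree $k$ with $\partial_xY_k=0$. A Clifford prolate spheroidal wave function (CPSWF) is a $\mathbb{C}_m$-valued function $\psi\not\equiv 0$ of class $C^2$ on $B$ that is an eigenfunction of $$L_cf(x)=\partial_x\big((1-|x|^2)\,\partial_xf(x)\big)+4\pi^2c^2|x|^2f(x).$$ The finite Fourier transform and, for $\alpha\ge -\tfrac12$, the finite Hankel transform are $$\mathcal{G}_cf(x)=\int_{B}f(y)\,e^{2\pi ic\langle x,y\rangle}\,dy,\qquad \mathcal{H}^{(\alpha)}_cf(x)=\sqrt{2\pi}\int_0^1\sqrt{2\pi cxy}\,J_\alpha(2\pi cxy)\,f(y)\,dy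 ,$$ the latter acting on $L^2(0,1)$. (Even case.) Let $\psi_{2N,m}^{k,c}(x)=P_N(|x|^2)Y_k(x)$, $N=0,1,2,\dots$, be CPSWFs, with $P_N$ complex-valued. Then each $\psi_{2N,m}^{k,c}$ is an eigenfunction on $B$ of $\mathcal{G}_c$ for exactly one eigenvalue $\mu_{2N,m}^{k,c}\in\mathbb{C}$, and for every $N$ the function $$\varphi_N(r)=r^{k+\frac{m-1}{2}}P_N(r^2)$$ is an eigenfunction of $\mathcal{H}_c^{(k+\frac m2-1)}$ with eigenvalue $$\gamma_N=(-i)^k\,c^{\frac{m-1}{2}}\,\mu_{2N,m}^{k,c}.$$ Moreover, if the sequence $(\psi_{2N,m}^{k,c})_{N\ge0}$ lists all CPSWFs of the form $P(|x|^2)Y_k(x)$, each exactly once up to a complex scalar factor, then $(\varphi_N)_{N\ge0}$ lists all eigenfunctions of $\mathcal{H}_c^{(k+\frac m2-1)}$, each exactly once up to a complex scalar factor. (Odd case.) Let $\psi_{2N+1,m}^{k,c}(x)=Q_N(|x|^2)\,x\,Y_k(x)$, $N=0,1,2,\dots$, be CPSWFs, with $Q_N$ complex-valued. Then each $\psi_{2N+1,m}^{k,c}$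 is an eigenfunction on $B$ of $\mathcal{G}_c$ for exactly one eigenvalue $\mu_{2N+1,m}^{k,c}\in\mathbb{C}$, and for every $N$ the function $$\varphi_N(r)=r^{k+\frac{m+1}{2}}Q_N(r^2)$$ is an eigenfunction of $\mathcal{H}_c^{(k+\frac m2)}$ with eigenvalue $$\gamma_N=(-i)^{k+1}\,c^{\frac{m-1}{2}}\,\mu_{2N+1,m}^{k,c}.$$ Moreover, if the sequence $(\psi_{2N+1,m}^{k,c})_{N\ge0}$ lists all CPSWFs of the form $Q(|x|^2)\,x\,Y_k(x)$, each exactly once up to a complex scalar factor, then $(\varphi_N)_{N\ge0}$ lists all eigenfunctions of $\mathcal{H}_c^{(k+\frac m2)}$, each exactly once up to a complex scalar factor. -/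

import Mathlib

open Set MeasureTheory

noncomputable section

/-- The quadratic form `z ↦ -∑ z_j ^ 2` on `ℂ^m`. -/
def negForm (m : ℕ) : QuadraticForm ℂ (Fin m → ℂ) :=
  QuadraticMap.weightedSumSquares ℂ (fun _ : Fin m => (-1 : ℂ))

/-- The complex Clifford algebra `ℂ_m`, with `e_j ^ 2 = -1` and `e_i e_j = - e_j e_i`. -/
def ComplexClifford (m : ℕ) : Type := CliffordAlgebra (negForm m)

instance (m : ℕ) : Ring (ComplexClifford m) :=
  inferInstanceAs (Ring (CliffordAlgebra (negForm m)))

instance (m : ℕ) : Algebra ℂ (ComplexClifford m) :=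
  inferInstanceAs (Algebra ℂ (CliffordAlgebra (negForm m)))

/-- The coordinates `λ_A` of `λ = ∑_A λ_A e_A`, where `A` runs over the subsets of `{1, …, m}`
(Mathlib's linear identification of the Clifford algebra with the exterior algebra, which sends
the products `e_A` of orthogonal basis vectors to the corresponding wedge products). -/
def cliffordCoord (m : ℕ) :
    ComplexClifford m ≃ₗ[ℂ] EuclideanSpace ℂ (Finset (Fin m)) :=
  (CliffordAlgebra.equivExterior (negForm m)).trans <|
    (Module.Basis.ExteriorAlgebra (Pi.basisFun ℂ (Fin m))).equivFun.trans
      (WithLp.linearEquiv 2 ℂ (Finset (Fin m) → ℂ)).symm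

/-- The norm `|λ| ^ 2 = ∑_A |λ_A| ^ 2`. -/
instance (m : ℕ) : NormedAddCommGroup (ComplexClifford m) :=
  NormedAddCommGroup.induced (ComplexClifford m) (EuclideanSpace ℂ (Finset (Fin m)))
    (cliffordCoord m) (cliffordCoord m).injective

instance (m : ℕ) : NormedSpace ℂ (ComplexClifford m) :=
  NormedSpace.induced ℂ (ComplexClifford m) (EuclideanSpace ℂ (Finset (Fin m)))
    (cliffordCoord m)

/-- The generator `e_j`. -/
def cliffordE {m : ℕ} (j : Fin m) : ComplexClifford m :=
  CliffordAlgebra.ι (negForm m) (Pi.single j 1)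

/-- The point `x` as the Clifford vector `∑ x_j e_j`. -/
def cliffordVec {m : ℕ} (x : EuclideanSpace ℝ (Fin m)) : ComplexClifford m :=
  ∑ j, (x j : ℂ) • cliffordE j

/-- The Dirac operator `∂_x f = ∑_j e_j ∂f/∂x_j`. -/
def dirac {m : ℕ} (f : EuclideanSpace ℝ (Fin m) → ComplexClifford m)
    (x : EuclideanSpace ℝ (Fin m)) : ComplexClifford m :=
  ∑ j, cliffordE j * fderiv ℝ f x (EuclideanSpace.single j 1)

/-- `Y` is a (left solid inner) spherical monogenic of degree `k`: a homogeneous polynomial of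
degree `k` with coefficients in `ℂ_m` that is annihilated by the Dirac operator. -/
def IsSphericalMonogenic {m : ℕ} (k : ℕ)
    (Y : EuclideanSpace ℝ (Fin m) → ComplexClifford m) : Prop :=
  (∃ a : (Fin m → ℕ) → ComplexClifford m, ∀ x,
    Y x = ∑ n ∈ Finset.piAntidiag Finset.univ k, (∏ j, x j ^ n j) • a n) ∧
  ∀ x, dirac Y x = 0

/-- `L_c f = ∂_x ((1 - |x| ^ 2) ∂_x f) + 4 π ^ 2 c ^ 2 |x| ^ 2 f`. -/
def cliffordL {m : ℕ} (c : ℝ) (f : EuclideanSpace ℝ (Fin m) → ComplexClifford m)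
    (x : EuclideanSpace ℝ (Fin m)) : ComplexClifford m :=
  dirac (fun y => (1 - ‖y‖ ^ 2) • dirac f y) x + (4 * Real.pi ^ 2 * c ^ 2 * ‖x‖ ^ 2) • f x

/-- `ψ` is a Clifford prolate spheroidal wave function: an eigenfunction of `L_c` of class `C^2`
on the closed unit ball. -/
structure IsCPSWF {m : ℕ} (c : ℝ) (ψ : EuclideanSpace ℝ (Fin m) → ComplexClifford m) :
    Prop where
  contDiffOn : ContDiffOn ℝ 2 ψ (Metric.closedBall 0 1)
  nonzero : ∃ x ∈ Metric.closedBall (0 : EuclideanSpace ℝ (Fin m)) 1, ψ x ≠ 0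
  eigen : ∃ χ : ℂ, ∀ x ∈ Metric.ball (0 : EuclideanSpace ℝ (Fin m)) 1,
    cliffordL c ψ x = χ • ψ x

/-- The even form `P(|x| ^ 2) Y(x)`. -/
def evenForm {m : ℕ} (Y : EuclideanSpace ℝ (Fin m) → ComplexClifford m) (P : ℝ → ℂ)
    (x : EuclideanSpace ℝ (Fin m)) : ComplexClifford m :=
  P (‖x‖ ^ 2) • Y x

/-- The odd form `Q(|x| ^ 2) x Y(x)`. -/
def oddForm {m : ℕ} (Y : EuclideanSpace ℝ (Fin m) → ComplexClifford m) (Q : ℝ → ℂ)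
    (x : EuclideanSpace ℝ (Fin m)) : ComplexClifford m :=
  Q (‖x‖ ^ 2) • (cliffordVec x * Y x)

/-- The sequence `P_0, P_1, …` lists every CPSWF of the form `F R` (with `F` the even or the odd
form) exactly once up to a complex scalar. -/
def ListsCPSWF {m : ℕ} (c : ℝ) (F : (ℝ → ℂ) → EuclideanSpace ℝ (Fin m) → ComplexClifford m)
    (P : ℕ → ℝ → ℂ) : Prop :=
  ∀ R : ℝ → ℂ, IsCPSWF c (F R) → ∃! N : ℕ, ∃ a : ℂ,
    ∀ x ∈ Metric.closedBall (0 : EuclideanSpace ℝ (Fin m)) 1, F R x = a • F (P N) x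

/-- The finite Fourier transform
`G_c f (x) = ∫_{|y| ≤ 1} f(y) exp (2 π i c ⟨x, y⟩) dy`. -/
def finiteFourier {m : ℕ} (c : ℝ) (f : EuclideanSpace ℝ (Fin m) → ComplexClifford m)
    (x : EuclideanSpace ℝ (Fin m)) : ComplexClifford m :=
  ∫ y in Metric.closedBall (0 : EuclideanSpace ℝ (Fin m)) 1,
    Complex.exp (2 * Real.pi * Complex.I * c * (inner ℝ x y : ℝ)) • f y

/-- `μ` is the eigenvalue of the finite Fourier transform at `ψ`. -/
def IsFourierEigenvalue {m : ℕ} (c : ℝ) (ψ : EuclideanSpace ℝ (Fin m) → ComplexClifford m)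
    (μ : ℂ) : Prop :=
  ∀ x ∈ Metric.closedBall (0 : EuclideanSpace ℝ (Fin m)) 1, finiteFourier c ψ x = μ • ψ x

/-- The Bessel function of the first kind `J_α(x)` for real order `α > -1` and `x > 0`. -/
def besselJ (α x : ℝ) : ℝ :=
  ∑' n : ℕ, (-1) ^ n / (n.factorial * Real.Gamma (n + α + 1)) * (x / 2) ^ (2 * (n : ℝ) + α)

/-- The finite Hankel transform
`f ↦ √(2π) ∫_0^1 √(2π c x y) J_α(2π c x y) f(y) dy`. -/
def finiteHankel (c α : ℝ) (f : ℝ → ℂ) (x : ℝ) : ℂ :=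
  (Real.sqrt (2 * Real.pi) : ℂ) * ∫ y in Ioc (0 : ℝ) 1,
    ((Real.sqrt (2 * Real.pi * c * x * y) * besselJ α (2 * Real.pi * c * x * y) : ℝ) : ℂ) * f y

/-- `φ` is an eigenfunction of the finite Hankel transform of order `α` in `L^2(0,1)`, with
eigenvalue `γ`; `φ` is taken to be the representative for which the equation holds at every
point of `(0,1]`. -/
structure IsHankelEigenpair (c α : ℝ) (φ : ℝ → ℂ) (γ : ℂ) : Prop where
  memLp : MemLp φ 2 (volume.restrict (Ioc (0 : ℝ) 1))
  nonzero : ¬ φ =ᵐ[volume.restrict (Ioc (0 : ℝ) 1)] 0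
  eigen : ∀ x ∈ Ioc (0 : ℝ) 1, finiteHankel c α φ x = γ * φ x

/-- The sequence `φ_0, φ_1, …` lists every eigenfunction of the finite Hankel transform of order
`α` exactly once up to a complex scalar. -/
def ListsHankel (c α : ℝ) (φ : ℕ → ℝ → ℂ) : Prop :=
  ∀ (f : ℝ → ℂ) (γ : ℂ), IsHankelEigenpair c α f γ → ∃! N : ℕ, ∃ a : ℂ,
    ∀ r ∈ Ioc (0 : ℝ) 1, f r = a * φ N r

end

/-!
The even and the odd case are one statement about an *angular factor* `H`, namely `Y` or `x Y`: a
homogeneous polynomial of degree `d`, harmonic, with `x ∂_x H = -δ H`. Put `β = 2 d + m`,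
`κ = (π c) ^ 2` and `t = |x| ^ 2`.

**Reduction to one variable.** On `P(|x| ^ 2) H(x)` the operator `L_c` acts as `-4 M + 2 δ`, where
`M P = t (1 - t) P'' + (β / 2 - (β / 2 + 1) t) P' - κ t P`
(`IsAngularFactor.cliffordL_radial_smul`). Expanding the exponential and using Hecke's formula for
the moments of a solid harmonic (`IsSolidHarmonic.integral_gaussMonomial`, transported from the
Gaussian to the ball by polar coordinates), the finite Fourier transform of `P(|x| ^ 2) H(x)` is a constant times
`(T P)(|x| ^ 2) H(x)`, where `T P (t) = ∑ b_j (∫₀¹ r ^ (2 j + β - 1) P(r ^ 2) dr) t ^ j` and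
`b_j = (-κ) ^ j / (j! Γ(j + β / 2))` (`IsSolidHarmonic.finiteFourier_eq`). The power series of the
Bessel function shows that the finite Hankel transform of `r ^ ((β - 1) / 2) P(r ^ 2)` is another
constant times `x ^ ((β - 1) / 2) (T P)(x ^ 2)` (`finiteHankel_eq`). Comparing the constants gives
the relation between the eigenvalues.

**Prolate functions are eigenfunctions of `T`.** If `P(|x| ^ 2) H(x)` is a Clifford prolate function
then `P` solves `M P = χ P` and is regular at both singular endpoints
(`IsAngularFactor.radial_of_isCPSWF`). Integrating by parts in the moments, `T P` solves the same
equation. Solutions regular at `t = 1` are proportional, since their weighted Wronskian is constant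
and tends to zero there; hence `T P = τ P` (`IsRadialSolution.exists_fourier_eq_mul`).

**Eigenfunctions of `T` are prolate functions.** Let `γ` be an eigenvalue of the finite Hankel
transform. It is nonzero, because the even moments of a function on `(0, 1]` determine it. An
eigenfunction is therefore `x ^ ((β - 1) / 2) F(x ^ 2)` with `F` entire and `T F = τ F`, `τ ≠ 0`. As
`T` commutes with `M`, it remains to see that `F` is an eigenfunction of `M`.

The key is that an eigenfunction `F ≠ 0` does not vanish at `1`. First, some eigenfunction for `τ`
does not vanish there: `M` preserves the eigenspace, and the values at `1` of the iterates `M ^ n F`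
determine all derivatives of `F` at `1`. Next, `D = t d/dt + β / 4` satisfies
`T D F = F(1) b / 2 - D T F` with `b(t) = ∑ b_j t ^ j`, so that `F(1) = 0` puts `D F ≠ 0` in the
eigenspace of `-τ`. But `F₁(1) F₂(1) = 0` for eigenfunctions `F₁`, `F₂` of eigenvalues `τ`, `-τ`,
so every eigenfunction for `-τ` would vanish at `1`, which the first step excludes. Applied to
`M F - χ F`, with `χ` chosen so that this vanishes at `1`, the key fact gives `M F = χ F`
(`IsRadialEigen.exists_seqProlate_eq`).
-/

/-! ### Entire power series given by their coefficients -/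

/-- The coefficients of a power series with infinite radius of convergence. -/
def IsEntireSeq (a : ℕ → ℂ) : Prop :=
  ∀ R : ℝ, 0 ≤ R → Summable fun n => ‖a n‖ * R ^ n

/-- The sum of the power series with coefficients `a`. -/
noncomputable def powerEval (a : ℕ → ℂ) (z : ℂ) : ℂ := ∑' n, a n * z ^ n

/-- The coefficients of the derivative of a power series. -/
def seqDeriv (a : ℕ → ℂ) (n : ℕ) : ℂ := (n + 1) * a (n + 1)

/-- The coefficients of `z` times a power series. -/
def seqPrev (a : ℕ → ℂ) : ℕ → ℂ
  | 0 => 0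
  | n + 1 => a n

namespace IsEntireSeq

variable {a a' : ℕ → ℂ}

lemma mul_of_norm_le (ha : IsEntireSeq a) {c : ℕ → ℂ} {C K : ℝ} (hK : 0 ≤ K)
    (hc : ∀ n, ‖c n‖ ≤ C * K ^ n) : IsEntireSeq fun n => c n * a n := by
  intro R hR
  refine Summable.of_nonneg_of_le (fun n => by positivity) (fun n => ?_)
    ((ha (K * R) (by positivity)).mul_left C)
  calc ‖c n * a n‖ * R ^ n = ‖c n‖ * (‖a n‖ * R ^ n) := by rw [norm_mul]; ring
    _ ≤ (C * K ^ n) * (‖a n‖ * R ^ n) := by gcongr; exact hc n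
    _ = C * (‖a n‖ * (K * R) ^ n) := by rw [mul_pow]; ring

lemma smul (ha : IsEntireSeq a) (c : ℂ) : IsEntireSeq fun n => c * a n :=
  ha.mul_of_norm_le (C := ‖c‖) zero_le_one (by simp)

lemma add (ha : IsEntireSeq a) (ha' : IsEntireSeq a') : IsEntireSeq fun n => a n + a' n := by
  intro R hR
  refine Summable.of_nonneg_of_le (fun n => by positivity) (fun n => ?_)
    ((ha R hR).add (ha' R hR))
  rw [← add_mul]
  gcongr
  exact norm_add_le _ _

lemma sub (ha : IsEntireSeq a) (ha' : IsEntireSeq a') : IsEntireSeq fun n => a n - a' n := by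
  simpa [sub_eq_add_neg] using ha.add (ha'.smul (-1))

/-- The Euler operator `z d/dz` preserves entire series. -/
lemma euler (ha : IsEntireSeq a) : IsEntireSeq fun n => (n : ℂ) * a n :=
  ha.mul_of_norm_le (C := 1) (K := 2) (by norm_num) fun n => by
    have : (n : ℝ) ≤ 2 ^ n := by exact_mod_cast Nat.lt_two_pow_self.le
    simpa using this

lemma tail (ha : IsEntireSeq a) : IsEntireSeq fun n => a (n + 1) := by
  intro R hR
  refine Summable.of_nonneg_of_le (fun n => by positivity) (fun n => ?_)
    ((summable_nat_add_iff 1).2 (ha (R + 1) (by positivity)))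
  have h1 : R ^ n ≤ (R + 1) ^ n := by gcongr; linarith
  have h2 : (R + 1) ^ n ≤ (R + 1) ^ (n + 1) :=
    pow_le_pow_right₀ (by linarith) (Nat.le_succ n)
  gcongr
  exact h1.trans h2

lemma seqDeriv (ha : IsEntireSeq a) : IsEntireSeq (seqDeriv a) := by
  have h := ha.euler.tail
  simp only [Nat.cast_add, Nat.cast_one] at h
  exact h

lemma iterate_seqDeriv (ha : IsEntireSeq a) (n : ℕ) : IsEntireSeq (_root_.seqDeriv^[n] a) := by
  induction n with
  | zero => exact ha
  | succ n ih => rw [Function.iterate_succ_apply']; exact ih.seqDeriv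

lemma seqPrev (ha : IsEntireSeq a) : IsEntireSeq (seqPrev a) := by
  intro R hR
  rw [← summable_nat_add_iff 1]
  refine ((ha R hR).mul_left R).congr fun n => ?_
  simp only [_root_.seqPrev]; ring

lemma summable_norm_mul_pow (ha : IsEntireSeq a) (z : ℂ) : Summable fun n => ‖a n * z ^ n‖ := by
  simpa using ha ‖z‖ (norm_nonneg z)

lemma summable_mul_pow (ha : IsEntireSeq a) (z : ℂ) : Summable fun n => a n * z ^ n :=
  (ha.summable_norm_mul_pow z).of_norm

lemma summable_norm (ha : IsEntireSeq a) : Summable fun n => ‖a n‖ := by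
  simpa using ha 1 zero_le_one

lemma summable (ha : IsEntireSeq a) : Summable a := ha.summable_norm.of_norm

lemma hasDerivAt (ha : IsEntireSeq a) (z : ℂ) :
    HasDerivAt (powerEval a) (powerEval (_root_.seqDeriv a) z) z := by
  have h0 : (∑' n, a n * ((n : ℂ) * z ^ (n - 1))) = powerEval (_root_.seqDeriv a) z := by
    have hs : Summable fun n => a n * ((n : ℂ) * z ^ (n - 1)) := by
      rw [← summable_nat_add_iff 1]
      refine (ha.seqDeriv.summable_mul_pow z).congr fun n => ?_
      simp [_root_.seqDeriv]; ring
    rw [hs.tsum_eq_zero_add]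
    simp only [powerEval, _root_.seqDeriv]
    simp
    refine tsum_congr fun n => by ring
  rw [← h0]
  set R : ℝ := ‖z‖ + 1
  have hR : 0 ≤ R := by positivity
  refine hasDerivAt_tsum_of_isPreconnected (u := fun n => ‖a n‖ * ((n : ℝ) * R ^ (n - 1)))
    (t := Metric.ball 0 R) (y₀ := 0) ?_ Metric.isOpen_ball (convex_ball _ _).isPreconnected
    (fun n y _ => (hasDerivAt_pow n y).const_mul (a n)) (fun n y hy => ?_) ?_
    (ha.summable_mul_pow 0) ?_
  · rw [← summable_nat_add_iff 1]
    refine (ha.seqDeriv R hR).congr fun n => ?_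
    have : ‖(n : ℂ) + 1‖ = n + 1 := by
      exact_mod_cast Complex.norm_natCast (n + 1)
    simp [_root_.seqDeriv, this]; ring
  · have hy' : ‖y‖ ≤ R := by simpa using (Metric.mem_ball.1 hy).le
    simp only [norm_mul, norm_pow, Complex.norm_natCast]
    gcongr
  · simp [R]; positivity
  · simp [R]

lemma differentiable (ha : IsEntireSeq a) : Differentiable ℂ (powerEval a) :=
  fun z => (ha.hasDerivAt z).differentiableAt

lemma hasDerivAt_ofReal (ha : IsEntireSeq a) (t : ℝ) :
    HasDerivAt (fun s : ℝ => powerEval a s) (powerEval (_root_.seqDeriv a) t) t :=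
  (ha.hasDerivAt t).comp_ofReal

lemma contDiff_ofReal (ha : IsEntireSeq a) {n : WithTop ℕ∞} :
    ContDiff ℝ n (fun s : ℝ => powerEval a s) :=
  (ha.differentiable.contDiff.restrict_scalars ℝ).comp Complex.ofRealCLM.contDiff

lemma iteratedDeriv_powerEval (ha : IsEntireSeq a) (n : ℕ) :
    iteratedDeriv n (powerEval a) = powerEval (_root_.seqDeriv^[n] a) := by
  induction n with
  | zero => simp
  | succ n ih =>
    rw [iteratedDeriv_succ, ih, Function.iterate_succ_apply']
    ext z
    exact ((ha.iterate_seqDeriv n).hasDerivAt z).deriv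

end IsEntireSeq

lemma powerEval_zero (a : ℕ → ℂ) : powerEval a 0 = a 0 := by
  rw [powerEval, tsum_eq_single 0]
  · simp
  · intro n hn; simp [hn]

lemma powerEval_one (a : ℕ → ℂ) : powerEval a 1 = ∑' n, a n := by
  simp [powerEval]

lemma powerEval_smul (a : ℕ → ℂ) (c z : ℂ) :
    powerEval (fun n => c * a n) z = c * powerEval a z := by
  simp [powerEval, mul_assoc, tsum_mul_left]

lemma iterate_seqDeriv_apply_zero (a : ℕ → ℂ) (n k : ℕ) :
    seqDeriv^[n] a k * k.factorial = (n + k).factorial * a (n + k) := by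
  induction n generalizing k with
  | zero => simp [mul_comm]
  | succ n ih =>
    rw [Function.iterate_succ_apply', seqDeriv]
    have := ih (k + 1)
    rw [Nat.factorial_succ k] at this
    push_cast at this
    rw [show n + 1 + k = n + (k + 1) by ring, ← this]
    generalize seqDeriv^[n] a (k + 1) = y
    ring

/-- An entire series all of whose derivatives vanish at some point has zero coefficients. -/
lemma IsEntireSeq.eq_zero_of_derivs {a : ℕ → ℂ} (ha : IsEntireSeq a) (c : ℂ)
    (h : ∀ n, powerEval (_root_.seqDeriv^[n] a) c = 0) (n : ℕ) : a n = 0 := by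
  have h0 : powerEval a = 0 := by
    ext z
    rw [← Complex.taylorSeries_eq_of_entire ha.differentiable c z]
    simp [ha.iteratedDeriv_powerEval, h]
  have h1 := iterate_seqDeriv_apply_zero a n 0
  rw [← powerEval_zero (_root_.seqDeriv^[n] a), ← ha.iteratedDeriv_powerEval, h0] at h1
  have : iteratedDeriv n (0 : ℂ → ℂ) 0 = 0 := by
    simp [Pi.zero_def]
  rw [this] at h1
  simpa [Nat.factorial_ne_zero] using h1.symm

/-- An entire series is determined by its values on `(0, 1]`. -/
lemma IsEntireSeq.eq_zero_of_eqOn {a : ℕ → ℂ} (ha : IsEntireSeq a)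
    (h : ∀ t ∈ Ioc (0 : ℝ) 1, powerEval a t = 0) (n : ℕ) : a n = 0 := by
  have han : AnalyticOnNhd ℂ (powerEval a) univ :=
    ha.differentiable.differentiableOn.analyticOnNhd isOpen_univ
  have hfreq : ∃ᶠ z in nhdsWithin (0 : ℂ) {0}ᶜ, powerEval a z = 0 := by
    have ht : Filter.Tendsto (fun t : ℝ => (t : ℂ)) (nhdsWithin 0 (Ioi 0))
        (nhdsWithin 0 {0}ᶜ) := by
      refine tendsto_nhdsWithin_iff.2 ⟨?_, ?_⟩
      · exact (Complex.continuous_ofReal.tendsto' 0 0 (by simp)).mono_left nhdsWithin_le_nhds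
      · filter_upwards [self_mem_nhdsWithin] with t ht
        simpa using (ne_of_gt ht)
    refine ht.frequently (Filter.Eventually.frequently ?_)
    filter_upwards [Ioc_mem_nhdsGT (zero_lt_one' ℝ)] with t ht using h t ht
  have h0 := han.eqOn_zero_of_preconnected_of_frequently_eq_zero isPreconnected_univ
    (mem_univ 0) hfreq
  refine ha.eq_zero_of_derivs 0 (fun n => ?_) n
  rw [← ha.iteratedDeriv_powerEval, show powerEval a = 0 from funext fun z => h0 (mem_univ z)]
  simp [Pi.zero_def]

/-! ### The radial Fourier operator and the prolate operator on power series -/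

/-- The coefficients `(-κ) ^ j / (j! Γ(j + β / 2))` of the entire function `b` for which
`s ↦ b(s t)` is the kernel of the radial Fourier operator; up to scaling, `b(z ^ 2)` is
`z ^ (1 - β / 2) J_{β / 2 - 1}(2 √κ z)`. -/
noncomputable def besselCoef (β : ℕ) (κ : ℝ) (j : ℕ) : ℂ :=
  (((-κ) ^ j / (j.factorial * Real.Gamma (j + β / 2)) : ℝ) : ℂ)

/-- The moment `∫₀¹ r ^ (2 j + β - 1) F(r ^ 2) dr` of the power series `F = ∑ a_n z ^ n`. -/
noncomputable def seqMoment (β : ℕ) (a : ℕ → ℂ) (j : ℕ) : ℂ :=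
  ∑' n, a n / (2 * n + 2 * j + β)

/-- The prolate operator `t (1 - t) F'' + (β / 2 - (β / 2 + 1) t) F' - κ t F` on coefficients. -/
noncomputable def seqProlate (β : ℕ) (κ : ℝ) (a : ℕ → ℂ) (n : ℕ) : ℂ :=
  (n + β / 2) * seqDeriv a n - n * (n + β / 2) * a n - κ * seqPrev a n

/-- `F = ∑ a_n z ^ n` is in the `τ`-eigenspace of the radial Fourier operator
`F ↦ ∑_j b_j (∫₀¹ r ^ (2 j + β - 1) F(r ^ 2) dr) z ^ j`. -/
structure IsRadialEigen (β : ℕ) (κ : ℝ) (τ : ℂ) (a : ℕ → ℂ) : Prop where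
  entire : IsEntireSeq a
  eigen : ∀ j, besselCoef β κ j * seqMoment β a j = τ * a j

lemma besselCoef_succ {β : ℕ} (hβ : 1 ≤ β) (κ : ℝ) (j : ℕ) :
    (j + 1) * (j + β / 2 : ℂ) * besselCoef β κ (j + 1) = -κ * besselCoef β κ j := by
  have h0 : (0 : ℝ) < j + β / 2 := by
    have : (1 : ℝ) ≤ β := by exact_mod_cast hβ
    positivity
  have h1 : (Real.Gamma (j + β / 2)) ≠ 0 := (Real.Gamma_pos_of_pos h0).ne'
  have h2 : ((j + 1 : ℕ) : ℝ) + β / 2 = (j + β / 2) + 1 := by push_cast; ring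
  have h3 : ((j + 1) * (j + β / 2) * ((-κ) ^ (j + 1) / ((j + 1).factorial *
      Real.Gamma ((j + 1 : ℕ) + β / 2))) : ℝ) =
      -κ * ((-κ) ^ j / (j.factorial * Real.Gamma (j + β / 2))) := by
    rw [h2, Real.Gamma_add_one h0.ne', Nat.factorial_succ]
    push_cast
    have := h0.ne'
    field_simp
    ring
  have h4 := congrArg (fun x : ℝ => (x : ℂ)) h3
  unfold besselCoef
  push_cast at h4 ⊢
  exact h4

lemma besselCoef_ne_zero {β : ℕ} (hβ : 1 ≤ β) {κ : ℝ} (hκ : κ ≠ 0) (j : ℕ) :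
    besselCoef β κ j ≠ 0 := by
  have h0 : (0 : ℝ) < j + β / 2 := by
    have : (1 : ℝ) ≤ β := by exact_mod_cast hβ
    positivity
  have h1 : (Real.Gamma (j + β / 2)) ≠ 0 := (Real.Gamma_pos_of_pos h0).ne'
  unfold besselCoef
  rw [Complex.ofReal_ne_zero]
  exact div_ne_zero (pow_ne_zero _ (neg_ne_zero.2 hκ))
    (mul_ne_zero (Nat.cast_ne_zero.2 (Nat.factorial_ne_zero j)) h1)

lemma isEntireSeq_besselCoef {β : ℕ} (hβ : 1 ≤ β) (κ : ℝ) : IsEntireSeq (besselCoef β κ) := by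
  have hβ' : (1 : ℝ) ≤ β := by exact_mod_cast hβ
  have key : ∀ j, ‖besselCoef β κ j‖ ≤
      ‖besselCoef β κ 0‖ * ((2 * |κ|) ^ j / j.factorial) := by
    intro j
    induction j with
    | zero => simp
    | succ j ih =>
      have h := congrArg norm (besselCoef_succ hβ κ j)
      have e1 : ‖(j + 1 : ℂ)‖ = j + 1 := by exact_mod_cast Complex.norm_natCast (j + 1)
      have e2 : ‖(j + β / 2 : ℂ)‖ = j + β / 2 := by
        have : ((j + β / 2 : ℝ) : ℂ) = (j + β / 2 : ℂ) := by push_cast; ring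
        rw [← this, Complex.norm_real, Real.norm_of_nonneg (by positivity)]
      rw [norm_mul, norm_mul, e1, e2, norm_mul, norm_neg, Complex.norm_real, Real.norm_eq_abs] at h
      have h5 : (1 / 2 : ℝ) ≤ j + β / 2 := by
        have : (0 : ℝ) ≤ j := Nat.cast_nonneg j
        linarith
      have h6 : (j + 1) * (1 / 2 : ℝ) * ‖besselCoef β κ (j + 1)‖ ≤
          |κ| * ‖besselCoef β κ j‖ := by
        rw [← h]; gcongr
      have h7 : ‖besselCoef β κ (j + 1)‖ ≤ 2 * |κ| / (j + 1) * ‖besselCoef β κ j‖ := by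
        rw [div_mul_eq_mul_div, le_div_iff₀ (by positivity)]
        linarith
      refine h7.trans ((mul_le_mul_of_nonneg_left ih (by positivity)).trans (le_of_eq ?_))
      rw [Nat.factorial_succ]
      push_cast
      field_simp
      ring
  intro R hR
  refine Summable.of_nonneg_of_le (fun n => by positivity) (fun n => ?_)
    ((Real.summable_pow_div_factorial (2 * |κ| * R)).mul_left ‖besselCoef β κ 0‖)
  calc _ ≤ ‖besselCoef β κ 0‖ * ((2 * |κ|) ^ n / n.factorial) * R ^ n := by
        gcongr; exact key n
    _ = _ := by rw [mul_pow (2 * |κ|)]; ring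

lemma moment_denom_ne_zero {β : ℕ} (hβ : 1 ≤ β) (n j : ℕ) :
    (2 * n + 2 * j + β : ℂ) ≠ 0 := by
  exact_mod_cast (by omega : 2 * n + 2 * j + β ≠ 0)

lemma norm_div_moment_denom_le {β : ℕ} (hβ : 1 ≤ β) (z : ℂ) (n j : ℕ) :
    ‖z / (2 * n + 2 * j + β)‖ ≤ ‖z‖ := by
  rw [norm_div]
  refine div_le_self (norm_nonneg _) ?_
  have : ‖(2 * n + 2 * j + β : ℂ)‖ = ((2 * n + 2 * j + β : ℕ) : ℝ) := by
    rw [← Complex.norm_natCast]; push_cast; rfl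
  rw [this]
  exact_mod_cast (by omega : 1 ≤ 2 * n + 2 * j + β)

lemma IsEntireSeq.summable_moment {a : ℕ → ℂ} (ha : IsEntireSeq a) {β : ℕ} (hβ : 1 ≤ β) (j : ℕ) :
    Summable fun n => a n / (2 * n + 2 * j + β : ℂ) :=
  ha.summable_norm.of_norm_bounded fun n => norm_div_moment_denom_le hβ (a n) n j

lemma norm_seqMoment_le {β : ℕ} (hβ : 1 ≤ β) {a : ℕ → ℂ} (ha : IsEntireSeq a) (j : ℕ) :
    ‖seqMoment β a j‖ ≤ ∑' n, ‖a n‖ :=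
  tsum_of_norm_bounded ha.summable_norm.hasSum fun n => norm_div_moment_denom_le hβ (a n) n j

lemma IsEntireSeq.seqProlate {a : ℕ → ℂ} (ha : IsEntireSeq a) (β : ℕ) (κ : ℝ) :
    IsEntireSeq (seqProlate β κ a) := by
  have h1 := ha.seqDeriv.euler.add (ha.seqDeriv.smul (β / 2))
  have h2 := ha.euler.euler.add (ha.euler.smul (β / 2))
  have h3 := ha.seqPrev.smul κ
  convert! (h1.sub h2).sub h3 using 2
  unfold _root_.seqProlate
  ring

/-- Integration by parts for the Euler operator `t d/dt`. -/
lemma seqMoment_euler {β : ℕ} (hβ : 1 ≤ β) {a : ℕ → ℂ} (ha : IsEntireSeq a) (j : ℕ) :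
    seqMoment β (fun n => n * a n) j =
      powerEval a 1 / 2 - (j + β / 2) * seqMoment β a j := by
  rw [powerEval_one, seqMoment, seqMoment, ← tsum_mul_left, ← tsum_div_const,
    ← (ha.summable.div_const 2).tsum_sub ((ha.summable_moment hβ j).mul_left _)]
  refine tsum_congr fun n => ?_
  have := moment_denom_ne_zero hβ n j
  -- eliminate `β` in favour of the denominator `D` of the moment
  obtain ⟨D, hD⟩ : ∃ D : ℂ, (β : ℂ) = D - 2 * n - 2 * j := ⟨2 * n + 2 * j + β, by ring⟩
  rw [hD, show 2 * (n : ℂ) + 2 * j + (D - 2 * n - 2 * j) = D by ring] at this ⊢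
  field_simp
  ring

/-- The prolate operator is symmetric: its effect on the moments of a function is the transpose
of its effect on monomials. -/
lemma seqMoment_seqProlate {β : ℕ} (hβ : 1 ≤ β) (κ : ℝ) {a : ℕ → ℂ} (ha : IsEntireSeq a) (j : ℕ) :
    seqMoment β (seqProlate β κ a) j =
      (j : ℂ) * (j + β / 2 - 1) * seqMoment β a (j - 1) -
        j * (j + β / 2) * seqMoment β a j - κ * seqMoment β a (j + 1) := by
  -- the sum `∑ (n - j) / 2 * a n` to which both pairs of matching terms are compared
  have hS : Summable fun n : ℕ => ((n : ℂ) - j) / 2 * a n := by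
    refine ((ha.euler.sub (ha.smul j)).smul (1 / 2)).summable.congr fun n => by ring
  have h1 : Summable fun n : ℕ => (n + β / 2 : ℂ) * seqDeriv a n / (2 * n + 2 * j + β) :=
    ((ha.seqDeriv.euler.add (ha.seqDeriv.smul (β / 2))).summable_moment hβ j).congr
      fun n => by ring
  have h2 : Summable fun n : ℕ => (n : ℂ) * (n + β / 2) * a n / (2 * n + 2 * j + β) :=
    ((ha.euler.euler.add (ha.euler.smul (β / 2))).summable_moment hβ j).congr
      fun n => by ring
  have h3 : Summable fun n : ℕ => κ * seqPrev a n / (2 * n + 2 * j + β : ℂ) :=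
    (ha.seqPrev.smul κ).summable_moment hβ j
  have e0 : seqMoment β (seqProlate β κ a) j =
      (∑' n : ℕ, (n + β / 2 : ℂ) * seqDeriv a n / (2 * n + 2 * j + β)) -
      (∑' n : ℕ, (n : ℂ) * (n + β / 2) * a n / (2 * n + 2 * j + β)) -
      ∑' n : ℕ, κ * seqPrev a n / (2 * n + 2 * j + β : ℂ) := by
    rw [← h1.tsum_sub h2, ← (h1.sub h2).tsum_sub h3]
    refine tsum_congr fun n => ?_
    unfold seqProlate; ring
  have e2 : (∑' n : ℕ, (n : ℂ) * (n + β / 2) * a n / (2 * n + 2 * j + β)) =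
      (∑' n : ℕ, ((n : ℂ) - j) / 2 * a n) + j * (j + β / 2) * seqMoment β a j := by
    rw [seqMoment, ← tsum_mul_left, ← hS.tsum_add ((ha.summable_moment hβ j).mul_left _)]
    refine tsum_congr fun n => ?_
    have := moment_denom_ne_zero hβ n j
    obtain ⟨D, hD⟩ : ∃ D : ℂ, (β : ℂ) = D - 2 * n - 2 * j := ⟨2 * n + 2 * j + β, by ring⟩
    rw [hD, show 2 * (n : ℂ) + 2 * j + (D - 2 * n - 2 * j) = D by ring] at this ⊢
    field_simp
    ring
  have e3 : (∑' n : ℕ, κ * seqPrev a n / (2 * n + 2 * j + β : ℂ)) =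
      κ * seqMoment β a (j + 1) := by
    rw [h3.tsum_eq_zero_add, seqMoment, ← tsum_mul_left]
    simp only [seqPrev, mul_zero, zero_div, zero_add]
    refine tsum_congr fun n => ?_
    push_cast
    rw [mul_div_assoc]
    ring_nf
  have e1 : (∑' n : ℕ, (n + β / 2 : ℂ) * seqDeriv a n / (2 * n + 2 * j + β)) =
      (∑' n : ℕ, ((n : ℂ) - j) / 2 * a n) +
        j * (j + β / 2 - 1) * seqMoment β a (j - 1) := by
    rcases j with _ | j
    · rw [hS.tsum_eq_zero_add]
      simp only [CharP.cast_eq_zero, zero_mul, add_zero, sub_self, zero_div, zero_add]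
      refine tsum_congr fun n => ?_
      have := moment_denom_ne_zero hβ n 0
      simp only [CharP.cast_eq_zero, mul_zero, add_zero] at this
      unfold seqDeriv
      push_cast
      obtain ⟨D, hD⟩ : ∃ D : ℂ, (β : ℂ) = D - 2 * n := ⟨2 * n + β, by ring⟩
      simp only [mul_zero, add_zero]
      rw [hD, show 2 * (n : ℂ) + (D - 2 * n) = D by ring] at this ⊢
      field_simp
      ring
    · rw [seqMoment, ← tsum_mul_left,
        ← hS.tsum_add ((ha.summable_moment hβ (j + 1 - 1)).mul_left _),
        (hS.add ((ha.summable_moment hβ (j + 1 - 1)).mul_left _)).tsum_eq_zero_add]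
      have h00 := moment_denom_ne_zero hβ 0 j
      have e4 : ((0 : ℕ) - (j + 1 : ℕ) : ℂ) / 2 * a 0 + (j + 1 : ℕ) * ((j + 1 : ℕ) + β / 2 - 1) *
          (a 0 / (2 * (0 : ℕ) + 2 * (j + 1 - 1 : ℕ) + β)) = 0 := by
        simp only [Nat.add_sub_cancel]
        push_cast at h00 ⊢
        simp only [mul_zero, zero_add] at h00 ⊢
        obtain ⟨D, hD⟩ : ∃ D : ℂ, (β : ℂ) = D - 2 * j := ⟨2 * j + β, by ring⟩
        rw [hD, show 2 * (j : ℂ) + (D - 2 * j) = D by ring] at h00 ⊢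
        field_simp
        ring
      rw [e4, zero_add]
      refine tsum_congr fun n => ?_
      have := moment_denom_ne_zero hβ n (j + 1)
      simp only [Nat.add_sub_cancel]
      unfold seqDeriv
      push_cast at this ⊢
      obtain ⟨D, hD⟩ : ∃ D : ℂ, (β : ℂ) = D - 2 * n - 2 * (j + 1) :=
        ⟨2 * n + 2 * (j + 1) + β, by ring⟩
      rw [hD, show 2 * (n : ℂ) + 2 * (j + 1) + (D - 2 * n - 2 * (j + 1)) = D by ring] at this ⊢
      rw [show 2 * ((n : ℂ) + 1) + 2 * j + (D - 2 * n - 2 * (j + 1)) = D by ring]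
      field_simp
      ring
  rw [e0, e1, e2, e3]
  ring

/-- The prolate operator commutes with the radial Fourier operator, in the form that it takes for
any sequence of moments. -/
lemma seqProlate_besselCoef_mul {β : ℕ} (hβ : 1 ≤ β) (κ : ℝ) (u : ℕ → ℂ) (j : ℕ) :
    seqProlate β κ (fun i => besselCoef β κ i * u i) j =
      besselCoef β κ j * ((j : ℂ) * (j + β / 2 - 1) * u (j - 1) -
        j * (j + β / 2) * u j - κ * u (j + 1)) := by
  have h := besselCoef_succ hβ κ
  unfold seqProlate seqDeriv
  rcases j with _ | j
  · have h0 := h 0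
    simp only [seqPrev]
    push_cast at h0 ⊢
    linear_combination u (0 + 1) * h0
  · have h0 := h j
    have h1 := h (j + 1)
    simp only [seqPrev, Nat.add_sub_cancel]
    push_cast at h0 h1 ⊢
    linear_combination u (j + 1 + 1) * h1 - u j * h0

namespace IsRadialEigen

variable {β : ℕ} {κ : ℝ} {τ : ℂ} {a a' : ℕ → ℂ}

lemma seqProlate (hβ : 1 ≤ β) (h : IsRadialEigen β κ τ a) :
    IsRadialEigen β κ τ (seqProlate β κ a) := by
  refine ⟨h.entire.seqProlate β κ, fun j => ?_⟩
  rw [seqMoment_seqProlate hβ κ h.entire, ← seqProlate_besselCoef_mul hβ]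
  rw [show (fun i => besselCoef β κ i * seqMoment β a i) = fun i => τ * a i from funext h.eigen]
  unfold _root_.seqProlate seqDeriv
  rcases j with _ | j <;> simp only [seqPrev] <;> ring

lemma smul (h : IsRadialEigen β κ τ a) (c : ℂ) : IsRadialEigen β κ τ fun n => c * a n := by
  refine ⟨h.entire.smul c, fun j => ?_⟩
  have : seqMoment β (fun n => c * a n) j = c * seqMoment β a j := by
    simp only [seqMoment, ← tsum_mul_left, mul_div_assoc]
  rw [this]
  linear_combination c * h.eigen j

lemma sub (hβ : 1 ≤ β) (h : IsRadialEigen β κ τ a) (h' : IsRadialEigen β κ τ a') :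
    IsRadialEigen β κ τ fun n => a n - a' n := by
  refine ⟨h.entire.sub h'.entire, fun j => ?_⟩
  have : seqMoment β (fun n => a n - a' n) j = seqMoment β a j - seqMoment β a' j := by
    simp only [seqMoment]
    rw [← (h.entire.summable_moment hβ j).tsum_sub (h'.entire.summable_moment hβ j)]
    exact tsum_congr fun n => by ring
  rw [this]
  linear_combination h.eigen j - h'.eigen j

end IsRadialEigen

/-- The radial Fourier operator anticommutes with `D = t d/dt + β / 4`, up to a boundary term. -/
lemma seqMoment_symmetricEuler {β : ℕ} {κ : ℝ} {τ : ℂ} {a : ℕ → ℂ} (hβ : 1 ≤ β)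
    (h : IsRadialEigen β κ τ a) (j : ℕ) :
    besselCoef β κ j * seqMoment β (fun n => (n + β / 4) * a n) j =
      besselCoef β κ j * (powerEval a 1 / 2) - τ * ((j + β / 4) * a j) := by
  have : seqMoment β (fun n => (n + β / 4) * a n) j =
      seqMoment β (fun n => n * a n) j + β / 4 * seqMoment β a j := by
    simp only [seqMoment]
    rw [← tsum_mul_left, ← (h.entire.euler.summable_moment hβ j).tsum_add
      ((h.entire.summable_moment hβ j).mul_left _)]
    exact tsum_congr fun n => by ring
  rw [this, seqMoment_euler hβ h.entire]
  linear_combination -(j + β / 4) * h.eigen j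

/-- The pairing `∫₀¹ r ^ (β - 1) F(r ^ 2) G(r ^ 2) dr` is symmetric. -/
lemma tsum_mul_seqMoment_comm {β : ℕ} (hβ : 1 ≤ β) {a a' : ℕ → ℂ} (ha : IsEntireSeq a)
    (ha' : IsEntireSeq a') :
    ∑' j, a j * seqMoment β a' j = ∑' j, a' j * seqMoment β a j := by
  simp only [seqMoment, ← tsum_mul_left]
  have hs : Summable (Function.uncurry fun j n : ℕ => a j * (a' n / (2 * n + 2 * j + β : ℂ))) := by
    refine (ha.summable_norm.mul_of_nonneg ha'.summable_norm (fun _ => norm_nonneg _)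
      fun _ => norm_nonneg _).of_norm_bounded fun p => ?_
    simp only [Function.uncurry, norm_mul]
    gcongr
    exact norm_div_moment_denom_le hβ _ _ _
  refine (Summable.tsum_comm hs).symm.trans ?_
  refine tsum_congr fun n => tsum_congr fun j => ?_
  rw [show (2 * n + 2 * j + β : ℂ) = 2 * j + 2 * n + β by ring]
  ring

/-- Eigenfunctions for opposite eigenvalues cannot both be nonzero at the endpoint `1`. -/
lemma powerEval_one_mul_eq_zero {β : ℕ} {κ : ℝ} {τ : ℂ} {a a' : ℕ → ℂ} (hβ : 1 ≤ β) (hτ : τ ≠ 0)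
    (h : IsRadialEigen β κ τ a) (h' : IsRadialEigen β κ (-τ) a') :
    powerEval a 1 * powerEval a' 1 = 0 := by
  set d : ℕ → ℂ := fun n => (n + β / 4) * a n with hd
  have hde : IsEntireSeq d := by
    convert! h.entire.euler.add (h.entire.smul (β / 4)) using 2
    simp only [hd]; ring
  have hj : ∀ j, a' j * seqMoment β d j =
      powerEval a 1 / 2 * a' j + d j * seqMoment β a' j := by
    intro j
    have e1 := seqMoment_symmetricEuler hβ h j
    have e2 := h'.eigen j
    refine mul_left_cancel₀ hτ ?_
    simp only [hd] at e1 ⊢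
    linear_combination (-seqMoment β a' j) * e1 +
      (seqMoment β (fun n => (n + β / 4) * a n) j - powerEval a 1 / 2) * e2
  have hs : Summable fun j => d j * seqMoment β a' j :=
    (hde.summable_norm.mul_right (∑' n, ‖a' n‖)).of_norm_bounded fun j => by
      rw [norm_mul]; gcongr; exact norm_seqMoment_le hβ h'.entire j
  have hsum := tsum_mul_seqMoment_comm hβ h'.entire hde
  rw [tsum_congr hj, (h'.entire.summable.mul_left _).tsum_add hs, tsum_mul_left,
    ← powerEval_one] at hsum
  linear_combination 2 * hsum

lemma powerEval_one_euler {a : ℕ → ℂ} (ha : IsEntireSeq a) :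
    ∑' n : ℕ, n * a n = powerEval (seqDeriv a) 1 := by
  rw [powerEval_one, ha.euler.summable.tsum_eq_zero_add]
  simp [seqDeriv]

lemma iterate_seqDeriv_seqProlate {β : ℕ} {κ : ℝ} (a : ℕ → ℂ) (n i : ℕ) :
    seqDeriv^[n] (seqProlate β κ a) i =
      (i + n + β / 2) * seqDeriv^[n + 1] a i - (i + n) * (i + n + β / 2) * seqDeriv^[n] a i -
        κ * (seqPrev (seqDeriv^[n] a) i + n * seqDeriv^[n - 1] a i) := by
  induction n generalizing i with
  | zero => simp [seqProlate]
  | succ n ih =>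
    rw [Function.iterate_succ_apply', seqDeriv, ih]
    rw [Function.iterate_succ_apply' _ (n + 1), seqDeriv]
    have hx : ∀ i, seqDeriv^[n + 1] a i = (i + 1) * seqDeriv^[n] a (i + 1) := fun i => by
      rw [Function.iterate_succ_apply', seqDeriv]
    have hy : (i + 1 : ℂ) * (n * seqDeriv^[n - 1] a (i + 1)) = n * seqDeriv^[n] a i := by
      rcases n with _ | n
      · simp
      · rw [Function.iterate_succ_apply', seqDeriv]; simp; ring
    have hz : seqPrev (seqDeriv^[n + 1] a) i = i * seqDeriv^[n] a i := by
      rcases i with _ | i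
      · simp [seqPrev]
      · simp only [seqPrev]; rw [hx]; push_cast; ring
    simp only [Nat.add_sub_cancel]
    rw [hz, hx i]
    simp only [seqPrev]
    push_cast
    linear_combination (-κ : ℂ) * hy

/-- At the endpoint `1`, a derivative of `M F` of order `n` is `-(n + 1) F ^ (n + 1)(1)` plus
terms of lower order, because the leading coefficient of the prolate operator vanishes there. -/
lemma powerEval_one_iterate_seqDeriv_seqProlate {β : ℕ} {κ : ℝ} {a : ℕ → ℂ} (ha : IsEntireSeq a)
    (n : ℕ) :
    powerEval (seqDeriv^[n] (seqProlate β κ a)) 1 =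
      -(n + 1) * powerEval (seqDeriv^[n + 1] a) 1 -
        (n * (n + β / 2) + κ) * powerEval (seqDeriv^[n] a) 1 -
        κ * n * powerEval (seqDeriv^[n - 1] a) 1 := by
  set x := seqDeriv^[n] a with hx
  have hxe : IsEntireSeq x := ha.iterate_seqDeriv n
  have hx1 : seqDeriv^[n + 1] a = seqDeriv x := by rw [Function.iterate_succ_apply']
  set y := seqDeriv^[n - 1] a with hy
  have hye : IsEntireSeq y := ha.iterate_seqDeriv _
  rw [hx1]
  have hi : ∀ i, seqDeriv^[n] (seqProlate β κ a) i =
      ((i : ℂ) * seqDeriv x i + (n + β / 2) * seqDeriv x i) - ((i : ℂ) * ((i : ℂ) * x i) +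
        (2 * n + β / 2) * ((i : ℂ) * x i) + n * (n + β / 2) * x i) -
        (κ * seqPrev x i + κ * n * y i) := by
    intro i
    rw [iterate_seqDeriv_seqProlate, hx1]
    ring
  have e1 : ∑' i : ℕ, (i : ℂ) * ((i : ℂ) * x i) =
      powerEval (seqDeriv (seqDeriv x)) 1 + powerEval (seqDeriv x) 1 := by
    rw [powerEval_one_euler hxe.euler, ← powerEval_one_euler hxe.seqDeriv, powerEval_one,
      powerEval_one, ← hxe.seqDeriv.euler.summable.tsum_add hxe.seqDeriv.summable]
    refine tsum_congr fun i => ?_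
    simp only [seqDeriv]
    push_cast
    ring
  have e2 : ∑' i, seqPrev x i = powerEval x 1 := by
    rw [hxe.seqPrev.summable.tsum_eq_zero_add, powerEval_one]
    simp [seqPrev]
  have s1 := hxe.seqDeriv.euler.summable
  have s2 := hxe.seqDeriv.summable.mul_left ((n : ℂ) + β / 2)
  have s3 := hxe.euler.euler.summable
  have s4 := hxe.euler.summable.mul_left (2 * (n : ℂ) + β / 2)
  have s5 := hxe.summable.mul_left ((n : ℂ) * (n + β / 2))
  have s6 := hxe.seqPrev.summable.mul_left (κ : ℂ)
  have s7 := hye.summable.mul_left ((κ : ℂ) * n)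
  rw [powerEval_one, tsum_congr hi, ((s1.add s2).sub ((s3.add s4).add s5)).tsum_sub (s6.add s7),
    (s1.add s2).tsum_sub ((s3.add s4).add s5), s1.tsum_add s2, (s3.add s4).tsum_add s5,
    s3.tsum_add s4, s6.tsum_add s7, tsum_mul_left, tsum_mul_left, tsum_mul_left, tsum_mul_left,
    tsum_mul_left, e1, e2, powerEval_one_euler hxe, powerEval_one_euler hxe.seqDeriv,
    ← powerEval_one, ← powerEval_one, ← powerEval_one]
  ring

/-- If every eigenfunction for `τ` vanishes at `1`, there is none: the prolate operator preserves
the eigenspace and lowers the order of vanishing at `1`. -/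
lemma eq_zero_of_forall_powerEval_one {β : ℕ} {κ : ℝ} {τ : ℂ} (hβ : 1 ≤ β)
    (hall : ∀ a, IsRadialEigen β κ τ a → powerEval a 1 = 0) {a : ℕ → ℂ}
    (ha : IsRadialEigen β κ τ a) (n : ℕ) : a n = 0 := by
  have key : ∀ n, ∀ i ≤ n, ∀ a, IsRadialEigen β κ τ a → powerEval (seqDeriv^[i] a) 1 = 0 := by
    intro n
    induction n with
    | zero =>
      intro i hi a ha
      rw [Nat.le_zero.1 hi]
      exact hall a ha
    | succ n ih =>
      intro i hi a ha
      rcases Nat.le_succ_iff.1 hi with hi | rfl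
      · exact ih i hi a ha
      · have h := powerEval_one_iterate_seqDeriv_seqProlate (β := β) (κ := κ) ha.entire n
        rw [ih n le_rfl _ (ha.seqProlate hβ), ih n le_rfl a ha, ih (n - 1) (by omega) a ha] at h
        have hn : (n + 1 : ℂ) ≠ 0 := by exact_mod_cast Nat.succ_ne_zero n
        refine mul_left_cancel₀ hn ?_
        linear_combination h
  exact ha.entire.eq_zero_of_derivs 1 (fun n => key n n le_rfl a ha) n

/-- A nonzero eigenfunction `F` with a nonzero eigenvalue `τ` does not vanish at `1`. Otherwise
`t F' + β / 4 F` is a nonzero eigenfunction for `-τ`, whereas at most one of the eigenspaces for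
`τ` and `-τ` contains a function not vanishing at `1`. -/
lemma powerEval_one_ne_zero {β : ℕ} {κ : ℝ} {τ : ℂ} {a : ℕ → ℂ} (hβ : 1 ≤ β) (hτ : τ ≠ 0)
    (ha : IsRadialEigen β κ τ a) (ha0 : a ≠ 0) : powerEval a 1 ≠ 0 := by
  intro h1
  set d : ℕ → ℂ := fun n => (n + β / 4) * a n with hd
  have hde : IsRadialEigen β κ (-τ) d := by
    refine ⟨?_, fun j => ?_⟩
    · convert! ha.entire.euler.add (ha.entire.smul (β / 4)) using 2
      simp only [hd]; ring
    · rw [seqMoment_symmetricEuler hβ ha, h1]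
      simp only [hd]; ring
  have hd0 : d ≠ 0 := by
    intro h0
    refine ha0 (funext fun n => ?_)
    have : (n + β / 4 : ℂ) ≠ 0 := by
      have : (4 * n + β : ℂ) ≠ 0 := by exact_mod_cast (by omega : 4 * n + β ≠ 0)
      intro h
      exact this (by linear_combination 4 * h)
    exact (mul_eq_zero.1 (congrFun h0 n)).resolve_left this
  by_cases hall : ∀ x, IsRadialEigen β κ τ x → powerEval x 1 = 0
  · exact ha0 (funext (eq_zero_of_forall_powerEval_one hβ hall ha))
  · push Not at hall
    obtain ⟨x, hx, hx1⟩ := hall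
    refine hd0 (funext (eq_zero_of_forall_powerEval_one hβ (fun y hy => ?_) hde))
    exact (mul_eq_zero.1 (powerEval_one_mul_eq_zero hβ hτ hx hy)).resolve_left hx1

/-- Eigenfunctions of the radial Fourier operator with nonzero eigenvalue are eigenfunctions of
the prolate operator. -/
theorem IsRadialEigen.exists_seqProlate_eq {β : ℕ} {κ : ℝ} {τ : ℂ} {a : ℕ → ℂ} (hβ : 1 ≤ β)
    (hτ : τ ≠ 0) (ha : IsRadialEigen β κ τ a) :
    ∃ χ : ℂ, ∀ n, _root_.seqProlate β κ a n = χ * a n := by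
  by_cases ha0 : a = 0
  · refine ⟨0, fun n => ?_⟩
    subst ha0
    rcases n with _ | n <;> simp [_root_.seqProlate, seqDeriv, seqPrev]
  have h1 := powerEval_one_ne_zero hβ hτ ha ha0
  set χ := powerEval (_root_.seqProlate β κ a) 1 / powerEval a 1
  refine ⟨χ, fun n => ?_⟩
  have hg := (ha.seqProlate hβ).sub hβ (ha.smul χ)
  by_contra hn
  refine powerEval_one_ne_zero hβ hτ hg (fun h0 => hn (sub_eq_zero.1 (congrFun h0 n))) ?_
  rw [powerEval_one, (ha.entire.seqProlate β κ).summable.tsum_sub (ha.entire.smul χ).summable,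
    tsum_mul_left, ← powerEval_one, ← powerEval_one, div_mul_cancel₀ _ h1, sub_self]

/-! ### The radial prolate equation -/

/-- The value at `t` of the prolate operator `t (1 - t) F'' + (β / 2 - (β / 2 + 1) t) F' - κ t F`
applied to a function with value `f` and first two derivatives `f₁`, `f₂` at `t`. -/
noncomputable def prolateAt (β : ℕ) (κ : ℝ) (t : ℝ) (f f₁ f₂ : ℂ) : ℂ :=
  t * (1 - t) * f₂ + (β / 2 - (β / 2 + 1) * t) * f₁ - κ * t * f

/-- `P` solves the radial prolate equation on `(0, 1)` with parameter `χ`, has derivatives `P₁` and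
`P₂` there, and is `C¹` up to the singular endpoint `1`. -/
structure IsRadialSolution (β : ℕ) (κ : ℝ) (χ : ℂ) (P P₁ P₂ : ℝ → ℂ) : Prop where
  hasDerivAt : ∀ t ∈ Ioo (0 : ℝ) 1, HasDerivAt P (P₁ t) t
  hasDerivAt' : ∀ t ∈ Ioo (0 : ℝ) 1, HasDerivAt P₁ (P₂ t) t
  ode : ∀ t ∈ Ioo (0 : ℝ) 1, prolateAt β κ t (P t) (P₁ t) (P₂ t) = χ * P t
  tendsto_one : ∃ l, Filter.Tendsto P (nhdsWithin 1 (Iio 1)) (nhds l)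
  tendsto_one' : ∃ l, Filter.Tendsto P₁ (nhdsWithin 1 (Iio 1)) (nhds l)

/-- The weighted Wronskian of `F` and `G` in the variable `r = √t`. -/
noncomputable def radialWronskian (β : ℕ) (F F₁ G G₁ : ℝ → ℂ) (r : ℝ) : ℂ :=
  ((r ^ β * (1 - r ^ 2) : ℝ) : ℂ) * (F₁ (r ^ 2) * G (r ^ 2) - F (r ^ 2) * G₁ (r ^ 2))

lemma sq_mem_Ioo {r : ℝ} (hr : r ∈ Ioo (0 : ℝ) 1) : r ^ 2 ∈ Ioo (0 : ℝ) 1 :=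
  ⟨pow_pos hr.1 2, pow_lt_one₀ hr.1.le hr.2 two_ne_zero⟩

/-- Lagrange's identity for the prolate operator. -/
lemma hasDerivAt_radialWronskian {β : ℕ} (hβ : 1 ≤ β) (κ : ℝ) {F F₁ F₂ G G₁ G₂ : ℝ → ℂ} {r : ℝ}
    (hF : HasDerivAt F (F₁ (r ^ 2)) (r ^ 2)) (hF₁ : HasDerivAt F₁ (F₂ (r ^ 2)) (r ^ 2))
    (hG : HasDerivAt G (G₁ (r ^ 2)) (r ^ 2)) (hG₁ : HasDerivAt G₁ (G₂ (r ^ 2)) (r ^ 2)) :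
    HasDerivAt (radialWronskian β F F₁ G G₁)
      (2 * ((r ^ (β - 1) : ℝ) : ℂ) *
        (prolateAt β κ (r ^ 2) (F (r ^ 2)) (F₁ (r ^ 2)) (F₂ (r ^ 2)) * G (r ^ 2) -
          F (r ^ 2) * prolateAt β κ (r ^ 2) (G (r ^ 2)) (G₁ (r ^ 2)) (G₂ (r ^ 2)))) r := by
  have hsq : HasDerivAt (fun r : ℝ => r ^ 2) (2 * r) r := by simpa using hasDerivAt_pow 2 r
  have h1 := ((hasDerivAt_pow β r).mul (hsq.const_sub 1)).ofReal_comp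
  have c : ∀ {H : ℝ → ℂ} {H' : ℂ}, HasDerivAt H H' (r ^ 2) →
      HasDerivAt (fun r => H (r ^ 2)) (2 * r * H') r := fun h => by
    have := HasDerivAt.scomp (h := fun r : ℝ => r ^ 2) r h hsq
    simpa [Function.comp_def] using this
  have h2 := ((c hF₁).mul (c hG)).sub ((c hF).mul (c hG₁))
  refine (h1.mul h2).congr_deriv ?_
  have hb : r ^ β = r ^ (β - 1) * r := by
    rw [← pow_succ]; congr 1; omega
  simp only [prolateAt, Pi.mul_apply, Pi.sub_apply, hb]
  push_cast
  ring

/-- Two solutions that are regular at the endpoint `1` are linearly dependent at every point: the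
Wronskian is constant and tends to `0` at `1`. -/
lemma IsRadialSolution.wronskian_eq_zero {β : ℕ} (hβ : 1 ≤ β) {κ : ℝ} {χ : ℂ}
    {F F₁ F₂ G G₁ G₂ : ℝ → ℂ} (hF : IsRadialSolution β κ χ F F₁ F₂)
    (hG : IsRadialSolution β κ χ G G₁ G₂) {t : ℝ} (ht : t ∈ Ioo (0 : ℝ) 1) :
    F₁ t * G t - F t * G₁ t = 0 := by
  set W := radialWronskian β F F₁ G G₁ with hW
  have hd : ∀ r ∈ Ioo (0 : ℝ) 1, HasDerivAt W 0 r := by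
    intro r hr
    have hr2 := sq_mem_Ioo hr
    refine (hasDerivAt_radialWronskian hβ κ (hF.hasDerivAt _ hr2) (hF.hasDerivAt' _ hr2)
      (hG.hasDerivAt _ hr2) (hG.hasDerivAt' _ hr2)).congr_deriv ?_
    rw [hF.ode _ hr2, hG.ode _ hr2]
    ring
  have hlim : Filter.Tendsto W (nhdsWithin 1 (Iio 1)) (nhds 0) := by
    obtain ⟨l1, h1⟩ := hF.tendsto_one
    obtain ⟨l2, h2⟩ := hF.tendsto_one'
    obtain ⟨l3, h3⟩ := hG.tendsto_one
    obtain ⟨l4, h4⟩ := hG.tendsto_one'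
    have hsq : Filter.Tendsto (fun r : ℝ => r ^ 2) (nhdsWithin 1 (Iio 1))
        (nhdsWithin 1 (Iio 1)) := by
      refine tendsto_nhdsWithin_iff.2 ⟨?_, ?_⟩
      · exact ((continuous_pow 2).tendsto' (1 : ℝ) 1 (by simp)).mono_left nhdsWithin_le_nhds
      · filter_upwards [Ioo_mem_nhdsLT (zero_lt_one' ℝ)] with r hr using (sq_mem_Ioo hr).2
    have h0 : Filter.Tendsto (fun r : ℝ => ((r ^ β * (1 - r ^ 2) : ℝ) : ℂ))
        (nhdsWithin 1 (Iio 1)) (nhds 0) := by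
      have : Continuous fun r : ℝ => ((r ^ β * (1 - r ^ 2) : ℝ) : ℂ) := by fun_prop
      exact (this.tendsto' 1 0 (by simp)).mono_left nhdsWithin_le_nhds
    have := h0.mul (((h2.comp hsq).mul (h3.comp hsq)).sub ((h1.comp hsq).mul (h4.comp hsq)))
    rw [zero_mul] at this
    exact this
  set s := Real.sqrt t
  have hs2 : s ^ 2 = t := Real.sq_sqrt ht.1.le
  have hs : s ∈ Ioo (0 : ℝ) 1 := ⟨Real.sqrt_pos.2 ht.1, by
    rw [Real.sqrt_lt' one_pos]; simpa using ht.2⟩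
  have hconst : ∀ r ∈ Ioo (0 : ℝ) 1, W r = W s := by
    intro r hr
    exact isOpen_Ioo.is_const_of_deriv_eq_zero isPreconnected_Ioo
      (fun x hx => (hd x hx).differentiableAt.differentiableWithinAt)
      (fun x hx => (hd x hx).deriv) hr hs
  have hWs : W s = 0 := by
    refine tendsto_nhds_unique (Filter.Tendsto.congr' ?_ tendsto_const_nhds) hlim
    filter_upwards [Ioo_mem_nhdsLT (zero_lt_one' ℝ)] with r hr using (hconst r hr).symm
  rw [hW, radialWronskian, hs2] at hWs
  refine (mul_eq_zero.1 hWs).resolve_left (Complex.ofReal_ne_zero.2 ?_)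
  have h1 := hs.1
  have h2 : 0 < 1 - t := by linarith [ht.2]
  exact (mul_pos (pow_pos h1 β) h2).ne'

/-- Uniqueness for the prolate equation at a regular point. -/
lemma prolate_eq_zero_of_initial {β : ℕ} {κ : ℝ} {χ : ℂ} {h h₁ h₂ : ℝ → ℂ}
    (hd : ∀ t ∈ Ioo (0 : ℝ) 1, HasDerivAt h (h₁ t) t)
    (hd' : ∀ t ∈ Ioo (0 : ℝ) 1, HasDerivAt h₁ (h₂ t) t)
    (ode : ∀ t ∈ Ioo (0 : ℝ) 1, prolateAt β κ t (h t) (h₁ t) (h₂ t) = χ * h t)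
    {t₀ : ℝ} (ht₀ : t₀ ∈ Ioo (0 : ℝ) 1) (h0 : h t₀ = 0) (h0' : h₁ t₀ = 0)
    {t : ℝ} (ht : t ∈ Ioo (0 : ℝ) 1) : h t = 0 := by
  obtain ⟨a, ha, ha'⟩ := exists_between (lt_min ht₀.1 ht.1)
  obtain ⟨b, hb, hb'⟩ := exists_between (max_lt ht₀.2 ht.2)
  rw [lt_min_iff] at ha'
  rw [max_lt_iff] at hb
  have hsub : ∀ s ∈ Ioo a b, s ∈ Ioo (0 : ℝ) 1 := fun s hs => ⟨ha.trans hs.1, hs.2.trans hb'⟩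
  -- the equation as a first-order system, whose coefficients are bounded on the interval `(a, b)`
  -- because it contains `t₀` and `t` but stays away from the singular points `0` and `1`
  let v : ℝ → ℂ × ℂ → ℂ × ℂ := fun s p =>
    (p.2, (χ * p.1 + κ * s * p.1 - (β / 2 - (β / 2 + 1) * s) * p.2) / (s * (1 - s)))
  set C : ℝ := ‖χ‖ + |κ| + (β + 1) with hC
  set K : ℝ := 1 + C / (a * (1 - b)) with hK
  have hab : 0 < a * (1 - b) := mul_pos ha (by linarith)
  have hC0 : 0 ≤ C := by positivity
  have hK0 : 0 ≤ K := by positivity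
  have hLip : ∀ s ∈ Ioo a b, LipschitzOnWith K.toNNReal (v s) univ := by
    intro s hs
    refine LipschitzOnWith.of_dist_le_mul fun p _ q _ => ?_
    rw [Real.coe_toNNReal _ hK0, dist_eq_norm, dist_eq_norm]
    have hs01 := hsub s hs
    have e : v s p - v s q = ((p - q).2, (χ * (p - q).1 + κ * s * (p - q).1 -
        (β / 2 - (β / 2 + 1) * s) * (p - q).2) / (s * (1 - s))) := by
      refine Prod.ext rfl ?_
      simp only [v, Prod.snd_sub, Prod.fst_sub, ← sub_div]
      congr 1
      ring
    rw [e]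
    set w := p - q
    have hw1 : ‖w.1‖ ≤ ‖w‖ := norm_fst_le w
    have hw2 : ‖w.2‖ ≤ ‖w‖ := norm_snd_le w
    have hden : ‖(s * (1 - s) : ℂ)‖ = s * (1 - s) := by
      have : ((s * (1 - s) : ℝ) : ℂ) = (s * (1 - s) : ℂ) := by push_cast; ring
      rw [← this, Complex.norm_real, Real.norm_of_nonneg]
      exact mul_nonneg hs01.1.le (by linarith [hs01.2])
    have hβs : ‖(β / 2 - (β / 2 + 1) * s : ℂ)‖ ≤ β + 1 := by
      have : ((β / 2 - (β / 2 + 1) * s : ℝ) : ℂ) = (β / 2 - (β / 2 + 1) * s : ℂ) := by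
        push_cast; ring
      rw [← this, Complex.norm_real, Real.norm_eq_abs, abs_le]
      have hβ0 : (0 : ℝ) ≤ β := Nat.cast_nonneg β
      constructor <;> nlinarith [hs01.1, hs01.2]
    have hκs : ‖(κ * s : ℂ)‖ ≤ |κ| := by
      rw [norm_mul, Complex.norm_real, Complex.norm_real, Real.norm_eq_abs,
        Real.norm_of_nonneg hs01.1.le]
      exact mul_le_of_le_one_right (abs_nonneg _) hs01.2.le
    have hnum : ‖χ * w.1 + κ * s * w.1 - (β / 2 - (β / 2 + 1) * s) * w.2‖ ≤ C * ‖w‖ := by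
      refine (norm_sub_le _ _).trans ?_
      refine (add_le_add_left (norm_add_le _ _) _).trans ?_
      rw [norm_mul χ, norm_mul (κ * s : ℂ), norm_mul (β / 2 - (β / 2 + 1) * s : ℂ),
        show C * ‖w‖ = ‖χ‖ * ‖w‖ + |κ| * ‖w‖ + (β + 1) * ‖w‖ by rw [hC]; ring]
      have hβ0 : (0 : ℝ) ≤ β + 1 := by positivity
      exact add_le_add (add_le_add (mul_le_mul_of_nonneg_left hw1 (norm_nonneg _))
        (mul_le_mul hκs hw1 (norm_nonneg _) (abs_nonneg _)))
        (mul_le_mul hβs hw2 (norm_nonneg _) hβ0)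
    rw [Prod.norm_def]
    refine max_le ?_ ?_
    · refine hw2.trans (le_mul_of_one_le_left (norm_nonneg _) ?_)
      rw [hK]
      linarith [div_nonneg hC0 hab.le]
    · rw [norm_div, hden]
      calc _ ≤ C * ‖w‖ / (a * (1 - b)) := by
            have hle : a * (1 - b) ≤ s * (1 - s) :=
              mul_le_mul hs.1.le (by linarith [hs.2]) (by linarith) hs01.1.le
            gcongr
        _ = C / (a * (1 - b)) * ‖w‖ := by ring
        _ ≤ K * ‖w‖ := by gcongr; rw [hK]; linarith
  have := ODE_solution_unique_of_mem_Ioo (v := v) (s := fun _ => univ) (f := fun s => (h s, h₁ s))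
    (g := fun _ => 0) hLip ⟨ha'.1, hb.1⟩ (fun s hs => ⟨?_, mem_univ _⟩)
    (fun s hs => ⟨?_, mem_univ _⟩) (by simp [h0, h0']) ⟨ha'.2, hb.2⟩
  · exact congrArg Prod.fst this
  · have hs01 := hsub s hs
    refine ((hd s hs01).prodMk (hd' s hs01)).congr_deriv (Prod.ext rfl ?_)
    have ho := ode s hs01
    have h1 : (s : ℂ) ≠ 0 := Complex.ofReal_ne_zero.2 hs01.1.ne'
    have h2 : (1 - s : ℂ) ≠ 0 := by
      have : ((1 - s : ℝ) : ℂ) ≠ 0 := Complex.ofReal_ne_zero.2 (by linarith [hs01.2])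
      simpa using this
    simp only [v]
    rw [eq_div_iff (mul_ne_zero h1 h2)]
    unfold prolateAt at ho
    linear_combination ho
  · exact (hasDerivAt_const s (0 : ℂ × ℂ)).congr_deriv
      (Prod.ext (by simp [v]) (by simp [v]))

/-- The solutions that are regular at the endpoint `1` form a line. -/
lemma IsRadialSolution.exists_eq_mul {β : ℕ} (hβ : 1 ≤ β) {κ : ℝ} {χ : ℂ}
    {F F₁ F₂ G G₁ G₂ : ℝ → ℂ} (hF : IsRadialSolution β κ χ F F₁ F₂)
    (hG : IsRadialSolution β κ χ G G₁ G₂) {t₀ : ℝ} (ht₀ : t₀ ∈ Ioo (0 : ℝ) 1) (h0 : G t₀ ≠ 0) :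
    ∃ τ : ℂ, ∀ t ∈ Ioo (0 : ℝ) 1, F t = τ * G t := by
  set τ := F t₀ / G t₀ with hτ
  refine ⟨τ, fun t ht => sub_eq_zero.1 ?_⟩
  refine prolate_eq_zero_of_initial (β := β) (κ := κ) (χ := χ) (h := fun t => F t - τ * G t)
    (h₁ := fun t => F₁ t - τ * G₁ t) (h₂ := fun t => F₂ t - τ * G₂ t)
    (fun t ht => (hF.hasDerivAt t ht).sub ((hG.hasDerivAt t ht).const_mul τ))
    (fun t ht => (hF.hasDerivAt' t ht).sub ((hG.hasDerivAt' t ht).const_mul τ))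
    (fun t ht => ?_) ht₀ ?_ ?_ ht
  · have h1 := hF.ode t ht
    have h2 := hG.ode t ht
    unfold prolateAt at *
    linear_combination h1 - τ * h2
  · simp [hτ, div_mul_cancel₀ _ h0]
  · have := hF.wronskian_eq_zero hβ hG ht₀
    simp only [hτ]
    field_simp
    linear_combination this

lemma powerEval_seqProlate {β : ℕ} {κ : ℝ} {a : ℕ → ℂ} (ha : IsEntireSeq a) (t : ℝ) :
    powerEval (seqProlate β κ a) t = prolateAt β κ t (powerEval a t) (powerEval (seqDeriv a) t)
      (powerEval (seqDeriv (seqDeriv a)) t) := by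
  have he : ∀ {x : ℕ → ℂ}, IsEntireSeq x →
      powerEval (fun n => n * x n) t = t * powerEval (seqDeriv x) t := fun {x} hx => by
    rw [powerEval, (hx.euler.summable_mul_pow t).tsum_eq_zero_add, powerEval, ← tsum_mul_left]
    simp only [seqDeriv, Nat.cast_zero, zero_mul, zero_add]
    refine tsum_congr fun n => ?_
    push_cast; ring
  have hp : powerEval (seqPrev a) t = t * powerEval a t := by
    rw [powerEval, (ha.seqPrev.summable_mul_pow t).tsum_eq_zero_add, powerEval, ← tsum_mul_left]
    simp only [seqPrev, zero_mul, zero_add]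
    exact tsum_congr fun n => by ring
  have hadd : ∀ {x y : ℕ → ℂ}, IsEntireSeq x → IsEntireSeq y →
      powerEval (fun n => x n + y n) t = powerEval x t + powerEval y t := fun {x y} hx hy => by
    rw [powerEval, powerEval, powerEval, ← (hx.summable_mul_pow t).tsum_add (hy.summable_mul_pow t)]
    exact tsum_congr fun n => by ring
  have hd : powerEval (seqDeriv fun n => n * a n) t =
      powerEval (seqDeriv a) t + t * powerEval (seqDeriv (seqDeriv a)) t := by
    rw [← he ha.seqDeriv, ← hadd ha.seqDeriv ha.seqDeriv.euler]
    congr 1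
    ext n
    simp only [seqDeriv]
    push_cast
    ring
  have e : seqProlate β κ a = fun n : ℕ => (((n : ℂ) * seqDeriv a n + β / 2 * seqDeriv a n) +
      (-1) * ((n : ℂ) * (n * a n) + β / 2 * (n * a n))) + (-κ) * seqPrev a n := by
    ext n
    simp only [seqProlate]
    ring
  have s1 := ha.seqDeriv.euler
  have s2 := ha.seqDeriv.smul (β / 2)
  have s3 := ha.euler.euler
  have s4 := ha.euler.smul (β / 2)
  rw [e, hadd ((s1.add s2).add ((s3.add s4).smul (-1))) (ha.seqPrev.smul (-κ)),
    hadd (s1.add s2) ((s3.add s4).smul (-1)), hadd s1 s2, powerEval_smul _ (-1), hadd s3 s4,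
    powerEval_smul, powerEval_smul, powerEval_smul, he ha.euler, he ha.seqDeriv, hd, he ha, hp]
  unfold prolateAt
  ring

lemma IsEntireSeq.isRadialSolution {β : ℕ} {κ : ℝ} {χ : ℂ} {a : ℕ → ℂ} (ha : IsEntireSeq a)
    (h : ∀ n, _root_.seqProlate β κ a n = χ * a n) :
    IsRadialSolution β κ χ (fun t => powerEval a t) (fun t => powerEval (_root_.seqDeriv a) t)
      (fun t => powerEval (_root_.seqDeriv (_root_.seqDeriv a)) t) where
  hasDerivAt t _ := ha.hasDerivAt_ofReal t
  hasDerivAt' t _ := ha.seqDeriv.hasDerivAt_ofReal t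
  ode t _ := by
    rw [← powerEval_seqProlate ha, ← powerEval_smul]
    exact congrArg (fun x => powerEval x t) (funext h)
  tendsto_one := ⟨_, (ha.hasDerivAt_ofReal 1).continuousAt.tendsto.mono_left nhdsWithin_le_nhds⟩
  tendsto_one' :=
    ⟨_, (ha.seqDeriv.hasDerivAt_ofReal 1).continuousAt.tendsto.mono_left nhdsWithin_le_nhds⟩

/-! ### Moments of solutions -/

/-- The moment `∫₀¹ r ^ (2 j + β - 1) P(r ^ 2) dr`. -/
noncomputable def radialMoment (β : ℕ) (P : ℝ → ℂ) (j : ℕ) : ℂ :=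
  ∫ r in Ioc (0 : ℝ) 1, ((r ^ (2 * j) : ℝ) : ℂ) * (((r ^ (β - 1) : ℝ) : ℂ) * P (r ^ 2))

lemma integrableOn_pow_mul {g : ℝ → ℂ} (hg : IntegrableOn g (Ioc 0 1)) (n : ℕ) :
    IntegrableOn (fun r => ((r ^ n : ℝ) : ℂ) * g r) (Ioc 0 1) := by
  refine Integrable.bdd_mul (c := 1) hg (by fun_prop) ?_
  filter_upwards [ae_restrict_mem measurableSet_Ioc] with r hr
  rw [Complex.norm_real, Real.norm_of_nonneg (pow_nonneg hr.1.le n)]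
  exact pow_le_one₀ hr.1.le hr.2

/-- The prolate equation in terms of moments: Lagrange's identity for `P` and the monomial `t ^ j`
is integrated over `(0, 1)`, and the boundary terms vanish by regularity at both endpoints. -/
lemma IsRadialSolution.radialMoment_recursion {β : ℕ} (hβ : 1 ≤ β) {κ : ℝ} {χ : ℂ}
    {P P₁ P₂ : ℝ → ℂ} (hP : IsRadialSolution β κ χ P P₁ P₂)
    (hint : IntegrableOn (fun r : ℝ => ((r ^ (β - 1) : ℝ) : ℂ) * P (r ^ 2)) (Ioc 0 1))
    (h0 : Filter.Tendsto (fun r : ℝ => ((r ^ β : ℝ) : ℂ) * P (r ^ 2)) (nhdsWithin 0 (Ioi 0))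
      (nhds 0))
    (h0' : Filter.Tendsto (fun r : ℝ => ((r ^ β : ℝ) : ℂ) * P₁ (r ^ 2)) (nhdsWithin 0 (Ioi 0))
      (nhds 0)) (j : ℕ) :
    (j : ℂ) * (j + β / 2 - 1) * radialMoment β P (j - 1) -
        j * (j + β / 2) * radialMoment β P j - κ * radialMoment β P (j + 1) =
      χ * radialMoment β P j := by
  set G : ℝ → ℂ := fun t => (t : ℂ) ^ j with hG
  set G₁ : ℝ → ℂ := fun t => j * (t : ℂ) ^ (j - 1) with hG₁
  set G₂ : ℝ → ℂ := fun t => j * (((j - 1 : ℕ) : ℂ) * (t : ℂ) ^ (j - 1 - 1)) with hG₂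
  have dG : ∀ t : ℝ, HasDerivAt G (G₁ t) t := fun t => (hasDerivAt_pow j (t : ℂ)).comp_ofReal
  have dG₁ : ∀ t : ℝ, HasDerivAt G₁ (G₂ t) t := fun t =>
    ((hasDerivAt_pow (j - 1) (t : ℂ)).const_mul (j : ℂ)).comp_ofReal
  have hMG : ∀ t : ℝ, prolateAt β κ t (G t) (G₁ t) (G₂ t) =
      (j : ℂ) * (j + β / 2 - 1) * (t : ℂ) ^ (j - 1) - j * (j + β / 2) * (t : ℂ) ^ j -
        κ * (t : ℂ) ^ (j + 1) := by
    intro t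
    simp only [prolateAt, hG, hG₁, hG₂]
    rcases j with _ | _ | j
    · simp
    · simp; ring
    · simp only [Nat.add_sub_cancel]; push_cast; ring
  set w : ℝ → ℂ := fun r => ((r ^ (β - 1) : ℝ) : ℂ) * P (r ^ 2) with hw
  -- the derivative of the Wronskian of `P` and the monomial `t ^ j`
  set f' : ℝ → ℂ := fun r => 2 * (χ * (((r ^ (2 * j) : ℝ) : ℂ) * w r) -
    ((j : ℂ) * (j + β / 2 - 1) * (((r ^ (2 * (j - 1)) : ℝ) : ℂ) * w r) -
      j * (j + β / 2) * (((r ^ (2 * j) : ℝ) : ℂ) * w r) -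
        κ * (((r ^ (2 * (j + 1)) : ℝ) : ℂ) * w r))) with hf'
  have hderiv : ∀ r ∈ Ioo (0 : ℝ) 1, HasDerivAt (radialWronskian β P P₁ G G₁) (f' r) r := by
    intro r hr
    have hr2 := sq_mem_Ioo hr
    refine (hasDerivAt_radialWronskian hβ κ (hP.hasDerivAt _ hr2) (hP.hasDerivAt' _ hr2)
      (dG _) (dG₁ _)).congr_deriv ?_
    rw [hP.ode _ hr2, hMG]
    simp only [hf', hw, hG]
    push_cast
    ring
  have I1 := integrableOn_pow_mul hint (2 * j)
  have I2 := integrableOn_pow_mul hint (2 * (j - 1))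
  have I3 := integrableOn_pow_mul hint (2 * (j + 1))
  have hfi : IntervalIntegrable f' volume 0 1 := by
    rw [intervalIntegrable_iff_integrableOn_Ioc_of_le zero_le_one]
    exact ((I1.const_mul _).sub (((I2.const_mul _).sub (I1.const_mul _)).sub
      (I3.const_mul _))).const_mul 2
  have hlim0 : Filter.Tendsto (radialWronskian β P P₁ G G₁) (nhdsWithin 0 (Ioi 0)) (nhds 0) := by
    have c1 : Filter.Tendsto (fun r : ℝ => ((1 - r ^ 2 : ℝ) : ℂ) * G (r ^ 2))
        (nhdsWithin 0 (Ioi 0)) (nhds (((1 - 0 ^ 2 : ℝ) : ℂ) * G (0 ^ 2))) := by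
      have : Continuous fun r : ℝ => ((1 - r ^ 2 : ℝ) : ℂ) * G (r ^ 2) := by
        simp only [hG]; fun_prop
      exact (this.tendsto 0).mono_left nhdsWithin_le_nhds
    have c2 : Filter.Tendsto (fun r : ℝ => ((1 - r ^ 2 : ℝ) : ℂ) * G₁ (r ^ 2))
        (nhdsWithin 0 (Ioi 0)) (nhds (((1 - 0 ^ 2 : ℝ) : ℂ) * G₁ (0 ^ 2))) := by
      have : Continuous fun r : ℝ => ((1 - r ^ 2 : ℝ) : ℂ) * G₁ (r ^ 2) := by
        simp only [hG₁]; fun_prop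
      exact (this.tendsto 0).mono_left nhdsWithin_le_nhds
    have := (h0'.mul c1).sub (h0.mul c2)
    rw [zero_mul, zero_mul, sub_zero] at this
    refine this.congr fun r => ?_
    simp only [radialWronskian]
    push_cast
    ring
  have hlim1 : Filter.Tendsto (radialWronskian β P P₁ G G₁) (nhdsWithin 1 (Iio 1)) (nhds 0) := by
    obtain ⟨l1, h1⟩ := hP.tendsto_one
    obtain ⟨l2, h2⟩ := hP.tendsto_one'
    have hsq : Filter.Tendsto (fun r : ℝ => r ^ 2) (nhdsWithin 1 (Iio 1))
        (nhdsWithin 1 (Iio 1)) := by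
      refine tendsto_nhdsWithin_iff.2 ⟨?_, ?_⟩
      · exact ((continuous_pow 2).tendsto' (1 : ℝ) 1 (by simp)).mono_left nhdsWithin_le_nhds
      · filter_upwards [Ioo_mem_nhdsLT (zero_lt_one' ℝ)] with r hr using (sq_mem_Ioo hr).2
    have h0 : Filter.Tendsto (fun r : ℝ => ((r ^ β * (1 - r ^ 2) : ℝ) : ℂ))
        (nhdsWithin 1 (Iio 1)) (nhds 0) := by
      have : Continuous fun r : ℝ => ((r ^ β * (1 - r ^ 2) : ℝ) : ℂ) := by fun_prop
      exact (this.tendsto' 1 0 (by simp)).mono_left nhdsWithin_le_nhds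
    have h3 := (dG 1).continuousAt.tendsto.mono_left (nhdsWithin_le_nhds (s := Iio 1))
    have h4 := (dG₁ 1).continuousAt.tendsto.mono_left (nhdsWithin_le_nhds (s := Iio 1))
    have := h0.mul (((h2.comp hsq).mul (h3.comp hsq)).sub ((h1.comp hsq).mul (h4.comp hsq)))
    rw [zero_mul] at this
    exact this
  have hFTC := intervalIntegral.integral_eq_sub_of_hasDerivAt_of_tendsto zero_lt_one hderiv hfi
    hlim0 hlim1
  rw [intervalIntegral.integral_of_le zero_le_one, sub_zero] at hFTC
  simp only [hf'] at hFTC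
  have J1 : IntegrableOn (fun r => (j : ℂ) * (j + β / 2 - 1) * (((r ^ (2 * (j - 1)) : ℝ) : ℂ) * w r)
      - j * (j + β / 2) * (((r ^ (2 * j) : ℝ) : ℂ) * w r)) (Ioc 0 1) :=
    (I2.const_mul _).sub (I1.const_mul _)
  have J2 : IntegrableOn (fun r => (j : ℂ) * (j + β / 2 - 1) * (((r ^ (2 * (j - 1)) : ℝ) : ℂ) * w r)
      - j * (j + β / 2) * (((r ^ (2 * j) : ℝ) : ℂ) * w r) -
        κ * (((r ^ (2 * (j + 1)) : ℝ) : ℂ) * w r)) (Ioc 0 1) := J1.sub (I3.const_mul _)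
  rw [integral_const_mul, integral_sub (I1.const_mul _) J2, integral_sub J1 (I3.const_mul _),
    integral_sub (I2.const_mul _) (I1.const_mul _),
    integral_const_mul, integral_const_mul, integral_const_mul, integral_const_mul] at hFTC
  simp only [radialMoment]
  linear_combination -hFTC / 2

lemma norm_radialMoment_le {β : ℕ} {P : ℝ → ℂ}
    (hint : IntegrableOn (fun r : ℝ => ((r ^ (β - 1) : ℝ) : ℂ) * P (r ^ 2)) (Ioc 0 1)) (j : ℕ) :
    ‖radialMoment β P j‖ ≤ ∫ r in Ioc (0 : ℝ) 1, ‖((r ^ (β - 1) : ℝ) : ℂ) * P (r ^ 2)‖ := by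
  refine (norm_integral_le_integral_norm _).trans
    (setIntegral_mono_on (integrableOn_pow_mul hint _).norm hint.norm measurableSet_Ioc
      fun r hr => ?_)
  rw [norm_mul, Complex.norm_real, Real.norm_of_nonneg (pow_nonneg hr.1.le _)]
  exact mul_le_of_le_one_left (norm_nonneg _) (pow_le_one₀ hr.1.le hr.2)

lemma isEntireSeq_besselCoef_mul_radialMoment {β : ℕ} (hβ : 1 ≤ β) (κ : ℝ) {P : ℝ → ℂ}
    (hint : IntegrableOn (fun r : ℝ => ((r ^ (β - 1) : ℝ) : ℂ) * P (r ^ 2)) (Ioc 0 1)) :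
    IsEntireSeq fun j => besselCoef β κ j * radialMoment β P j := by
  have := (isEntireSeq_besselCoef hβ κ).mul_of_norm_le (c := radialMoment β P) zero_le_one
    (fun n => by rw [one_pow, mul_one]; exact norm_radialMoment_le hint n)
  convert! this using 2
  ring

/-- A solution of the radial prolate equation that is regular at both endpoints is an
eigenfunction of the radial Fourier operator: its image solves the same equation. -/
theorem IsRadialSolution.exists_fourier_eq_mul {β : ℕ} (hβ : 1 ≤ β) {κ : ℝ} {χ : ℂ}
    {P P₁ P₂ : ℝ → ℂ} (hP : IsRadialSolution β κ χ P P₁ P₂)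
    (hint : IntegrableOn (fun r : ℝ => ((r ^ (β - 1) : ℝ) : ℂ) * P (r ^ 2)) (Ioc 0 1))
    (h0 : Filter.Tendsto (fun r : ℝ => ((r ^ β : ℝ) : ℂ) * P (r ^ 2)) (nhdsWithin 0 (Ioi 0))
      (nhds 0))
    (h0' : Filter.Tendsto (fun r : ℝ => ((r ^ β : ℝ) : ℂ) * P₁ (r ^ 2)) (nhdsWithin 0 (Ioi 0))
      (nhds 0)) {t₀ : ℝ} (ht₀ : t₀ ∈ Ioo (0 : ℝ) 1) (hPt₀ : P t₀ ≠ 0) :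
    ∃ τ : ℂ, ∀ t ∈ Ioo (0 : ℝ) 1,
      powerEval (fun j => besselCoef β κ j * radialMoment β P j) t = τ * P t := by
  have ha := isEntireSeq_besselCoef_mul_radialMoment hβ κ hint
  have hM : ∀ n, seqProlate β κ (fun j => besselCoef β κ j * radialMoment β P j) n =
      χ * (besselCoef β κ n * radialMoment β P n) := by
    intro n
    rw [seqProlate_besselCoef_mul hβ, hP.radialMoment_recursion hβ hint h0 h0']
    ring
  exact (ha.isRadialSolution hM).exists_eq_mul hβ hP ht₀ hPt₀

/-! ### Calculus of the Dirac operator -/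

instance (m : ℕ) : FiniteDimensional ℂ (ComplexClifford m) :=
  (cliffordCoord m).symm.finiteDimensional

instance (m : ℕ) : FiniteDimensional ℝ (ComplexClifford m) :=
  FiniteDimensional.complexToReal _

instance (m : ℕ) : CompleteSpace (ComplexClifford m) :=
  FiniteDimensional.complete ℂ _

section Clifford

variable {m : ℕ}

lemma cliffordVec_eq_ι (x : EuclideanSpace ℝ (Fin m)) :
    cliffordVec x = CliffordAlgebra.ι (negForm m) (fun j => (x j : ℂ)) := by
  have : (fun j => (x j : ℂ)) = ∑ j, (x j : ℂ) • (Pi.single j 1 : Fin m → ℂ) := by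
    ext i
    simp [Finset.sum_apply, Pi.single_apply]
  rw [this, map_sum]
  simp only [map_smul]
  rfl

lemma cliffordVec_mul_self (x : EuclideanSpace ℝ (Fin m)) :
    cliffordVec x * cliffordVec x = (-(‖x‖ ^ 2 : ℝ) : ℂ) • (1 : ComplexClifford m) := by
  have h := CliffordAlgebra.ι_sq_scalar (negForm m) (fun j => (x j : ℂ))
  have hQ : negForm m (fun j => (x j : ℂ)) = (-(‖x‖ ^ 2 : ℝ) : ℂ) := by
    rw [EuclideanSpace.real_norm_sq_eq]
    simp [negForm, QuadraticMap.weightedSumSquares_apply, pow_two]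
  rw [cliffordVec_eq_ι, ← Algebra.algebraMap_eq_smul_one, ← hQ]
  exact h

lemma cliffordE_mul_cliffordVec (j : Fin m) (x : EuclideanSpace ℝ (Fin m)) :
    cliffordE j * cliffordVec x =
      -(cliffordVec x * cliffordE j) - (2 * x j : ℂ) • (1 : ComplexClifford m) := by
  have h := CliffordAlgebra.ι_mul_ι_add_swap (Q := negForm m) (Pi.single j 1)
    (fun j => (x j : ℂ))
  have hQ : QuadraticMap.polar (negForm m) (Pi.single j 1) (fun j => (x j : ℂ)) =
      -(2 * x j : ℂ) := by
    simp only [QuadraticMap.polar, negForm, QuadraticMap.weightedSumSquares_apply, Pi.add_apply,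
      smul_eq_mul]
    rw [← Finset.sum_sub_distrib, ← Finset.sum_sub_distrib, Finset.sum_eq_single j]
    · simp; ring
    · intro i _ hi
      simp [hi]
    · simp
  rw [hQ, Algebra.algebraMap_eq_smul_one] at h
  have h' : cliffordE j * cliffordVec x + cliffordVec x * cliffordE j =
      -(2 * x j : ℂ) • (1 : ComplexClifford m) := by
    rw [cliffordVec_eq_ι]
    exact h
  rw [neg_smul] at h'
  rw [eq_sub_iff_add_eq, eq_neg_iff_add_eq_zero, add_right_comm, h', neg_add_cancel]

lemma cliffordE_mul_self (j : Fin m) : (cliffordE j * cliffordE j : ComplexClifford m) = -1 := by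
  have h := CliffordAlgebra.ι_sq_scalar (negForm m) (Pi.single j 1)
  have hQ : negForm m (Pi.single j 1) = -1 := by
    simp [negForm, QuadraticMap.weightedSumSquares_apply, Pi.single_apply]
  rw [hQ, map_neg, map_one] at h
  exact h

lemma cliffordVec_single (j : Fin m) :
    cliffordVec (EuclideanSpace.single j (1 : ℝ)) = (cliffordE j : ComplexClifford m) := by
  unfold cliffordVec
  rw [Finset.sum_eq_single j] <;> simp +contextual

lemma cliffordE_mul_add_swap (i j : Fin m) :
    (cliffordE i * cliffordE j + cliffordE j * cliffordE i : ComplexClifford m) =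
      if i = j then (-2 : ℂ) • 1 else 0 := by
  have h := cliffordE_mul_cliffordVec i (EuclideanSpace.single j (1 : ℝ))
  rw [cliffordVec_single] at h
  rw [h]
  split_ifs with hij
  · subst hij
    simp only [PiLp.single_apply, if_true, Complex.ofReal_one, mul_one, neg_smul]
    abel
  · simp [hij]

/-- Left multiplication by a Clifford number, as a continuous real-linear map. -/
noncomputable def cliffordMulLeft (a : ComplexClifford m) :
    ComplexClifford m →L[ℝ] ComplexClifford m :=
  LinearMap.toContinuousLinearMap ((LinearMap.mulLeft ℂ a).restrictScalars ℝ)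

@[simp]
lemma cliffordMulLeft_apply (a b : ComplexClifford m) : cliffordMulLeft a b = a * b := rfl

lemma cliffordVec_mul (x : EuclideanSpace ℝ (Fin m)) (a : ComplexClifford m) :
    cliffordVec x * a = ∑ i, x i • cliffordMulLeft (cliffordE i) a := by
  simp [cliffordVec, Finset.sum_mul, ← Complex.coe_smul]

lemma hasFDerivAt_cliffordVec_mul {Z : EuclideanSpace ℝ (Fin m) → ComplexClifford m}
    {x : EuclideanSpace ℝ (Fin m)} (hZ : DifferentiableAt ℝ Z x) :
    HasFDerivAt (fun y => cliffordVec y * Z y)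
      (∑ i, (x i • (cliffordMulLeft (cliffordE i)).comp (fderiv ℝ Z x) +
        (EuclideanSpace.proj i : EuclideanSpace ℝ (Fin m) →L[ℝ] ℝ).smulRight
          (cliffordMulLeft (cliffordE i) (Z x)))) x := by
  simp only [cliffordVec_mul]
  refine HasFDerivAt.fun_sum fun i _ => ?_
  exact (EuclideanSpace.proj (𝕜 := ℝ) i).hasFDerivAt.smul
    ((cliffordMulLeft (cliffordE i)).hasFDerivAt.comp x hZ.hasFDerivAt)

lemma fderiv_cliffordVec_mul_apply {Z : EuclideanSpace ℝ (Fin m) → ComplexClifford m}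
    {x : EuclideanSpace ℝ (Fin m)} (hZ : DifferentiableAt ℝ Z x)
    (v : EuclideanSpace ℝ (Fin m)) :
    fderiv ℝ (fun y => cliffordVec y * Z y) x v =
      cliffordVec v * Z x + cliffordVec x * fderiv ℝ Z x v := by
  rw [(hasFDerivAt_cliffordVec_mul hZ).fderiv, cliffordVec_mul, cliffordVec_mul,
    ← Finset.sum_add_distrib]
  simp [add_comm]

lemma sum_smul_fderiv_single {V : Type*} [NormedAddCommGroup V] [NormedSpace ℝ V]
    (L : EuclideanSpace ℝ (Fin m) →L[ℝ] V) (x : EuclideanSpace ℝ (Fin m)) :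
    ∑ j, x j • L (EuclideanSpace.single j 1) = L x := by
  simp only [← map_smul, ← map_sum]
  congr 1
  ext i
  simp [Pi.single_apply]

/-- `∂_x (x Z) = -m Z - 2 E Z - x ∂_x Z`, with `E` the Euler operator. -/
lemma dirac_cliffordVec_mul {Z : EuclideanSpace ℝ (Fin m) → ComplexClifford m}
    {x : EuclideanSpace ℝ (Fin m)} (hZ : DifferentiableAt ℝ Z x) :
    dirac (fun y => cliffordVec y * Z y) x =
      -((m : ℂ) • Z x) - (2 : ℂ) • fderiv ℝ Z x x - cliffordVec x * dirac Z x := by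
  have hj : ∀ j : Fin m, cliffordE j * fderiv ℝ (fun y => cliffordVec y * Z y) x
      (EuclideanSpace.single j 1) = -Z x - (2 : ℂ) • (x j • fderiv ℝ Z x
        (EuclideanSpace.single j 1)) - cliffordVec x * (cliffordE j * fderiv ℝ Z x
        (EuclideanSpace.single j 1)) := by
    intro j
    rw [fderiv_cliffordVec_mul_apply hZ, cliffordVec_single, mul_add, ← mul_assoc, ← mul_assoc,
      cliffordE_mul_self, cliffordE_mul_cliffordVec, sub_mul, neg_mul, neg_mul, one_mul,
      smul_mul_assoc, one_mul, mul_assoc, ← Complex.coe_smul (x j), smul_smul]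
    abel
  rw [← sum_smul_fderiv_single (fderiv ℝ Z x) x]
  unfold dirac
  simp only [hj, Finset.sum_sub_distrib, Finset.mul_sum, Finset.smul_sum]
  simp [← Nat.cast_smul_eq_nsmul ℂ]

/-- `∂_x (g(|x| ^ 2) Z) = 2 g'(|x| ^ 2) x Z + g(|x| ^ 2) ∂_x Z`. -/
lemma dirac_radial_smul {g : ℝ → ℂ} {g' : ℂ}
    {Z : EuclideanSpace ℝ (Fin m) → ComplexClifford m} {x : EuclideanSpace ℝ (Fin m)}
    (hg : HasDerivAt g g' (‖x‖ ^ 2)) (hZ : DifferentiableAt ℝ Z x) :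
    DifferentiableAt ℝ (fun y => g (‖y‖ ^ 2) • Z y) x ∧
    dirac (fun y => g (‖y‖ ^ 2) • Z y) x =
      (2 * g') • (cliffordVec x * Z x) + g (‖x‖ ^ 2) • dirac Z x := by
  have h1 : HasFDerivAt (fun y : EuclideanSpace ℝ (Fin m) => g (‖y‖ ^ 2))
      (((2 : ℝ) • innerSL ℝ x).smulRight g') x := by
    have hn : HasFDerivAt (fun y : EuclideanSpace ℝ (Fin m) => ‖y‖ ^ 2)
        ((2 : ℝ) • innerSL ℝ x) x := by
      have := (hasStrictFDerivAt_norm_sq x).hasFDerivAt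
      rwa [← Nat.cast_smul_eq_nsmul ℝ, Nat.cast_ofNat] at this
    exact (HasFDerivAt.comp (f := fun y : EuclideanSpace ℝ (Fin m) => ‖y‖ ^ 2) x
      hg.hasFDerivAt hn).congr_fderiv (by ext v; simp [mul_assoc])
  have h2 : HasFDerivAt (fun y => g (‖y‖ ^ 2) • Z y) (g (‖x‖ ^ 2) • fderiv ℝ Z x +
      (((2 : ℝ) • innerSL ℝ x).smulRight g').smulRight (Z x)) x := h1.smul hZ.hasFDerivAt
  refine ⟨h2.differentiableAt, ?_⟩
  have hj : ∀ j : Fin m, cliffordE j * fderiv ℝ (fun y => g (‖y‖ ^ 2) • Z y) x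
      (EuclideanSpace.single j 1) = (2 * g') • (((x j : ℂ) • cliffordE j) * Z x) +
        g (‖x‖ ^ 2) • (cliffordE j * fderiv ℝ Z x (EuclideanSpace.single j 1)) := by
    intro j
    rw [h2.fderiv]
    simp only [add_apply, smul_apply,
      ContinuousLinearMap.smulRight_apply, innerSL_apply_apply]
    rw [mul_add, add_comm, mul_smul_comm, smul_mul_assoc, smul_smul, mul_smul_comm]
    congr 2
    simp [EuclideanSpace.inner_single_right]
    ring
  unfold dirac
  simp only [hj, Finset.sum_add_distrib, ← Finset.smul_sum]
  rw [← Finset.sum_mul]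
  rfl

end Clifford

/-! ### Spherical monogenics and solid harmonics -/

/-- A smooth homogeneous harmonic function of degree `d` with values in a normed space. -/
structure IsSolidHarmonic {m : ℕ} {V : Type*} [NormedAddCommGroup V] [NormedSpace ℝ V] (d : ℕ)
    (H : EuclideanSpace ℝ (Fin m) → V) : Prop where
  contDiff : ContDiff ℝ (⊤ : ℕ∞) H
  homogeneous : ∀ (s : ℝ) (x : EuclideanSpace ℝ (Fin m)), H (s • x) = s ^ d • H x
  laplacian : ∀ x, ∑ j, fderiv ℝ (fderiv ℝ H) x (EuclideanSpace.single j 1)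
    (EuclideanSpace.single j 1) = 0

/-- The angular factors of the even and of the odd Clifford prolate functions: homogeneous of
degree `d`, annihilated by `∂_x ^ 2`, and eigenfunctions of `x ∂_x` for the eigenvalue `-δ`. -/
structure IsAngularFactor {m : ℕ} (d : ℕ) (δ : ℂ)
    (H : EuclideanSpace ℝ (Fin m) → ComplexClifford m) : Prop where
  contDiff : ContDiff ℝ (⊤ : ℕ∞) H
  homogeneous : ∀ (s : ℝ) (x : EuclideanSpace ℝ (Fin m)), H (s • x) = s ^ d • H x
  dirac_dirac : ∀ x, dirac (dirac H) x = 0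
  vec_dirac : ∀ x, cliffordVec x * dirac H x = -δ • H x
  ne_zero : H ≠ 0

section Angular

variable {m : ℕ}

lemma fderiv_apply_self_of_homogeneous {V : Type*} [NormedAddCommGroup V] [NormedSpace ℝ V] {d : ℕ}
    {H : EuclideanSpace ℝ (Fin m) → V} {x : EuclideanSpace ℝ (Fin m)}
    (hd : DifferentiableAt ℝ H x) (hH : ∀ s : ℝ, H (s • x) = s ^ d • H x) :
    fderiv ℝ H x x = (d : ℝ) • H x := by
  have h1 : HasDerivAt (fun s : ℝ => H (s • x)) (fderiv ℝ H x x) 1 := by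
    have hs : HasDerivAt (fun s : ℝ => s • x) x 1 := by
      simpa using (hasDerivAt_id (1 : ℝ)).smul_const x
    exact HasFDerivAt.comp_hasDerivAt (f := fun s : ℝ => s • x) 1
      (by simpa using hd.hasFDerivAt) hs
  have h2 : HasDerivAt (fun s : ℝ => H (s • x)) ((d : ℝ) • H x) 1 := by
    simp only [hH]
    simpa using (hasDerivAt_pow d (1 : ℝ)).smul_const (H x)
  exact h1.unique h2

lemma exists_norm_eq_one_of_homogeneous {V : Type*} [NormedAddCommGroup V] [NormedSpace ℝ V]
    (hm : 1 ≤ m) {d : ℕ} {H : EuclideanSpace ℝ (Fin m) → V}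
    (hH : ∀ (s : ℝ) (x : EuclideanSpace ℝ (Fin m)), H (s • x) = s ^ d • H x) (h0 : H ≠ 0) :
    ∃ x, ‖x‖ = 1 ∧ H x ≠ 0 := by
  obtain ⟨x, hx⟩ := Function.ne_iff.1 h0
  rw [Pi.zero_apply] at hx
  by_cases hx0 : x = 0
  · refine ⟨EuclideanSpace.single ⟨0, hm⟩ 1, by simp, fun h => hx ?_⟩
    have := hH 0 (EuclideanSpace.single ⟨0, hm⟩ 1)
    rwa [h, smul_zero, zero_smul, ← hx0] at this
  · refine ⟨‖x‖⁻¹ • x, ?_, ?_⟩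
    · rw [norm_smul, norm_inv, norm_norm, inv_mul_cancel₀ (norm_ne_zero_iff.2 hx0)]
    · rw [hH]
      exact smul_ne_zero (pow_ne_zero _ (inv_ne_zero (norm_ne_zero_iff.2 hx0))) hx

lemma contDiff_dirac {Z : EuclideanSpace ℝ (Fin m) → ComplexClifford m}
    (hZ : ContDiff ℝ (⊤ : ℕ∞) Z) : ContDiff ℝ (⊤ : ℕ∞) (dirac Z) := by
  have h1 : ContDiff ℝ (⊤ : ℕ∞) (fderiv ℝ Z) := hZ.fderiv_right (by exact_mod_cast le_top)
  exact ContDiff.sum fun j _ =>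
    (cliffordMulLeft (cliffordE j)).contDiff.comp (h1.clm_apply contDiff_const)

lemma contDiff_cliffordVec_mul {Z : EuclideanSpace ℝ (Fin m) → ComplexClifford m}
    (hZ : ContDiff ℝ (⊤ : ℕ∞) Z) : ContDiff ℝ (⊤ : ℕ∞) (fun y => cliffordVec y * Z y) := by
  simp only [cliffordVec_mul]
  exact ContDiff.sum fun i _ => (EuclideanSpace.proj (𝕜 := ℝ) i).contDiff.smul
    ((cliffordMulLeft (cliffordE i)).contDiff.comp hZ)

lemma dirac_smul_const (c : ℂ) {Z : EuclideanSpace ℝ (Fin m) → ComplexClifford m}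
    {x : EuclideanSpace ℝ (Fin m)} (hZ : DifferentiableAt ℝ Z x) :
    dirac (fun y => c • Z y) x = c • dirac Z x := by
  unfold dirac
  rw [Finset.smul_sum]
  refine Finset.sum_congr rfl fun j _ => ?_
  rw [fderiv_fun_const_smul hZ]
  simp

lemma dirac_add {Z W : EuclideanSpace ℝ (Fin m) → ComplexClifford m}
    {x : EuclideanSpace ℝ (Fin m)} (hZ : DifferentiableAt ℝ Z x) (hW : DifferentiableAt ℝ W x) :
    dirac (fun y => Z y + W y) x = dirac Z x + dirac W x := by
  unfold dirac
  rw [fderiv_fun_add hZ hW, ← Finset.sum_add_distrib]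
  exact Finset.sum_congr rfl fun j _ => mul_add _ _ _

lemma dirac_congr {Z W : EuclideanSpace ℝ (Fin m) → ComplexClifford m}
    {x : EuclideanSpace ℝ (Fin m)} (h : Z =ᶠ[nhds x] W) : dirac Z x = dirac W x := by
  unfold dirac
  rw [h.fderiv_eq]

/-- The square of the Dirac operator is minus the Laplacian. -/
lemma dirac_dirac_eq_neg_laplacian {Z : EuclideanSpace ℝ (Fin m) → ComplexClifford m}
    (hZ : ContDiff ℝ (⊤ : ℕ∞) Z) (x : EuclideanSpace ℝ (Fin m)) :
    dirac (dirac Z) x = -∑ j, fderiv ℝ (fderiv ℝ Z) x (EuclideanSpace.single j 1)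
      (EuclideanSpace.single j 1) := by
  have h1 : ContDiff ℝ (⊤ : ℕ∞) (fderiv ℝ Z) := hZ.fderiv_right (by exact_mod_cast le_top)
  have hd : ∀ y, DifferentiableAt ℝ (fderiv ℝ Z) y := fun y =>
    (h1.differentiable (by simp)) y
  set D : Fin m → Fin m → ComplexClifford m := fun j i =>
    fderiv ℝ (fderiv ℝ Z) x (EuclideanSpace.single j 1) (EuclideanSpace.single i 1) with hD
  have hsm : minSmoothness ℝ 2 ≤ ((⊤ : ℕ∞) : WithTop ℕ∞) := by
    rw [minSmoothness_of_isRCLikeNormedField]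
    exact WithTop.coe_le_coe.2 (le_top : (2 : ℕ∞) ≤ ⊤)
  have hsymm : ∀ i j, D i j = D j i := fun i j =>
    (hZ.contDiffAt.isSymmSndFDerivAt hsm).eq _ _
  have hi : ∀ j, fderiv ℝ (dirac Z) x (EuclideanSpace.single j 1) =
      ∑ i, cliffordE i * D j i := by
    intro j
    have : HasFDerivAt (dirac Z) (∑ i, (cliffordMulLeft (cliffordE i)).comp
        ((fderiv ℝ (fderiv ℝ Z) x).flip (EuclideanSpace.single i 1))) x := by
      refine HasFDerivAt.fun_sum fun i _ => ?_
      refine (cliffordMulLeft (cliffordE i)).hasFDerivAt.comp x ?_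
      simpa using (hd x).hasFDerivAt.clm_apply
        (hasFDerivAt_const (EuclideanSpace.single i (1 : ℝ)) x)
    rw [this.fderiv]
    simp [hD]
  have e1 : dirac (dirac Z) x = ∑ j, ∑ i, cliffordE j * (cliffordE i * D j i) := by
    unfold dirac at hi ⊢
    simp only [hi, Finset.mul_sum]
  have e2 : dirac (dirac Z) x = ∑ j, ∑ i, cliffordE i * (cliffordE j * D j i) := by
    rw [e1, Finset.sum_comm]
    refine Finset.sum_congr rfl fun j _ => Finset.sum_congr rfl fun i _ => ?_
    rw [hsymm]
  have e3 : (2 : ℂ) • dirac (dirac Z) x = -((2 : ℂ) • ∑ j, D j j) := by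
    rw [two_smul]
    nth_rewrite 1 [e1]
    rw [e2, ← Finset.sum_add_distrib, Finset.smul_sum, ← Finset.sum_neg_distrib]
    refine Finset.sum_congr rfl fun j _ => ?_
    rw [← Finset.sum_add_distrib, Finset.sum_eq_single j]
    · rw [← mul_assoc, ← add_mul, cliffordE_mul_add_swap]
      simp
    · intro i _ hij
      rw [← mul_assoc, ← mul_assoc, ← add_mul, cliffordE_mul_add_swap, if_neg hij.symm, zero_mul]
    · simp
  rw [← smul_neg] at e3
  exact smul_right_injective _ (two_ne_zero' ℂ) e3

lemma IsAngularFactor.isSolidHarmonic {d : ℕ} {δ : ℂ}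
    {H : EuclideanSpace ℝ (Fin m) → ComplexClifford m} (hH : IsAngularFactor d δ H) :
    IsSolidHarmonic d H where
  contDiff := hH.contDiff
  homogeneous := hH.homogeneous
  laplacian x := by
    have := hH.dirac_dirac x
    rwa [dirac_dirac_eq_neg_laplacian hH.contDiff, neg_eq_zero] at this

lemma IsSphericalMonogenic.isAngularFactor {k : ℕ}
    {Y : EuclideanSpace ℝ (Fin m) → ComplexClifford m} (hY : IsSphericalMonogenic k Y)
    (hY0 : Y ≠ 0) : IsAngularFactor k 0 Y := by
  obtain ⟨⟨a, ha⟩, hd⟩ := hY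
  have hd0 : dirac Y = 0 := funext hd
  refine ⟨?_, fun s x => ?_, fun x => ?_, fun x => ?_, hY0⟩
  · rw [show Y = fun x => ∑ n ∈ Finset.piAntidiag Finset.univ k, (∏ j, x j ^ n j) • a n from
      funext ha]
    refine ContDiff.sum fun n _ => ?_
    have h : ContDiff ℝ (⊤ : ℕ∞) fun x : EuclideanSpace ℝ (Fin m) => ∏ j, x j ^ n j :=
      contDiff_prod fun j _ => (EuclideanSpace.proj (𝕜 := ℝ) j).contDiff.pow _
    exact h.smul contDiff_const
  · rw [ha, ha, Finset.smul_sum]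
    refine Finset.sum_congr rfl fun n hn => ?_
    rw [smul_smul]
    congr 1
    have hsum : ∑ j, n j = k := (Finset.mem_piAntidiag.1 hn).1
    simp only [PiLp.smul_apply, smul_eq_mul, mul_pow, Finset.prod_mul_distrib]
    rw [Finset.prod_pow_eq_pow_sum, hsum]
  · rw [hd0]
    simp [dirac, Pi.zero_def]
  · simp [hd]

lemma IsSphericalMonogenic.isAngularFactor_vec_mul (hm : 1 ≤ m) {k : ℕ}
    {Y : EuclideanSpace ℝ (Fin m) → ComplexClifford m} (hY : IsSphericalMonogenic k Y)
    (hY0 : Y ≠ 0) : IsAngularFactor (k + 1) (m + 2 * k) (fun x => cliffordVec x * Y x) := by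
  have hf := hY.isAngularFactor hY0
  have hdiff : ∀ x, DifferentiableAt ℝ Y x := fun x => (hf.contDiff.differentiable (by simp)) x
  have hdir : dirac (fun x => cliffordVec x * Y x) = fun x => (-(m + 2 * k) : ℂ) • Y x := by
    ext x
    rw [dirac_cliffordVec_mul (hdiff x), hY.2 x, mul_zero, sub_zero,
      fderiv_apply_self_of_homogeneous (hdiff x) (fun s => hf.homogeneous s x),
      ← Complex.coe_smul, smul_smul, ← neg_smul, ← sub_smul]
    congr 1
    push_cast
    ring
  refine ⟨contDiff_cliffordVec_mul hf.contDiff, fun s x => ?_, fun x => ?_, fun x => ?_, ?_⟩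
  · have : cliffordVec (s • x) = (s : ℂ) • cliffordVec x := by
      simp only [cliffordVec, Finset.smul_sum, smul_smul, PiLp.smul_apply, smul_eq_mul,
        Complex.ofReal_mul]
    rw [hf.homogeneous, this, ← Complex.coe_smul, ← Complex.coe_smul, mul_smul_comm,
      smul_mul_assoc, smul_smul]
    congr 1
    push_cast; ring
  · rw [hdir, dirac_smul_const _ (hdiff x), hY.2 x, smul_zero]
  · rw [hdir, mul_smul_comm]
  · intro h0
    obtain ⟨x, hx, hYx⟩ := exists_norm_eq_one_of_homogeneous hm hf.homogeneous hY0
    refine hYx ?_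
    have h1 := congrArg (fun z => cliffordVec x * z) (congrFun h0 x)
    simp only [Pi.zero_apply, mul_zero] at h1
    rw [← mul_assoc, cliffordVec_mul_self, hx, smul_mul_assoc, one_mul] at h1
    simpa using h1

/-- The operator `L_c` acts on `P(|x| ^ 2) H(x)` as the radial prolate operator on `P`. -/
lemma IsAngularFactor.cliffordL_radial_smul {d : ℕ} {δ : ℂ}
    {H : EuclideanSpace ℝ (Fin m) → ComplexClifford m} (hH : IsAngularFactor d δ H) (c : ℝ)
    {P P₁ : ℝ → ℂ} {p₂ : ℂ} {x : EuclideanSpace ℝ (Fin m)}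
    (hP : ∀ᶠ s in nhds (‖x‖ ^ 2), HasDerivAt P (P₁ s) s) (hP₁ : HasDerivAt P₁ p₂ (‖x‖ ^ 2)) :
    cliffordL c (fun y => P (‖y‖ ^ 2) • H y) x =
      (-4 * prolateAt (2 * d + m) ((Real.pi * c) ^ 2) (‖x‖ ^ 2) (P (‖x‖ ^ 2)) (P₁ (‖x‖ ^ 2)) p₂ +
        2 * δ * P (‖x‖ ^ 2)) • H x := by
  have hdiff : ∀ y, DifferentiableAt ℝ H y := fun y => (hH.contDiff.differentiable (by simp)) y
  have hdiff₁ : ∀ y, DifferentiableAt ℝ (dirac H) y := fun y =>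
    ((contDiff_dirac hH.contDiff).differentiable (by simp)) y
  have hdiff₂ : ∀ y, DifferentiableAt ℝ (fun y => cliffordVec y * H y) y := fun y =>
    ((contDiff_cliffordVec_mul hH.contDiff).differentiable (by simp)) y
  set g₁ : ℝ → ℂ := fun s => (1 - s) * (2 * P₁ s) with hg₁
  set g₂ : ℝ → ℂ := fun s => (1 - s) * P s with hg₂
  have hcoe : HasDerivAt (fun s : ℝ => (1 - s : ℂ)) (-1) (‖x‖ ^ 2) := by
    have := ((hasDerivAt_id (‖x‖ ^ 2)).ofReal_comp).const_sub (1 : ℂ)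
    simpa using this
  have dg₁ : HasDerivAt g₁ (-1 * (2 * P₁ (‖x‖ ^ 2)) + (1 - ↑(‖x‖ ^ 2)) * (2 * p₂)) (‖x‖ ^ 2) :=
    hcoe.mul (hP₁.const_mul 2)
  have dg₂ : HasDerivAt g₂ (-1 * P (‖x‖ ^ 2) + (1 - ↑(‖x‖ ^ 2)) * P₁ (‖x‖ ^ 2)) (‖x‖ ^ 2) :=
    hcoe.mul hP.self_of_nhds
  have hev : (fun y => (1 - ‖y‖ ^ 2) • dirac (fun y => P (‖y‖ ^ 2) • H y) y) =ᶠ[nhds x]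
      fun y => g₁ (‖y‖ ^ 2) • (cliffordVec y * H y) + g₂ (‖y‖ ^ 2) • dirac H y := by
    have hcont : Continuous fun y : EuclideanSpace ℝ (Fin m) => ‖y‖ ^ 2 := by fun_prop
    filter_upwards [hcont.continuousAt.eventually hP] with y hy
    rw [(dirac_radial_smul hy (hdiff y)).2, ← Complex.coe_smul, smul_add, smul_smul, smul_smul]
    simp only [hg₁, hg₂]
    push_cast
    rfl
  have hfd : dirac (fun y => (1 - ‖y‖ ^ 2) • dirac (fun y => P (‖y‖ ^ 2) • H y) y) x =
      dirac (fun y => g₁ (‖y‖ ^ 2) • (cliffordVec y * H y)) x +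
        dirac (fun y => g₂ (‖y‖ ^ 2) • dirac H y) x := by
    rw [dirac_congr hev, dirac_add (dirac_radial_smul dg₁ (hdiff₂ x)).1
      (dirac_radial_smul dg₂ (hdiff₁ x)).1]
  have hxH : dirac (fun y => cliffordVec y * H y) x = (-(m + 2 * d) + δ : ℂ) • H x := by
    rw [dirac_cliffordVec_mul (hdiff x), hH.vec_dirac,
      fderiv_apply_self_of_homogeneous (hdiff x) (fun s => hH.homogeneous s x),
      ← Complex.coe_smul, smul_smul]
    module
  rw [cliffordL, hfd, (dirac_radial_smul dg₁ (hdiff₂ x)).2, (dirac_radial_smul dg₂ (hdiff₁ x)).2,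
    hH.dirac_dirac, hH.vec_dirac, hxH, ← mul_assoc (cliffordVec x), cliffordVec_mul_self,
    smul_mul_assoc, one_mul, ← Complex.coe_smul]
  simp only [smul_zero, add_zero, smul_smul, ← add_smul]
  congr 1
  simp only [hg₁, prolateAt]
  push_cast
  ring

end Angular

/-! ### Radial parts of Clifford prolate spheroidal wave functions -/

section RadialPart

variable {m : ℕ}

lemma tendsto_sqrt_nhdsLT_one :
    Filter.Tendsto Real.sqrt (nhdsWithin 1 (Iio 1)) (nhdsWithin 1 (Icc (-1) 1)) := by
  refine tendsto_nhdsWithin_iff.2 ⟨?_, ?_⟩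
  · exact (Real.continuous_sqrt.tendsto' 1 1 Real.sqrt_one).mono_left nhdsWithin_le_nhds
  · filter_upwards [Ioo_mem_nhdsLT (zero_lt_one' ℝ)] with t ht
    exact ⟨by linarith [Real.sqrt_nonneg t], Real.sqrt_le_one.2 ht.2.le⟩

/-- Regularity of the radial part: if `r ^ d P(r ^ 2)` is `C²` on `[-1, 1]`, then `P` is `C¹` up to
`1`, and the boundary terms of the radial prolate operator at `0` vanish. -/
lemma radial_regularity (hm : 1 ≤ m) {d : ℕ} {P p : ℝ → ℂ}
    (hp : ContDiffOn ℝ 2 p (Icc (-1) 1)) (hpP : ∀ r : ℝ, p r = (r : ℂ) ^ d * P (r ^ 2)) :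
    (∀ t ∈ Ioo (0 : ℝ) 1, HasDerivAt P (deriv P t) t) ∧
    (∀ t ∈ Ioo (0 : ℝ) 1, HasDerivAt (deriv P) (deriv (deriv P) t) t) ∧
    ContinuousOn P (Ioc 0 1) ∧
    (∃ l, Filter.Tendsto P (nhdsWithin 1 (Iio 1)) (nhds l)) ∧
    (∃ l, Filter.Tendsto (deriv P) (nhdsWithin 1 (Iio 1)) (nhds l)) ∧
    IntegrableOn (fun r : ℝ => ((r ^ (2 * d + m - 1) : ℝ) : ℂ) * P (r ^ 2)) (Ioc 0 1) ∧
    Filter.Tendsto (fun r : ℝ => ((r ^ (2 * d + m) : ℝ) : ℂ) * P (r ^ 2)) (nhdsWithin 0 (Ioi 0))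
      (nhds 0) ∧
    Filter.Tendsto (fun r : ℝ => ((r ^ (2 * d + m) : ℝ) : ℂ) * deriv P (r ^ 2))
      (nhdsWithin 0 (Ioi 0)) (nhds 0) := by
  have hsqrt : ∀ t : ℝ, 0 < t → P t = p (√t) / ((√t : ℝ) : ℂ) ^ d := fun t ht => by
    have h0 : ((√t : ℝ) : ℂ) ^ d ≠ 0 :=
      pow_ne_zero _ (Complex.ofReal_ne_zero.2 (Real.sqrt_pos.2 ht).ne')
    rw [hpP, Real.sq_sqrt ht.le, mul_div_cancel_left₀ _ h0]
  have hsub : Ioo (-1 : ℝ) 1 ⊆ Icc (-1) 1 := Ioo_subset_Icc_self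
  have hcdP : ContDiffOn ℝ 2 P (Ioo 0 1) := by
    have h1 : ContDiffOn ℝ 2 Real.sqrt (Ioo 0 1) := fun t ht =>
      (Real.contDiffAt_sqrt ht.1.ne').contDiffWithinAt
    have h2 : ContDiffOn ℝ 2 (fun t => p (√t)) (Ioo 0 1) := hp.comp h1 fun t ht =>
      ⟨by linarith [Real.sqrt_nonneg t], Real.sqrt_le_one.2 ht.2.le⟩
    have h3 : ContDiffOn ℝ 2 (fun t => ((√t : ℝ) : ℂ) ^ d) (Ioo 0 1) :=
      (Complex.ofRealCLM.contDiff.comp_contDiffOn h1).pow d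
    refine (h2.mul (h3.inv fun t ht => ?_)).congr fun t ht => ?_
    · exact pow_ne_zero _ (Complex.ofReal_ne_zero.2 (Real.sqrt_pos.2 ht.1).ne')
    · rw [hsqrt t ht.1, div_eq_mul_inv]
      rfl
  have hat : ∀ t ∈ Ioo (0 : ℝ) 1, ContDiffAt ℝ 2 P t := fun t ht =>
    hcdP.contDiffAt (isOpen_Ioo.mem_nhds ht)
  have hd1 : ∀ t ∈ Ioo (0 : ℝ) 1, HasDerivAt P (deriv P t) t := fun t ht =>
    ((hat t ht).differentiableAt (by norm_num)).hasDerivAt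
  have hd2 : ∀ t ∈ Ioo (0 : ℝ) 1, HasDerivAt (deriv P) (deriv (deriv P) t) t := fun t ht => by
    have h1 : ContDiffOn ℝ 1 (deriv P) (Ioo 0 1) :=
      hcdP.deriv_of_isOpen isOpen_Ioo (by norm_num)
    exact (((h1.contDiffAt (isOpen_Ioo.mem_nhds ht))).differentiableAt (by norm_num)).hasDerivAt
  have hpc : ContinuousOn p (Icc (-1) 1) := hp.continuousOn
  have hPc : ContinuousOn P (Ioc 0 1) := by
    have h2 : ContinuousOn (fun t => p (√t)) (Ioc 0 1) :=
      hpc.comp Real.continuous_sqrt.continuousOn fun t ht =>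
        ⟨by linarith [Real.sqrt_nonneg t], Real.sqrt_le_one.2 ht.2⟩
    have h3 : Continuous (fun t : ℝ => ((√t : ℝ) : ℂ) ^ d) := by fun_prop
    refine (h2.div h3.continuousOn fun t ht => ?_).congr fun t ht => hsqrt t ht.1
    exact pow_ne_zero _ (Complex.ofReal_ne_zero.2 (Real.sqrt_pos.2 ht.1).ne')
  set p' := derivWithin p (Icc (-1) 1) with hp'
  have hp'c : ContinuousOn p' (Icc (-1) 1) :=
    hp.continuousOn_derivWithin (uniqueDiffOn_Icc (by norm_num)) (by norm_num)
  have hp'd : ∀ r ∈ Ioo (-1 : ℝ) 1, HasDerivAt p (p' r) r := fun r hr =>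
    ((hp.differentiableOn (by norm_num)) r (hsub hr)).hasDerivWithinAt.hasDerivAt
      (Icc_mem_nhds hr.1 hr.2)
  -- the chain rule for `p r = r ^ d P(r ^ 2)`
  have hrel : ∀ r ∈ Ioo (0 : ℝ) 1,
      2 * (r : ℂ) ^ (d + 1) * deriv P (r ^ 2) = p' r - d * (r : ℂ) ^ (d - 1) * P (r ^ 2) := by
    intro r hr
    have hsq : HasDerivAt (fun r : ℝ => r ^ 2) (2 * r) r := by simpa using hasDerivAt_pow 2 r
    have h1 : HasDerivAt (fun r : ℝ => P (r ^ 2)) (2 * r * deriv P (r ^ 2)) r := by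
      have := HasDerivAt.scomp (h := fun r : ℝ => r ^ 2) r (hd1 _ (sq_mem_Ioo hr)) hsq
      simpa [Function.comp_def] using this
    have h2 : HasDerivAt (fun r : ℝ => (r : ℂ) ^ d) (d * (r : ℂ) ^ (d - 1)) r :=
      (hasDerivAt_pow d (r : ℂ)).comp_ofReal
    have h3 : HasDerivAt p (d * (r : ℂ) ^ (d - 1) * P (r ^ 2) +
        (r : ℂ) ^ d * (2 * r * deriv P (r ^ 2))) r := by
      rw [show p = fun r : ℝ => (r : ℂ) ^ d * P (r ^ 2) from funext hpP]
      exact h2.mul h1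
    rw [(hp'd r ⟨by linarith [hr.1], hr.2⟩).unique h3]
    ring
  have h1mem : (1 : ℝ) ∈ Icc (-1 : ℝ) 1 := by norm_num
  have h0mem : (0 : ℝ) ∈ Ioo (-1 : ℝ) 1 := by norm_num
  have hlimP : Filter.Tendsto P (nhdsWithin 1 (Iio 1)) (nhds (p 1)) := by
    have h1 := (hpc 1 h1mem).tendsto.comp tendsto_sqrt_nhdsLT_one
    have h2 : Filter.Tendsto (fun t : ℝ => ((√t : ℝ) : ℂ) ^ d) (nhdsWithin 1 (Iio 1)) (nhds 1) := by
      have : Continuous (fun t : ℝ => ((√t : ℝ) : ℂ) ^ d) := by fun_prop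
      exact (this.tendsto' 1 1 (by simp)).mono_left nhdsWithin_le_nhds
    have h3 := h1.div h2 one_ne_zero
    rw [div_one] at h3
    refine h3.congr' ?_
    filter_upwards [Ioo_mem_nhdsLT (zero_lt_one' ℝ)] with t ht
    rw [hsqrt t ht.1]
    rfl
  have hmem0 : nhdsWithin (0 : ℝ) (Ioi 0) ≤ nhds 0 := nhdsWithin_le_nhds
  have hpc0 : Filter.Tendsto p (nhdsWithin 0 (Ioi 0)) (nhds (p 0)) :=
    (hp'd 0 h0mem).continuousAt.tendsto.mono_left hmem0
  have hp'c0 : Filter.Tendsto p' (nhdsWithin 0 (Ioi 0)) (nhds (p' 0)) :=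
    ((hp'c.mono hsub).continuousAt (isOpen_Ioo.mem_nhds h0mem)).tendsto.mono_left hmem0
  have hpow : ∀ n : ℕ, Filter.Tendsto (fun r : ℝ => (r : ℂ) ^ n) (nhdsWithin 0 (Ioi 0))
      (nhds (((0 : ℝ) : ℂ) ^ n)) := fun n => by
    have : Continuous fun r : ℝ => (r : ℂ) ^ n := by fun_prop
    exact (this.tendsto 0).mono_left hmem0
  refine ⟨hd1, hd2, hPc, ⟨_, hlimP⟩, ?_, ?_, ?_, ?_⟩
  · have h1 := (hp'c 1 h1mem).tendsto.comp tendsto_sqrt_nhdsLT_one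
    have hc : ∀ n : ℕ, Filter.Tendsto (fun t : ℝ => ((√t : ℝ) : ℂ) ^ n) (nhdsWithin 1 (Iio 1))
        (nhds 1) := fun n => by
      have : Continuous (fun t : ℝ => ((√t : ℝ) : ℂ) ^ n) := by fun_prop
      exact (this.tendsto' 1 1 (by simp)).mono_left nhdsWithin_le_nhds
    refine ⟨_, ((h1.sub (((hc (d - 1)).const_mul (d : ℂ)).mul hlimP)).div
      ((hc (d + 1)).const_mul 2) (by norm_num)).congr' ?_⟩
    filter_upwards [Ioo_mem_nhdsLT (zero_lt_one' ℝ)] with t ht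
    have hs : √t ∈ Ioo (0 : ℝ) 1 := ⟨Real.sqrt_pos.2 ht.1, by
      rw [Real.sqrt_lt' one_pos]; simpa using ht.2⟩
    have h2 := hrel _ hs
    rw [Real.sq_sqrt ht.1.le] at h2
    have h0 : (2 : ℂ) * ((√t : ℝ) : ℂ) ^ (d + 1) ≠ 0 :=
      mul_ne_zero two_ne_zero (pow_ne_zero _ (Complex.ofReal_ne_zero.2 hs.1.ne'))
    simp only [Function.comp_apply, Pi.div_apply]
    rw [← h2, mul_div_cancel_left₀ _ h0]
  · have hc : ContinuousOn (fun r : ℝ => ((r ^ (d + m - 1) : ℝ) : ℂ) * p r) (Icc 0 1) := by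
      have h1 : Continuous fun r : ℝ => ((r ^ (d + m - 1) : ℝ) : ℂ) := by fun_prop
      exact h1.continuousOn.mul (hpc.mono (Icc_subset_Icc (by norm_num) le_rfl))
    refine (hc.integrableOn_Icc.mono_set Ioc_subset_Icc_self).congr_fun (fun r _ => ?_)
      measurableSet_Ioc
    simp only [hpP]
    rw [← mul_assoc]
    push_cast
    rw [← pow_add, show d + m - 1 + d = 2 * d + m - 1 by omega]
  · have h := (hpow (d + m)).mul hpc0
    rw [Complex.ofReal_zero, zero_pow (by omega), zero_mul] at h
    refine h.congr fun r => ?_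
    rw [hpP]
    push_cast
    ring
  · have hev : ∀ᶠ r in nhdsWithin (0 : ℝ) (Ioi 0), r ∈ Ioo (0 : ℝ) 1 :=
      Ioo_mem_nhdsGT zero_lt_one
    rcases d with _ | e
    · -- `p` is even, so that its derivative vanishes at the origin
      have hp'0 : p' 0 = 0 := by
        have h1 := hp'd 0 h0mem
        have h2 : HasDerivAt p (-(p' 0)) 0 := by
          have h3 : HasDerivAt (fun r : ℝ => p (-r)) (-(p' 0)) 0 := by
            have := HasDerivAt.scomp (h := fun r : ℝ => -r) (0 : ℝ) (g₁ := p) (g₁' := p' 0)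
              (by simpa using h1) (hasDerivAt_neg 0)
            simpa [Function.comp_def] using this
          refine h3.congr_of_eventuallyEq (Filter.Eventually.of_forall fun r => ?_)
          simp [hpP]
        have := h1.unique h2
        exact self_eq_neg.1 this
      have h := ((hpow (m - 1)).mul hp'c0).div_const 2
      rw [hp'0, mul_zero, zero_div] at h
      refine h.congr' ?_
      filter_upwards [hev] with r hr
      have h2 := hrel r hr
      simp only [Nat.cast_zero, zero_mul, sub_zero] at h2
      rw [← h2, show 2 * 0 + m = m - 1 + 1 by omega]
      push_cast
      ring
    · have hp0 : p 0 = 0 := by simp [hpP]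
      have h := (((hpow (e + m)).mul hp'c0).sub
        (((hpow (e + m - 1)).mul hpc0).const_mul ((e : ℂ) + 1))).div_const 2
      rw [hp0, mul_zero, mul_zero, sub_zero, Complex.ofReal_zero, zero_pow (by omega), zero_mul,
        zero_div] at h
      refine h.congr' ?_
      filter_upwards [hev] with r hr
      have h2 := hrel r hr
      have h3 := hpP r
      simp only [Nat.add_sub_cancel] at h2
      obtain ⟨q, hq⟩ : ∃ q, m = q + 1 := ⟨m - 1, by omega⟩
      subst hq
      rw [h3, show e + (q + 1) - 1 = e + q by omega,
        show 2 * (e + 1) + (q + 1) = (e + 1 + 1) + (e + (q + 1)) - 0 by omega]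
      push_cast at h2 ⊢
      rw [Nat.sub_zero]
      linear_combination -(r : ℂ) ^ (e + (q + 1)) / 2 * h2

/-- The radial part of a Clifford prolate spheroidal wave function solves the radial prolate
equation, is regular at both endpoints, and is not identically zero. -/
lemma IsAngularFactor.radial_of_isCPSWF (hm : 1 ≤ m) {d : ℕ} {δ : ℂ} {c : ℝ}
    {H : EuclideanSpace ℝ (Fin m) → ComplexClifford m} (hH : IsAngularFactor d δ H) {P : ℝ → ℂ}
    (hψ : IsCPSWF c fun x => P (‖x‖ ^ 2) • H x) :
    ∃ χ : ℂ, ∃ P₁ P₂ : ℝ → ℂ,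
      IsRadialSolution (2 * d + m) ((Real.pi * c) ^ 2) χ P P₁ P₂ ∧
      ContinuousOn P (Ioc 0 1) ∧
      IntegrableOn (fun r : ℝ => ((r ^ (2 * d + m - 1) : ℝ) : ℂ) * P (r ^ 2)) (Ioc 0 1) ∧
      Filter.Tendsto (fun r : ℝ => ((r ^ (2 * d + m) : ℝ) : ℂ) * P (r ^ 2))
        (nhdsWithin 0 (Ioi 0)) (nhds 0) ∧
      Filter.Tendsto (fun r : ℝ => ((r ^ (2 * d + m) : ℝ) : ℂ) * P₁ (r ^ 2))
        (nhdsWithin 0 (Ioi 0)) (nhds 0) ∧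
      (∃ t ∈ Ioo (0 : ℝ) 1, P t ≠ 0) ∧
      ContinuousOn (fun r : ℝ => (r : ℂ) ^ d * P (r ^ 2)) (Icc 0 1) := by
  obtain ⟨ω, hω, hHω⟩ := exists_norm_eq_one_of_homogeneous hm hH.homogeneous hH.ne_zero
  obtain ⟨l, hl⟩ := SeparatingDual.exists_eq_one (R := ℂ) hHω
  set ψ : EuclideanSpace ℝ (Fin m) → ComplexClifford m := fun x => P (‖x‖ ^ 2) • H x with hψd
  have hnorm : ∀ r : ℝ, ‖r • ω‖ ^ 2 = r ^ 2 := fun r => by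
    rw [norm_smul, hω, mul_one, Real.norm_eq_abs, sq_abs]
  -- on the line through `ω` a coordinate of `ψ` is `r ^ d P(r ^ 2)`
  set p : ℝ → ℂ := fun r => l (ψ (r • ω)) with hpd
  have hpP : ∀ r : ℝ, p r = (r : ℂ) ^ d * P (r ^ 2) := fun r => by
    simp only [hpd, hψd]
    rw [hnorm, hH.homogeneous, ← Complex.coe_smul, map_smul, map_smul, hl]
    push_cast
    simp [mul_comm]
  have hp : ContDiffOn ℝ 2 p (Icc (-1) 1) := by
    refine (l.restrictScalars ℝ).contDiff.comp_contDiffOn (hψ.contDiffOn.comp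
      (contDiff_id.smul contDiff_const).contDiffOn fun r hr => ?_)
    rw [mem_closedBall_zero_iff, norm_smul, hω, mul_one, Real.norm_eq_abs]
    exact abs_le.2 hr
  obtain ⟨h1, h2, h3, h4, h5, h6, h7, h8⟩ := radial_regularity hm hp hpP
  obtain ⟨χ, hχ⟩ := hψ.eigen
  refine ⟨(2 * δ - χ) / 4, deriv P, deriv (deriv P), ⟨h1, h2, fun t ht => ?_, h4, h5⟩, h3, h6, h7,
    h8, ?_, ?_⟩
  · set x := √t • ω with hx
    have hxt : ‖x‖ ^ 2 = t := by rw [hnorm, Real.sq_sqrt ht.1.le]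
    have hxb : x ∈ Metric.ball (0 : EuclideanSpace ℝ (Fin m)) 1 := by
      rw [mem_ball_zero_iff, ← sq_lt_one_iff₀ (norm_nonneg x), hxt]
      exact ht.2
    have hHx : H x ≠ 0 := by
      rw [hx, hH.homogeneous]
      exact smul_ne_zero (pow_ne_zero _ (Real.sqrt_pos.2 ht.1).ne') hHω
    have e := hχ x hxb
    rw [hψd, hH.cliffordL_radial_smul c (P₁ := deriv P) (p₂ := deriv (deriv P) t)
      (by rw [hxt]; filter_upwards [isOpen_Ioo.mem_nhds ht] with s hs using h1 s hs)
      (by rw [hxt]; exact h2 t ht), hxt, smul_smul] at e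
    have e' := smul_left_injective ℂ hHx e
    rw [hxt] at e'
    linear_combination (-1 / 4 : ℂ) * e'
  · -- if `P` vanishes on `(0, 1)`, then so does `ψ` on each radius, up to its ends by continuity
    by_contra! hzero
    have hray : ∀ y : EuclideanSpace ℝ (Fin m), 0 < ‖y‖ → ‖y‖ ≤ 1 →
        EqOn (fun s : ℝ => ψ (s • y)) (fun _ => 0) (Icc 0 1) := by
      intro y hy0 hy1
      have hn : ∀ s : ℝ, ‖s • y‖ = |s| * ‖y‖ := fun s => by rw [norm_smul, Real.norm_eq_abs]
      refine EqOn.of_subset_closure (s := Ioo 0 1) (fun s hs => ?_) ?_ continuousOn_const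
        Ioo_subset_Icc_self (by rw [closure_Ioo (zero_ne_one' ℝ)])
      · have : ‖s • y‖ ∈ Ioo (0 : ℝ) 1 := by
          rw [hn, abs_of_pos hs.1]
          exact ⟨mul_pos hs.1 hy0, by nlinarith [hs.1, hs.2]⟩
        simp only [hψd]
        rw [hzero _ (sq_mem_Ioo this), zero_smul]
      · refine hψ.contDiffOn.continuousOn.comp (by fun_prop) fun s hs => ?_
        rw [mem_closedBall_zero_iff, hn, abs_of_nonneg hs.1]
        exact mul_le_one₀ hs.2 (norm_nonneg _) hy1
    obtain ⟨x, hx, hx0⟩ := hψ.nonzero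
    refine hx0 ?_
    by_cases hx' : x = 0
    · have := hray ω (by rw [hω]; exact one_pos) hω.le (left_mem_Icc.2 zero_le_one)
      simpa [hx'] using this
    · have := hray x (norm_pos_iff.2 hx') (mem_closedBall_zero_iff.1 hx)
        (right_mem_Icc.2 zero_le_one)
      simpa using this
  · exact (hp.continuousOn.mono (Icc_subset_Icc (by norm_num) le_rfl)).congr fun r _ => (hpP r).symm

end RadialPart

/-! ### Gaussian moments of solid harmonics -/

section Gaussian

variable {m : ℕ} {V : Type*} [NormedAddCommGroup V] [NormedSpace ℝ V]

/-- The Gaussian `exp(-|y| ^ 2)` times the monomial `⟨x, y⟩ ^ n`. -/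
noncomputable def gaussMonomial (x : EuclideanSpace ℝ (Fin m)) (n : ℕ)
    (y : EuclideanSpace ℝ (Fin m)) : ℝ :=
  Real.exp (-‖y‖ ^ 2) * inner ℝ x y ^ n

lemma norm_le_of_homogeneous {N : ℕ} {f : EuclideanSpace ℝ (Fin m) → V} (hf : Continuous f)
    (hN : ∀ (s : ℝ) (x : EuclideanSpace ℝ (Fin m)), f (s • x) = s ^ N • f x) :
    ∃ C, 0 ≤ C ∧ ∀ y, ‖f y‖ ≤ C * ‖y‖ ^ N := by
  obtain ⟨C, hC⟩ := (isCompact_closedBall (0 : EuclideanSpace ℝ (Fin m))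
    1).exists_bound_of_continuousOn hf.continuousOn
  refine ⟨C, (norm_nonneg _).trans (hC 0 (by simp)), fun y => ?_⟩
  have hy : ‖y‖ • (‖y‖⁻¹ • y) = y := by
    by_cases h : y = 0
    · simp [h]
    · rw [smul_smul, mul_inv_cancel₀ (norm_ne_zero_iff.2 h), one_smul]
  have h1 : ‖y‖⁻¹ • y ∈ Metric.closedBall (0 : EuclideanSpace ℝ (Fin m)) 1 := by
    rw [mem_closedBall_zero_iff, norm_smul, norm_inv, norm_norm]
    exact inv_mul_le_one
  calc ‖f y‖ = ‖y‖ ^ N * ‖f (‖y‖⁻¹ • y)‖ := by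
        conv_lhs => rw [← hy, hN, norm_smul, norm_pow, norm_norm]
    _ ≤ ‖y‖ ^ N * C := by gcongr; exact hC _ h1
    _ = C * ‖y‖ ^ N := mul_comm _ _

lemma integrable_gauss_smul {N : ℕ} {f : EuclideanSpace ℝ (Fin m) → V} (hf : Continuous f)
    (hN : ∀ (s : ℝ) (x : EuclideanSpace ℝ (Fin m)), f (s • x) = s ^ N • f x) :
    Integrable fun y => Real.exp (-‖y‖ ^ 2) • f y := by
  obtain ⟨C, hC0, hC⟩ := norm_le_of_homogeneous hf hN
  -- half of the Gaussian absorbs the polynomial growth of `f`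
  have hg : Integrable fun y : EuclideanSpace ℝ (Fin m) => Real.exp (-(1 / 2) * ‖y‖ ^ 2) := by
    have := (GaussianFourier.integrable_cexp_neg_mul_sq_norm_add (V := EuclideanSpace ℝ (Fin m))
      (b := 1 / 2) (by norm_num) 0 0).norm
    refine this.congr (Filter.Eventually.of_forall fun y => ?_)
    simp only [zero_mul, add_zero, Complex.norm_exp]
    congr 1
    have : (-(1 / 2 : ℂ) * (‖y‖ : ℂ) ^ 2) = ((-(1 / 2) * ‖y‖ ^ 2 : ℝ) : ℂ) := by push_cast; ring
    rw [this, Complex.ofReal_re]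
  refine (hg.const_mul (C * (1 + N.factorial * 2 ^ N))).mono' (by fun_prop)
    (Filter.Eventually.of_forall fun y => ?_)
  have h1 : ‖y‖ ^ N ≤ 1 + (‖y‖ ^ 2) ^ N := by
    rw [← pow_mul, mul_comm, pow_mul]
    nlinarith [sq_nonneg (‖y‖ ^ N - 1), pow_nonneg (norm_nonneg y) N]
  have h2 := Real.pow_div_factorial_le_exp (x := ‖y‖ ^ 2 / 2) (by positivity) N
  rw [div_le_iff₀ (by positivity), div_pow, div_le_iff₀ (by positivity)] at h2
  have h3 : (1 : ℝ) ≤ Real.exp (‖y‖ ^ 2 / 2) := Real.one_le_exp (by positivity)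
  have h4 : ‖y‖ ^ N ≤ (1 + N.factorial * 2 ^ N) * Real.exp (‖y‖ ^ 2 / 2) := by
    refine h1.trans ((add_le_add h3 h2).trans (le_of_eq ?_))
    ring
  rw [norm_smul, Real.norm_of_nonneg (Real.exp_pos _).le]
  calc Real.exp (-‖y‖ ^ 2) * ‖f y‖
      ≤ Real.exp (-‖y‖ ^ 2) * (C * ((1 + N.factorial * 2 ^ N) * Real.exp (‖y‖ ^ 2 / 2))) := by
        gcongr
        exact (hC y).trans (by gcongr)
    _ = C * (1 + N.factorial * 2 ^ N) *
        (Real.exp (-‖y‖ ^ 2) * Real.exp (‖y‖ ^ 2 / 2)) := by ring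
    _ = C * (1 + N.factorial * 2 ^ N) * Real.exp (-(1 / 2) * ‖y‖ ^ 2) := by
        rw [← Real.exp_add]; congr 2; ring

lemma integrable_gaussMonomial_smul {d : ℕ} {f : EuclideanSpace ℝ (Fin m) → V} (hf : Continuous f)
    (hd : ∀ (s : ℝ) (x : EuclideanSpace ℝ (Fin m)), f (s • x) = s ^ d • f x)
    (x : EuclideanSpace ℝ (Fin m)) (n : ℕ) : Integrable fun y => gaussMonomial x n y • f y := by
  have := integrable_gauss_smul (N := n + d) (f := fun y => inner ℝ x y ^ n • f y) (by fun_prop)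
    (fun s y => by
      rw [hd, inner_smul_right, mul_pow, smul_smul, smul_smul, pow_add]
      congr 1; ring)
  refine this.congr (Filter.Eventually.of_forall fun y => ?_)
  simp only [gaussMonomial, mul_smul]

lemma fderiv_gaussMonomial (x : EuclideanSpace ℝ (Fin m)) (n : ℕ)
    (y : EuclideanSpace ℝ (Fin m)) :
    DifferentiableAt ℝ (gaussMonomial x n) y ∧ ∀ v, fderiv ℝ (gaussMonomial x n) y v =
      -2 * inner ℝ y v * gaussMonomial x n y + n * inner ℝ x v * gaussMonomial x (n - 1) y := by
  have h1 : HasFDerivAt (fun y : EuclideanSpace ℝ (Fin m) => ‖y‖ ^ 2)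
      ((2 : ℝ) • innerSL ℝ y) y := by
    have := (hasStrictFDerivAt_norm_sq y).hasFDerivAt
    rwa [← Nat.cast_smul_eq_nsmul ℝ, Nat.cast_ofNat] at this
  have h2 : HasFDerivAt (fun y : EuclideanSpace ℝ (Fin m) => inner ℝ x y) (innerSL ℝ x) y :=
    (innerSL ℝ x).hasFDerivAt
  have h3 := (h1.neg.exp).mul (h2.pow n)
  have h3' : HasFDerivAt (gaussMonomial x n) _ y := h3
  refine ⟨h3'.differentiableAt, fun v => ?_⟩
  rw [h3'.fderiv]
  simp [gaussMonomial]
  ring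

lemma IsSolidHarmonic.eq_zero_apply {H : EuclideanSpace ℝ (Fin m) → V} (hH : IsSolidHarmonic 0 H)
    (x : EuclideanSpace ℝ (Fin m)) : H x = H 0 := by
  have := hH.homogeneous 0 x
  simpa using this.symm

lemma IsSolidHarmonic.fderiv_smul {d : ℕ} {H : EuclideanSpace ℝ (Fin m) → V}
    (hH : IsSolidHarmonic d H) (v : EuclideanSpace ℝ (Fin m)) (s : ℝ)
    (x : EuclideanSpace ℝ (Fin m)) :
    fderiv ℝ H (s • x) v = s ^ (d - 1) • fderiv ℝ H x v := by
  have hdiff : Differentiable ℝ H := hH.contDiff.differentiable (by simp)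
  rcases d with _ | d
  · have h0 : fderiv ℝ H = 0 := by
      rw [show H = fun _ => H 0 from funext hH.eq_zero_apply]
      ext; simp
    simp [h0]
  -- away from `s = 0` differentiate the homogeneity relation; at `s = 0` use continuity
  have key : ∀ s : ℝ, s ≠ 0 → fderiv ℝ H (s • x) v = s ^ d • fderiv ℝ H x v := by
    intro s hs
    have h1 : HasFDerivAt (fun y => H (s • y)) ((fderiv ℝ H (s • x)).comp
        (s • ContinuousLinearMap.id ℝ _)) x :=
      (hdiff (s • x)).hasFDerivAt.comp x ((hasFDerivAt_id x).const_smul s)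
    have h2 : HasFDerivAt (fun y => H (s • y)) (s ^ (d + 1) • fderiv ℝ H x) x := by
      simp only [hH.homogeneous]
      exact (hdiff x).hasFDerivAt.const_smul _
    have h3 := congrArg (fun L => L v) (h1.unique h2)
    simp only [ContinuousLinearMap.comp_apply, smul_apply, ContinuousLinearMap.id_apply, map_smul]
      at h3
    rw [pow_succ', mul_smul] at h3
    exact smul_right_injective _ hs h3
  have hc : Continuous (fderiv ℝ H) := (hH.contDiff.continuous_fderiv (by simp))
  have h1 : Continuous fun s : ℝ => fderiv ℝ H (s • x) v := by fun_prop
  have h2 : Continuous fun s : ℝ => s ^ d • fderiv ℝ H x v := by fun_prop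
  exact congrFun (h1.ext_on (dense_compl_singleton (0 : ℝ)) h2 fun s hs => key s hs) s

/-- Integration by parts in the direction `x`. -/
lemma integral_gaussMonomial_succ {d : ℕ} {H : EuclideanSpace ℝ (Fin m) → V}
    (hH : IsSolidHarmonic d H) (x : EuclideanSpace ℝ (Fin m)) (n : ℕ) :
    ∫ y, gaussMonomial x (n + 1) y • H y =
      (1 / 2 : ℝ) • (∫ y, gaussMonomial x n y • fderiv ℝ H y x) +
        (n * ‖x‖ ^ 2 / 2 : ℝ) • ∫ y, gaussMonomial x (n - 1) y • H y := by
  have hHc : Continuous H := hH.contDiff.continuous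
  have hfc : Continuous (fderiv ℝ H) := (hH.contDiff.continuous_fderiv (by simp))
  have i1 := integrable_gaussMonomial_smul hHc hH.homogeneous x n
  have i2 := integrable_gaussMonomial_smul hHc hH.homogeneous x (n + 1)
  have i3 := integrable_gaussMonomial_smul hHc hH.homogeneous x (n - 1)
  have i4 := integrable_gaussMonomial_smul (f := fun y => fderiv ℝ H y x) (by fun_prop)
    (fun s y => hH.fderiv_smul x s y) x n
  have hf' : ∀ y, fderiv ℝ (gaussMonomial x n) y x • H y =
      (-2 : ℝ) • (gaussMonomial x (n + 1) y • H y) +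
        (n * ‖x‖ ^ 2 : ℝ) • (gaussMonomial x (n - 1) y • H y) := by
    intro y
    rw [(fderiv_gaussMonomial x n y).2, smul_smul, smul_smul, ← add_smul]
    congr 1
    simp only [gaussMonomial, real_inner_self_eq_norm_sq, real_inner_comm x y]
    ring
  have j2 : Integrable fun y => (-2 : ℝ) • (gaussMonomial x (n + 1) y • H y) := i2.smul _
  have j3 : Integrable fun y => (n * ‖x‖ ^ 2 : ℝ) • (gaussMonomial x (n - 1) y • H y) := i3.smul _
  have key := integral_smul_fderiv_eq_neg_fderiv_smul_of_integrable (𝕜 := ℝ) (μ := volume)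
    (f := gaussMonomial x n) (g := H) (v := x)
    (by simp only [hf']; exact j2.add j3) i4 i1
    (fun y _ => (fderiv_gaussMonomial x n y).1)
    (fun y _ => (hH.contDiff.differentiable (by simp)) y)
  simp only [hf'] at key
  rw [integral_add j2 j3, integral_smul, integral_smul] at key
  rw [key]
  module

/-- A directional derivative of a solid harmonic is a solid harmonic of one degree less. -/
lemma IsSolidHarmonic.fderiv_apply {d : ℕ} {H : EuclideanSpace ℝ (Fin m) → V}
    (hH : IsSolidHarmonic (d + 1) H) (v : EuclideanSpace ℝ (Fin m)) :
    IsSolidHarmonic d fun y => fderiv ℝ H y v := by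
  have hsm : minSmoothness ℝ 2 ≤ ((⊤ : ℕ∞) : WithTop ℕ∞) := by
    rw [minSmoothness_of_isRCLikeNormedField]
    exact WithTop.coe_le_coe.2 (le_top : (2 : ℕ∞) ≤ ⊤)
  have h1 : ContDiff ℝ (⊤ : ℕ∞) (fderiv ℝ H) :=
    hH.contDiff.fderiv_right (by exact_mod_cast le_top)
  have hcomm : ∀ {G : EuclideanSpace ℝ (Fin m) → V}, ContDiff ℝ (⊤ : ℕ∞) G → ∀ u w y,
      fderiv ℝ (fun z => fderiv ℝ G z u) y w = fderiv ℝ (fun z => fderiv ℝ G z w) y u := by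
    intro G hG u w y
    have hG1 : ContDiff ℝ (⊤ : ℕ∞) (fderiv ℝ G) := hG.fderiv_right (by exact_mod_cast le_top)
    have hd : ∀ u w, fderiv ℝ (fun z => fderiv ℝ G z u) y w = fderiv ℝ (fderiv ℝ G) y w u := by
      intro u w
      rw [fderiv_clm_apply (hG1.differentiable (by simp) y) (by fun_prop)]
      simp
    rw [hd, hd]
    exact (hG.contDiffAt.isSymmSndFDerivAt hsm).eq _ _
  have happ : ∀ {G : EuclideanSpace ℝ (Fin m) → V}, ContDiff ℝ (⊤ : ℕ∞) G → ∀ w,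
      ContDiff ℝ (⊤ : ℕ∞) fun z => fderiv ℝ G z w := fun {G} hG w =>
    (hG.fderiv_right (by exact_mod_cast le_top)).clm_apply contDiff_const
  have hsnd : ∀ {G : EuclideanSpace ℝ (Fin m) → V}, ContDiff ℝ (⊤ : ℕ∞) G → ∀ u y,
      fderiv ℝ (fderiv ℝ G) y u u = fderiv ℝ (fun z => fderiv ℝ G z u) y u := by
    intro G hG u y
    have hG1 : ContDiff ℝ (⊤ : ℕ∞) (fderiv ℝ G) := hG.fderiv_right (by exact_mod_cast le_top)
    rw [fderiv_clm_apply (hG1.differentiable (by simp) y) (by fun_prop)]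
    simp
  refine ⟨happ hH.contDiff v, fun s x => hH.fderiv_smul v s x, fun x => ?_⟩
  have hlap : (fun y => ∑ j, fderiv ℝ (fun z => fderiv ℝ H z (EuclideanSpace.single j 1)) y
      (EuclideanSpace.single j 1)) = fun _ => 0 := by
    ext y
    rw [← hH.laplacian y]
    exact Finset.sum_congr rfl fun j _ => (hsnd hH.contDiff _ _).symm
  have hD := congrArg (fun F => fderiv ℝ F x v) hlap
  simp only [fderiv_const_apply, zero_apply] at hD
  rw [fderiv_fun_sum fun j _ => (happ (happ hH.contDiff _) _).differentiable (by simp) x,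
    sum_apply] at hD
  rw [← hD]
  refine Finset.sum_congr rfl fun j _ => ?_
  rw [hsnd (happ hH.contDiff v), hcomm (happ hH.contDiff _) (EuclideanSpace.single j 1) v]
  congr 2
  ext z
  exact hcomm hH.contDiff _ _ _


lemma IsSolidHarmonic.fderiv_apply_self {d : ℕ} {H : EuclideanSpace ℝ (Fin m) → V}
    (hH : IsSolidHarmonic d H) (x : EuclideanSpace ℝ (Fin m)) :
    fderiv ℝ H x x = (d : ℝ) • H x :=
  fderiv_apply_self_of_homogeneous (hH.contDiff.differentiable (by simp) x)
    fun s => hH.homogeneous s x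

/-- A solid harmonic of positive degree is orthogonal to the Gaussian. -/
lemma IsSolidHarmonic.integral_gauss_eq_zero {d : ℕ} {H : EuclideanSpace ℝ (Fin m) → V}
    (hH : IsSolidHarmonic (d + 1) H) : ∫ y, Real.exp (-‖y‖ ^ 2) • H y = 0 := by
  set e : Fin m → EuclideanSpace ℝ (Fin m) := fun j => EuclideanSpace.single j 1 with he
  have hG : ∀ j, IsSolidHarmonic d fun y => fderiv ℝ H y (e j) := fun j => hH.fderiv_apply (e j)
  have hint : ∀ j, Integrable fun y => gaussMonomial (e j) 1 y • fderiv ℝ H y (e j) := fun j =>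
    integrable_gaussMonomial_smul (hG j).contDiff.continuous (hG j).homogeneous _ _
  have hint' : ∀ j, Integrable fun y =>
      gaussMonomial (e j) 0 y • fderiv ℝ (fun z => fderiv ℝ H z (e j)) y (e j) := fun j =>
    integrable_gaussMonomial_smul
      (((hG j).contDiff.continuous_fderiv (by simp)).clm_apply continuous_const)
      (fun s y => (hG j).fderiv_smul _ s y) _ _
  -- Euler's identity turns the integrand into `∑ y_j ∂_j H`, and an integration by parts in each
  -- coordinate turns the integral into that of the Laplacian of `H`
  have h1 : ∀ y, ((d + 1 : ℕ) : ℝ) • (Real.exp (-‖y‖ ^ 2) • H y) =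
      ∑ j, gaussMonomial (e j) 1 y • fderiv ℝ H y (e j) := by
    intro y
    rw [smul_comm, ← hH.fderiv_apply_self y, ← sum_smul_fderiv_single, Finset.smul_sum]
    refine Finset.sum_congr rfl fun j _ => ?_
    simp [gaussMonomial, he, smul_smul, EuclideanSpace.inner_single_left]
  have h2 : ((d + 1 : ℕ) : ℝ) • ∫ y, Real.exp (-‖y‖ ^ 2) • H y = 0 := by
    rw [← integral_smul]
    simp only [h1]
    rw [integral_finsetSum _ fun j _ => hint j]
    have h3 : ∀ j, ∫ y, gaussMonomial (e j) 1 y • fderiv ℝ H y (e j) = (1 / 2 : ℝ) •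
        ∫ y, gaussMonomial (e j) 0 y • fderiv ℝ (fun z => fderiv ℝ H z (e j)) y (e j) := by
      intro j
      have := integral_gaussMonomial_succ (hG j) (e j) 0
      simpa using this
    simp only [h3]
    rw [← Finset.smul_sum, ← integral_finsetSum _ fun j _ => hint' j]
    have h4 : ∀ y, ∑ j, gaussMonomial (e j) 0 y •
        fderiv ℝ (fun z => fderiv ℝ H z (e j)) y (e j) = 0 := by
      intro y
      have hd : DifferentiableAt ℝ (fderiv ℝ H) y :=
        (hH.contDiff.fderiv_right (m := ((⊤ : ℕ∞) : WithTop ℕ∞))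
          (by exact_mod_cast le_top)).differentiable (by simp) y
      have h5 : ∀ j, fderiv ℝ (fun z => fderiv ℝ H z (e j)) y (e j) =
          fderiv ℝ (fderiv ℝ H) y (e j) (e j) := by
        intro j
        rw [fderiv_clm_apply hd (by fun_prop)]
        simp
      simp only [gaussMonomial, pow_zero, mul_one, h5]
      rw [← Finset.smul_sum, hH.laplacian y, smul_zero]
    simp only [h4, integral_zero, smul_zero]
  exact (smul_eq_zero.1 h2).resolve_left (by positivity)

lemma integral_gauss (m : ℕ) :
    ∫ y : EuclideanSpace ℝ (Fin m), Real.exp (-‖y‖ ^ 2) = Real.pi ^ (m / 2 : ℝ) := by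
  have := GaussianFourier.integral_rexp_neg_mul_sq_norm (V := EuclideanSpace ℝ (Fin m))
    (b := 1) one_pos
  simpa using this

variable [CompleteSpace V]

/-- Hecke's formula: the Gaussian moment of order `n = d + 2 j` of a solid harmonic `H` of degree
`d` is a multiple of `|x| ^ (2 j) H(x)`, and the moments of all other orders vanish. -/
lemma IsSolidHarmonic.integral_gaussMonomial (n : ℕ) :
    ∀ {d : ℕ} {H : EuclideanSpace ℝ (Fin m) → V}, IsSolidHarmonic d H →
      ∀ x, (∀ j, n = d + 2 * j → ∫ y, gaussMonomial x n y • H y =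
        (Real.pi ^ (m / 2 : ℝ) * n.factorial / (2 ^ n * j.factorial) * ‖x‖ ^ (2 * j)) • H x) ∧
      ((∀ j, n ≠ d + 2 * j) → ∫ y, gaussMonomial x n y • H y = 0) := by
  -- the recursion of `integral_gaussMonomial_succ` lowers `n`; in its first term the degree drops
  -- to `d - 1` and the value at `x` is `d • H x` by Euler's identity
  induction n using Nat.strong_induction_on with
  | _ n ih =>
    intro d H hH x
    rcases n with _ | n
    · simp only [gaussMonomial, pow_zero, mul_one]
      rcases d with _ | d
      · refine ⟨fun j hj => ?_, fun h => absurd rfl (h 0)⟩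
        obtain rfl : j = 0 := by omega
        simp only [hH.eq_zero_apply]
        rw [integral_smul_const, integral_gauss]
        simp
      · exact ⟨fun j hj => by omega, fun _ => hH.integral_gauss_eq_zero⟩
    have hrec := integral_gaussMonomial_succ hH x n
    rcases d with _ | d
    · have h0 : ∀ y, fderiv ℝ H y x = 0 := by
        intro y
        rw [show H = fun _ => H 0 from funext hH.eq_zero_apply]
        simp
      simp only [h0, smul_zero, integral_zero, zero_add] at hrec
      rw [hrec]
      rcases n with _ | n
      · refine ⟨fun j hj => by omega, fun _ => by simp⟩
      · obtain ⟨e1, e2⟩ := ih n (by omega) hH x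
        rw [Nat.add_sub_cancel]
        refine ⟨fun j hj => ?_, fun h => ?_⟩
        · obtain ⟨i, rfl⟩ : ∃ i, j = i + 1 := ⟨j - 1, by omega⟩
          rw [e1 i (by omega), smul_smul]
          obtain rfl : n = 2 * i := by omega
          congr 1
          rw [Nat.factorial_succ, Nat.factorial_succ, Nat.factorial_succ i]
          push_cast
          field_simp
          ring
        · rw [e2 fun j hj => h (j + 1) (by omega), smul_zero]
    · obtain ⟨f1, f2⟩ := ih n (by omega) (hH.fderiv_apply x) x
      rw [hrec]
      have hE := hH.fderiv_apply_self x
      refine ⟨fun j hj => ?_, fun h => ?_⟩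
      · rw [f1 j (by omega), hE]
        rcases j with _ | i
        · have h0 : ∫ y, gaussMonomial x (n - 1) y • H y = 0 ∨ n = 0 := by
            rcases n with _ | n
            · exact Or.inr rfl
            · exact Or.inl ((ih n (by omega) hH x).2 fun j hj' => by omega)
          have h1 : (n * ‖x‖ ^ 2 / 2 : ℝ) • ∫ y, gaussMonomial x (n - 1) y • H y = 0 := by
            rcases h0 with h0 | h0 <;> simp [h0]
          rw [h1, add_zero, smul_smul, smul_smul]
          obtain rfl : n = d := by omega
          congr 1
          rw [Nat.factorial_succ]
          push_cast
          field_simp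
          ring
        · obtain ⟨n, rfl⟩ : ∃ l, n = l + 1 := ⟨n - 1, by omega⟩
          rw [Nat.add_sub_cancel, (ih n (by omega) hH x).1 i (by omega), smul_smul, smul_smul,
            smul_smul, ← add_smul]
          congr 1
          obtain rfl : n = d + 1 + 2 * i := by omega
          rw [Nat.factorial_succ (d + 1 + 2 * i + 1), Nat.factorial_succ (d + 1 + 2 * i),
            Nat.factorial_succ i]
          push_cast
          field_simp
          ring
      · rw [f2 fun j hj => h j (by omega)]
        rcases n with _ | n
        · simp
        · rw [Nat.add_sub_cancel, (ih n (by omega) hH x).2 fun j hj => h (j + 1) (by omega)]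
          simp

end Gaussian

/-! ### Moments of radial multiples of solid harmonics over the ball -/

section Ball

variable {m : ℕ} {V : Type*} [NormedAddCommGroup V] [NormedSpace ℂ V]

/-- Polar coordinates for the product of a radial and a homogeneous function. -/
lemma integral_radial_smul_homogeneous (hm : 1 ≤ m) {N : ℕ} (w : ℝ → ℂ)
    {g : EuclideanSpace ℝ (Fin m) → V}
    (hg : ∀ (s : ℝ) (x : EuclideanSpace ℝ (Fin m)), g (s • x) = s ^ N • g x) :
    ∫ y, w ‖y‖ • g y = (∫ r in Ioi (0 : ℝ), ((r ^ (m - 1 + N) : ℝ) : ℂ) * w r) •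
      ∫ ω, g ω.1 ∂(volume : Measure (EuclideanSpace ℝ (Fin m))).toSphere := by
  have : Nontrivial (EuclideanSpace ℝ (Fin m)) := by
    have : Nonempty (Fin m) := ⟨⟨0, hm⟩⟩
    infer_instance
  have hdim : Module.finrank ℝ (EuclideanSpace ℝ (Fin m)) = m := finrank_euclideanSpace_fin
  set μ : Measure (EuclideanSpace ℝ (Fin m)) := volume
  have hmp := μ.measurePreserving_homeomorphUnitSphereProd
  rw [hdim] at hmp
  have h1 : ∀ y : EuclideanSpace ℝ (Fin m), y ≠ 0 →
      w ‖y‖ • g y = (((‖y‖ ^ N : ℝ) : ℂ) * w ‖y‖) • g (‖y‖⁻¹ • y) := by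
    intro y hy
    conv_lhs => rw [show y = ‖y‖ • (‖y‖⁻¹ • y) by
      rw [smul_smul, mul_inv_cancel₀ (norm_ne_zero_iff.2 hy), one_smul], hg]
    rw [norm_smul, norm_smul, norm_inv, norm_norm, inv_mul_cancel₀ (norm_ne_zero_iff.2 hy), mul_one,
      ← Complex.coe_smul, smul_smul, mul_comm]
  calc ∫ y, w ‖y‖ • g y
      = ∫ y : ({0}ᶜ : Set (EuclideanSpace ℝ (Fin m))), w ‖y.1‖ • g y.1 ∂(μ.comap (↑)) := by
        rw [integral_subtype_comap (measurableSet_singleton _).compl fun y => w ‖y‖ • g y,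
          restrict_compl_singleton]
    _ = ∫ p : Metric.sphere (0 : EuclideanSpace ℝ (Fin m)) 1 × Ioi (0 : ℝ),
          (((p.2.1 ^ N : ℝ) : ℂ) * w p.2.1) • g p.1.1 ∂μ.toSphere.prod (.volumeIoiPow (m - 1)) := by
        rw [← hmp.integral_comp (Homeomorph.measurableEmbedding _)]
        refine integral_congr_ae (Filter.Eventually.of_forall fun y => ?_)
        simpa using h1 y.1 y.2
    _ = ∫ p : Ioi (0 : ℝ) × Metric.sphere (0 : EuclideanSpace ℝ (Fin m)) 1,
          (((p.1.1 ^ N : ℝ) : ℂ) * w p.1.1) • g p.2.1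
            ∂(Measure.volumeIoiPow (m - 1)).prod μ.toSphere := by
        rw [← integral_prod_swap]; rfl
    _ = (∫ r : Ioi (0 : ℝ), ((r.1 ^ N : ℝ) : ℂ) * w r.1 ∂Measure.volumeIoiPow (m - 1)) •
          ∫ ω, g ω.1 ∂μ.toSphere :=
        integral_prod_smul (fun r : Ioi (0 : ℝ) => ((r.1 ^ N : ℝ) : ℂ) * w r.1)
          fun ω : Metric.sphere (0 : EuclideanSpace ℝ (Fin m)) 1 => g ω.1
    _ = _ := by
        congr 1
        simp only [Measure.volumeIoiPow, ENNReal.ofReal]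
        rw [integral_withDensity_eq_integral_smul
            (measurable_subtype_coe.pow_const _).real_toNNReal,
          integral_subtype_comap measurableSet_Ioi
            fun a => Real.toNNReal (a ^ (m - 1)) • (((a ^ N : ℝ) : ℂ) * w a),
          setIntegral_congr_fun measurableSet_Ioi fun x hx => ?_]
        simp only [NNReal.smul_def, Real.coe_toNNReal _ (pow_nonneg (le_of_lt hx) _)]
        rw [pow_add, Complex.real_smul]
        push_cast
        ring

lemma integral_pow_mul_gauss (q : ℕ) :
    ∫ r in Ioi (0 : ℝ), ((r ^ q : ℝ) : ℂ) * ((Real.exp (-r ^ 2) : ℝ) : ℂ) =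
      ((1 / 2 * Real.Gamma ((q + 1) / 2) : ℝ) : ℂ) := by
  have := integral_rpow_mul_exp_neg_rpow (p := 2) (q := q) two_pos
    (by linarith [(q.cast_nonneg : (0 : ℝ) ≤ q)])
  rw [← this, ← integral_complex_ofReal]
  refine integral_congr_ae (Filter.Eventually.of_forall fun r => ?_)
  simp only [Real.rpow_natCast, Real.rpow_ofNat]
  push_cast
  rfl

variable [CompleteSpace V]

/-- The moments of `P(|y| ^ 2) H(y)` over the unit ball: the radial integral is separated from the
angular one, which is then read off from the Gaussian moments of `H`. -/
lemma IsSolidHarmonic.integral_ball (hm : 1 ≤ m) {d : ℕ} {H : EuclideanSpace ℝ (Fin m) → V}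
    (hH : IsSolidHarmonic d H) (P : ℝ → ℂ) (x : EuclideanSpace ℝ (Fin m)) (n : ℕ) :
    (∀ j, n = d + 2 * j →
      ∫ y in Metric.closedBall (0 : EuclideanSpace ℝ (Fin m)) 1,
        ((inner ℝ x y : ℝ) : ℂ) ^ n • (P (‖y‖ ^ 2) • H y) =
      (radialMoment (2 * d + m) P j * ((2 * Real.pi ^ (m / 2 : ℝ) * n.factorial /
        (2 ^ n * j.factorial * Real.Gamma (j + (2 * d + m : ℕ) / 2)) * ‖x‖ ^ (2 * j) : ℝ) : ℂ)) •
        H x) ∧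
    ((∀ j, n ≠ d + 2 * j) →
      ∫ y in Metric.closedBall (0 : EuclideanSpace ℝ (Fin m)) 1,
        ((inner ℝ x y : ℝ) : ℂ) ^ n • (P (‖y‖ ^ 2) • H y) = 0) := by
  set S := ∫ ω, (inner ℝ x ω.1 : ℝ) ^ n • H ω.1
    ∂(volume : Measure (EuclideanSpace ℝ (Fin m))).toSphere with hS
  have hg : ∀ (s : ℝ) (y : EuclideanSpace ℝ (Fin m)),
      (inner ℝ x (s • y) : ℝ) ^ n • H (s • y) = s ^ (n + d) • ((inner ℝ x y : ℝ) ^ n • H y) := by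
    intro s y
    rw [hH.homogeneous, inner_smul_right, mul_pow, smul_smul, smul_smul, pow_add]
    congr 1; ring
  have hG : ∫ y, gaussMonomial x n y • H y =
      ((1 / 2 * Real.Gamma (((m - 1 + (n + d) : ℕ) + 1) / 2) : ℝ) : ℂ) • S := by
    rw [← integral_pow_mul_gauss, hS, ← integral_radial_smul_homogeneous hm
      (fun r => ((Real.exp (-r ^ 2) : ℝ) : ℂ)) (g := fun y => (inner ℝ x y : ℝ) ^ n • H y) hg]
    simp only [gaussMonomial, mul_smul, Complex.coe_smul]
  have hB : ∫ y in Metric.closedBall (0 : EuclideanSpace ℝ (Fin m)) 1,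
      ((inner ℝ x y : ℝ) : ℂ) ^ n • (P (‖y‖ ^ 2) • H y) =
      (∫ r in Ioc (0 : ℝ) 1, ((r ^ (m - 1 + (n + d)) : ℝ) : ℂ) * P (r ^ 2)) • S := by
    have h1 := integral_radial_smul_homogeneous hm ((Iic (1 : ℝ)).indicator fun r => P (r ^ 2))
      (g := fun y => (inner ℝ x y : ℝ) ^ n • H y) hg
    have h2 : ∀ r : ℝ, ((r ^ (m - 1 + (n + d)) : ℝ) : ℂ) *
        (Iic (1 : ℝ)).indicator (fun r => P (r ^ 2)) r =
        (Iic (1 : ℝ)).indicator (fun r => ((r ^ (m - 1 + (n + d)) : ℝ) : ℂ) * P (r ^ 2)) r := by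
      intro r
      by_cases h : r ∈ Iic (1 : ℝ) <;> simp [h]
    simp only [h2] at h1
    rw [setIntegral_indicator measurableSet_Iic, Ioi_inter_Iic] at h1
    rw [← h1, ← integral_indicator Metric.isClosed_closedBall.measurableSet]
    refine integral_congr_ae (Filter.Eventually.of_forall fun y => ?_)
    by_cases h : ‖y‖ ≤ 1
    · simp only [indicator, mem_closedBall_zero_iff, mem_Iic, h, if_true]
      rw [smul_comm, ← Complex.ofReal_pow, Complex.coe_smul]
    · simp [indicator, h]
  have hpos : 0 < Real.Gamma (((m - 1 + (n + d) : ℕ) + 1) / 2) :=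
    Real.Gamma_pos_of_pos (by positivity)
  -- the Gaussian moment determines the spherical integral `S`
  have hS' : S = ((2 / Real.Gamma (((m - 1 + (n + d) : ℕ) + 1) / 2) : ℝ) : ℂ) •
      ∫ y, gaussMonomial x n y • H y := by
    rw [hG, smul_smul, ← Complex.ofReal_mul]
    have : 2 / Real.Gamma (((m - 1 + (n + d) : ℕ) + 1) / 2) *
        (1 / 2 * Real.Gamma (((m - 1 + (n + d) : ℕ) + 1) / 2)) = 1 := by
      field_simp
    rw [this]
    simp
  refine ⟨fun j hj => ?_, fun h => ?_⟩
  · rw [hB, hS', (hH.integral_gaussMonomial n x).1 j hj, ← Complex.coe_smul, smul_smul,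
      smul_smul]
    have e1 : ((m - 1 + (n + d) : ℕ) + 1 : ℝ) / 2 = j + (2 * d + m : ℕ) / 2 := by
      rw [← Nat.cast_succ, show (m - 1 + (n + d)).succ = 2 * j + (2 * d + m) by omega]
      push_cast
      ring
    have e2 : (∫ r in Ioc (0 : ℝ) 1, ((r ^ (m - 1 + (n + d)) : ℝ) : ℂ) * P (r ^ 2)) =
        radialMoment (2 * d + m) P j := by
      rw [radialMoment]
      refine integral_congr_ae (Filter.Eventually.of_forall fun r => ?_)
      simp only
      rw [← mul_assoc, ← Complex.ofReal_mul, ← pow_add]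
      rw [show m - 1 + (n + d) = 2 * j + (2 * d + m - 1) by omega]
    rw [e1, e2, mul_assoc, ← Complex.ofReal_mul]
    congr 3
    ring
  · rw [hB, hS', (hH.integral_gaussMonomial n x).2 h, smul_zero, smul_zero]

end Ball

/-! ### The finite Fourier transform as a power series -/

/-- Termwise integration of an entire power series in a bounded function `u` against an integrable
function. -/
lemma IsEntireSeq.hasSum_integral {α V : Type*} [MeasurableSpace α] {μ : Measure α}
    [NormedAddCommGroup V] [NormedSpace ℂ V] {b : ℕ → ℂ} (hb : IsEntireSeq b)
    {u : α → ℝ} (hu : AEStronglyMeasurable u μ) {R : ℝ} (hR : ∀ᵐ a ∂μ, |u a| ≤ R) {g : α → V}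
    (hg : Integrable g μ) :
    HasSum (fun n => b n • ∫ a, (u a : ℂ) ^ n • g a ∂μ)
      (∫ a, powerEval b (u a) • g a ∂μ) := by
  set M := max R 0 with hM
  have hM0 : 0 ≤ M := le_max_right _ _
  have hbd : ∀ n, ∀ᵐ a ∂μ, ‖(u a : ℂ) ^ n‖ ≤ M ^ n := fun n => by
    filter_upwards [hR] with a ha
    rw [norm_pow, Complex.norm_real, Real.norm_eq_abs]
    exact pow_le_pow_left₀ (abs_nonneg _) (ha.trans (le_max_left _ _)) n
  have hmeas : ∀ n, AEStronglyMeasurable (fun a => (u a : ℂ) ^ n) μ := fun n =>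
    (Complex.continuous_ofReal.comp_aestronglyMeasurable hu).pow n
  have hint : ∀ n, Integrable (fun a => (u a : ℂ) ^ n • g a) μ := fun n =>
    hg.bdd_smul (M ^ n) (hmeas n) (hbd n)
  have hsum : Summable fun n => ∫ a, ‖b n • (u a : ℂ) ^ n • g a‖ ∂μ := by
    have h0 : Summable fun n => ‖b n‖ * M ^ n := hb M hM0
    refine (h0.mul_right (∫ a, ‖g a‖ ∂μ)).of_nonneg_of_le
      (fun n => integral_nonneg fun a => norm_nonneg _) fun n => ?_
    rw [← integral_const_mul]
    refine integral_mono_ae ((hint n).smul (b n)).norm (hg.norm.const_mul _) ?_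
    filter_upwards [hbd n] with a ha
    rw [norm_smul, norm_smul, ← mul_assoc]
    gcongr
  have := hasSum_integral_of_summable_integral_norm (fun n => (hint n).smul (b n)) hsum
  simp only [Pi.smul_apply, integral_smul] at this
  convert this using 3 with a
  simp only [powerEval, smul_smul]
  exact ((hb.summable_mul_pow _).tsum_smul_const _).symm

lemma isEntireSeq_exp (z : ℂ) : IsEntireSeq fun n => z ^ n / n.factorial := by
  intro R hR
  have := Real.summable_pow_div_factorial (‖z‖ * R)
  refine this.congr fun n => ?_
  rw [norm_div, norm_pow, Complex.norm_natCast, mul_pow]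
  ring

lemma powerEval_exp (z u : ℂ) :
    powerEval (fun n => z ^ n / n.factorial) u = Complex.exp (z * u) := by
  rw [Complex.exp_eq_exp_ℂ, NormedSpace.exp_eq_tsum_div, powerEval]
  refine tsum_congr fun n => ?_
  rw [mul_pow]; ring

/-- The finite Fourier transform of `P(|x| ^ 2) H(x)` is again a radial multiple of the solid
harmonic `H`. -/
lemma IsSolidHarmonic.finiteFourier_eq {m : ℕ} (hm : 1 ≤ m) {d : ℕ} (c : ℝ)
    {H : EuclideanSpace ℝ (Fin m) → ComplexClifford m} (hH : IsSolidHarmonic d H) {P : ℝ → ℂ}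
    (hint : IntegrableOn (fun y => P (‖y‖ ^ 2) • H y) (Metric.closedBall 0 1))
    (hseq : IsEntireSeq fun j => besselCoef (2 * d + m) ((Real.pi * c) ^ 2) j *
      radialMoment (2 * d + m) P j) (x : EuclideanSpace ℝ (Fin m)) :
    finiteFourier c (fun y => P (‖y‖ ^ 2) • H y) x =
      (2 * ((Real.pi ^ (m / 2 : ℝ) : ℝ) : ℂ) * (Real.pi * Complex.I * c) ^ d *
        powerEval (fun j => besselCoef (2 * d + m) ((Real.pi * c) ^ 2) j *
          radialMoment (2 * d + m) P j) ((‖x‖ ^ 2 : ℝ))) • H x := by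
  set z : ℂ := 2 * Real.pi * Complex.I * c with hz
  have h1 := (isEntireSeq_exp z).hasSum_integral
    (μ := volume.restrict (Metric.closedBall (0 : EuclideanSpace ℝ (Fin m)) 1))
    (u := fun y => inner ℝ x y) (by fun_prop) (R := ‖x‖) (by
      refine (ae_restrict_mem Metric.isClosed_closedBall.measurableSet).mono fun y hy => ?_
      rw [mem_closedBall_zero_iff] at hy
      exact (abs_real_inner_le_norm x y).trans (mul_le_of_le_one_right (norm_nonneg _) hy)) hint
  simp only [powerEval_exp] at h1
  have hinj : Function.Injective fun j : ℕ => d + 2 * j := fun i j h => by simp at h; omega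
  -- only the exponents `d + 2 j` contribute
  rw [← hinj.hasSum_iff fun n hn => by
    rw [(hH.integral_ball hm P x n).2 fun j hj => hn ⟨j, hj.symm⟩, smul_zero]] at h1
  rw [finiteFourier, ← h1.tsum_eq, powerEval, ← tsum_mul_left]
  have hent : ∀ j, ((fun n => (z ^ n / n.factorial) • ∫ y in Metric.closedBall
      (0 : EuclideanSpace ℝ (Fin m)) 1, ((inner ℝ x y : ℝ) : ℂ) ^ n • (P (‖y‖ ^ 2) • H y)) ∘
        fun j : ℕ => d + 2 * j) j =
      (2 * ((Real.pi ^ (m / 2 : ℝ) : ℝ) : ℂ) * (Real.pi * Complex.I * c) ^ d *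
        (besselCoef (2 * d + m) ((Real.pi * c) ^ 2) j * radialMoment (2 * d + m) P j *
          ((‖x‖ ^ 2 : ℝ) : ℂ) ^ j)) • H x := by
    intro j
    simp only [Function.comp_apply]
    rw [(hH.integral_ball hm P x _).1 j rfl, smul_smul]
    congr 1
    have hG : Real.Gamma (j + (2 * d + m : ℕ) / 2) ≠ 0 :=
      (Real.Gamma_pos_of_pos (by positivity)).ne'
    rw [besselCoef]
    generalize Real.Gamma (j + (2 * d + m : ℕ) / 2) = G at hG ⊢
    have hGc : (G : ℂ) ≠ 0 := by exact_mod_cast hG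
    have hf : ((d + 2 * j).factorial : ℂ) ≠ 0 := by exact_mod_cast (d + 2 * j).factorial_ne_zero
    have hf' : (j.factorial : ℂ) ≠ 0 := by exact_mod_cast j.factorial_ne_zero
    have hzz : z = 2 * (Real.pi * Complex.I * c) := by rw [hz]; ring
    have hsq : (Real.pi * Complex.I * c : ℂ) ^ (2 * j) = (-(Real.pi * c) ^ 2) ^ j := by
      rw [pow_mul]
      congr 1
      linear_combination (Real.pi * c : ℂ) ^ 2 * Complex.I_sq
    rw [hzz, mul_pow, pow_add (Real.pi * Complex.I * c : ℂ) d, hsq]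
    push_cast
    rw [pow_mul (‖x‖ : ℂ)]
    field_simp
  rw [tsum_congr hent]
  exact (((hseq.summable_mul_pow _).mul_left _).tsum_smul_const _)

/-! ### The finite Hankel transform as a power series -/

/-- The moments of `y ^ (2 j)`, `j = 0, 1, …`, determine an integrable function on `(0, 1]`:
by the Weierstrass theorem the polynomials in `y ^ 2` are dense in the continuous functions. -/
lemma ae_eq_zero_of_forall_even_moment {g : ℝ → ℂ} (hg : IntegrableOn g (Ioc 0 1))
    (h : ∀ j : ℕ, ∫ y in Ioc (0 : ℝ) 1, ((y ^ 2 : ℝ) : ℂ) ^ j * g y = 0) :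
    g =ᵐ[volume.restrict (Ioc (0 : ℝ) 1)] 0 := by
  have hpi : ∀ j : ℕ, IntegrableOn (fun y => (y ^ 2) ^ j • g y) (Ioc 0 1) := by
    intro j
    refine (integrableOn_pow_mul hg (2 * j)).congr_fun (fun y _ => ?_) measurableSet_Ioc
    simp only
    rw [pow_mul, Complex.real_smul]
  have hpoly : ∀ p : Polynomial ℝ, IntegrableOn (fun y => p.eval (y ^ 2) • g y) (Ioc 0 1) ∧
      ∫ y in Ioc (0 : ℝ) 1, p.eval (y ^ 2) • g y = 0 := by
    intro p
    have e : ∀ y : ℝ, p.eval (y ^ 2) • g y =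
        ∑ i ∈ Finset.range (p.natDegree + 1), p.coeff i • ((y ^ 2) ^ i • g y) := by
      intro y
      rw [Polynomial.eval_eq_sum_range, Finset.sum_smul]
      simp only [smul_smul]
    have hpi' : ∀ i : ℕ, IntegrableOn (fun y => p.coeff i • ((y ^ 2) ^ i • g y)) (Ioc 0 1) :=
      fun i => (hpi i).smul (p.coeff i)
    simp only [e]
    refine ⟨integrable_finsetSum _ fun i _ => hpi' i, ?_⟩
    rw [integral_finsetSum _ fun i _ => hpi' i]
    refine Finset.sum_eq_zero fun i _ => ?_
    have hi : ∫ y in Ioc (0 : ℝ) 1, (y ^ 2) ^ i • g y = 0 := by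
      rw [← h i]
      simp only [Complex.real_smul, Complex.ofReal_pow]
    rw [integral_smul, hi, smul_zero]
  have hcont : ∀ φ : ℝ → ℝ, Continuous φ → ∫ y in Ioc (0 : ℝ) 1, φ y • g y = 0 := by
    intro φ hφ
    set I := ∫ y in Ioc (0 : ℝ) 1, ‖g y‖ with hI
    have hI0 : 0 ≤ I := integral_nonneg fun _ => norm_nonneg _
    obtain ⟨M, hM⟩ := isCompact_Icc.exists_bound_of_continuousOn (hφ.continuousOn (s := Icc 0 1))
    have hφi : IntegrableOn (fun y => φ y • g y) (Ioc 0 1) := by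
      refine hg.bdd_smul M hφ.aestronglyMeasurable
        ((ae_restrict_mem measurableSet_Ioc).mono fun y hy => hM y (Ioc_subset_Icc_self hy))
    rw [← norm_eq_zero]
    refine le_antisymm (le_of_forall_pos_le_add fun ε hε => ?_) (norm_nonneg _)
    obtain ⟨p, hp⟩ := exists_polynomial_near_of_continuousOn 0 1 (fun t => φ (Real.sqrt t))
      (by fun_prop) (ε / (I + 1)) (by positivity)
    calc ‖∫ y in Ioc (0 : ℝ) 1, φ y • g y‖
        = ‖∫ y in Ioc (0 : ℝ) 1, (φ y • g y - p.eval (y ^ 2) • g y)‖ := by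
          rw [integral_sub hφi (hpoly p).1, (hpoly p).2, sub_zero]
      _ ≤ ∫ y in Ioc (0 : ℝ) 1, ‖φ y • g y - p.eval (y ^ 2) • g y‖ :=
          norm_integral_le_integral_norm _
      _ ≤ ∫ y in Ioc (0 : ℝ) 1, ε / (I + 1) * ‖g y‖ := by
          refine setIntegral_mono_on (hφi.sub (hpoly p).1).norm (hg.norm.const_mul _)
            measurableSet_Ioc fun y hy => ?_
          have := (hp (y ^ 2) ⟨sq_nonneg y, pow_le_one₀ hy.1.le hy.2⟩).le
          rw [Real.sqrt_sq hy.1.le, abs_sub_comm] at this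
          rw [← sub_smul, norm_smul, Real.norm_eq_abs]
          gcongr
      _ = ε * (I / (I + 1)) := by rw [integral_const_mul, ← hI]; ring
      _ ≤ 0 + ε := by
          rw [zero_add]
          exact mul_le_of_le_one_right hε.le ((div_le_one (by positivity)).2 (by linarith))
  have hU := isOpen_Ioo.ae_eq_zero_of_integral_contDiff_smul_eq_zero (μ := volume) (f := g)
    (U := Ioo (0 : ℝ) 1) (hg.mono_set Ioo_subset_Ioc_self).locallyIntegrableOn
    fun φ hφ _ hsupp => by
      rw [← hcont φ hφ.continuous, eq_comm]
      refine setIntegral_eq_integral_of_forall_compl_eq_zero fun y hy => ?_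
      rw [image_eq_zero_of_notMem_tsupport fun hy' => hy (Ioo_subset_Ioc_self (hsupp hy')),
        zero_smul]
  rw [← restrict_Ioo_eq_restrict_Ioc]
  exact (ae_restrict_iff' measurableSet_Ioo).2 hU

/-- The power series of `√u J_α(u)`, with the Gamma function written as in `besselCoef`. -/
lemma sqrt_mul_besselJ {β : ℕ} {κ s y : ℝ} (hs : 0 < s) (hy : 0 < y) (hκ : κ = s ^ 2) (x : ℝ)
    (hx : 0 < x) :
    ((Real.sqrt (2 * s * x * y) * besselJ ((β : ℝ) / 2 - 1) (2 * s * x * y) : ℝ) : ℂ) =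
      ((Real.sqrt 2 * s ^ (((β : ℝ) - 1) / 2) * x ^ (((β : ℝ) - 1) / 2) *
        y ^ (((β : ℝ) - 1) / 2) : ℝ) : ℂ) *
        powerEval (fun j => besselCoef β κ j * ((x ^ 2 : ℝ) : ℂ) ^ j) ((y ^ 2 : ℝ)) := by
  have hv : 0 < s * x * y := by positivity
  have h2 : 2 * s * x * y / 2 = s * x * y := by ring
  have hterm : ∀ n : ℕ, (-1) ^ n / (n.factorial * Real.Gamma (n + ((β : ℝ) / 2 - 1) + 1)) *
      (2 * s * x * y / 2) ^ (2 * (n : ℝ) + ((β : ℝ) / 2 - 1)) =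
      (s * x * y) ^ ((β : ℝ) / 2 - 1) *
        ((-κ) ^ n / (n.factorial * Real.Gamma (n + β / 2)) * (x ^ 2) ^ n * (y ^ 2) ^ n) := by
    intro n
    rw [h2, Real.rpow_add hv, show (2 * (n : ℝ)) = ((2 * n : ℕ) : ℝ) by push_cast; ring,
      Real.rpow_natCast, show (n : ℝ) + ((β : ℝ) / 2 - 1) + 1 = n + β / 2 by ring, hκ]
    rw [pow_mul, show -s ^ 2 = (-1) * s ^ 2 by ring, mul_pow (-1 : ℝ),
      show (s * x * y) ^ 2 = s ^ 2 * x ^ 2 * y ^ 2 by ring, mul_pow, mul_pow]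
    ring
  have hroot : Real.sqrt (2 * s * x * y) * (s * x * y) ^ ((β : ℝ) / 2 - 1) =
      Real.sqrt 2 * s ^ (((β : ℝ) - 1) / 2) * x ^ (((β : ℝ) - 1) / 2) *
        y ^ (((β : ℝ) - 1) / 2) := by
    rw [show 2 * s * x * y = 2 * (s * x * y) by ring, Real.sqrt_mul zero_le_two, mul_assoc,
      Real.sqrt_eq_rpow (s * x * y), ← Real.rpow_add hv,
      show (1 : ℝ) / 2 + ((β : ℝ) / 2 - 1) = ((β : ℝ) - 1) / 2 by ring,
      Real.mul_rpow (by positivity) hy.le, Real.mul_rpow hs.le hx.le]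
    ring
  rw [besselJ]
  simp only [hterm]
  rw [tsum_mul_left, ← mul_assoc, hroot, Complex.ofReal_mul, powerEval, Complex.ofReal_tsum]
  congr 1
  refine tsum_congr fun n => ?_
  simp only [besselCoef]
  push_cast
  ring

lemma IsEntireSeq.mul_pow {a : ℕ → ℂ} (ha : IsEntireSeq a) (z : ℂ) :
    IsEntireSeq fun n => a n * z ^ n := by
  have := ha.mul_of_norm_le (c := fun n => z ^ n) (C := 1) (norm_nonneg z)
    (fun n => by rw [norm_pow, one_mul])
  convert! this using 2
  ring

/-- The moments of `y ^ ((β - 1) / 2) f(y)`. -/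
noncomputable def hankelMoment (β : ℕ) (f : ℝ → ℂ) (j : ℕ) : ℂ :=
  ∫ y in Ioc (0 : ℝ) 1, ((y ^ 2 : ℝ) : ℂ) ^ j * (((y ^ (((β : ℝ) - 1) / 2) : ℝ) : ℂ) * f y)

lemma isEntireSeq_besselCoef_mul_hankelMoment {β : ℕ} (hβ : 1 ≤ β) (κ : ℝ) {f : ℝ → ℂ}
    (hf : IntegrableOn (fun y : ℝ => ((y ^ (((β : ℝ) - 1) / 2) : ℝ) : ℂ) * f y) (Ioc 0 1)) :
    IsEntireSeq fun j => besselCoef β κ j * hankelMoment β f j := by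
  have := (isEntireSeq_besselCoef hβ κ).mul_of_norm_le (c := hankelMoment β f)
    (C := ∫ y in Ioc (0 : ℝ) 1, ‖((y ^ (((β : ℝ) - 1) / 2) : ℝ) : ℂ) * f y‖) zero_le_one
    (fun j => by
      rw [one_pow, mul_one]
      refine (norm_integral_le_integral_norm _).trans (setIntegral_mono_on ?_ hf.norm
        measurableSet_Ioc fun r hr => ?_)
      · refine ((integrableOn_pow_mul hf (2 * j)).congr_fun (fun y _ => ?_)
          measurableSet_Ioc).norm
        rw [pow_mul, Complex.ofReal_pow]
      · rw [norm_mul, norm_pow, Complex.norm_real, Real.norm_of_nonneg (sq_nonneg r)]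
        exact mul_le_of_le_one_left (norm_nonneg _)
          (pow_le_one₀ (sq_nonneg r) (pow_le_one₀ hr.1.le hr.2)))
  convert! this using 2
  ring

/-- The finite Hankel transform of an arbitrary function is `x ^ ((β - 1) / 2)` times an entire
function of `x ^ 2`. -/
lemma finiteHankel_eq {β : ℕ} (hβ : 1 ≤ β) {c : ℝ} (hc : 0 < c) {f : ℝ → ℂ}
    (hf : IntegrableOn (fun y : ℝ => ((y ^ (((β : ℝ) - 1) / 2) : ℝ) : ℂ) * f y) (Ioc 0 1))
    {x : ℝ} (hx : 0 < x) :
    finiteHankel c ((β : ℝ) / 2 - 1) f x =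
      ((2 * Real.pi ^ ((β : ℝ) / 2) * c ^ (((β : ℝ) - 1) / 2) : ℝ) : ℂ) *
        (((x ^ (((β : ℝ) - 1) / 2) : ℝ) : ℂ) *
          powerEval (fun j => besselCoef β ((Real.pi * c) ^ 2) j * hankelMoment β f j)
            ((x ^ 2 : ℝ))) := by
  have hs : 0 < Real.pi * c := by positivity
  have h1 := ((isEntireSeq_besselCoef hβ ((Real.pi * c) ^ 2)).mul_pow
    ((x ^ 2 : ℝ) : ℂ)).hasSum_integral (μ := volume.restrict (Ioc (0 : ℝ) 1)) (u := fun y => y ^ 2)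
    (by fun_prop) (R := 1) (by
      refine (ae_restrict_mem measurableSet_Ioc).mono fun y hy => ?_
      rw [abs_of_nonneg (sq_nonneg y)]
      exact pow_le_one₀ hy.1.le hy.2) hf
  have h2 : powerEval (fun j => besselCoef β ((Real.pi * c) ^ 2) j * hankelMoment β f j)
      ((x ^ 2 : ℝ)) = ∫ y in Ioc (0 : ℝ) 1, powerEval (fun j => besselCoef β ((Real.pi * c) ^ 2) j *
        ((x ^ 2 : ℝ) : ℂ) ^ j) ((y ^ 2 : ℝ)) * (((y ^ (((β : ℝ) - 1) / 2) : ℝ) : ℂ) * f y) := by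
    rw [powerEval]
    refine (tsum_congr fun j => ?_).trans h1.tsum_eq
    simp only [hankelMoment, smul_eq_mul]
    ring
  have hconst : Real.sqrt (2 * Real.pi) * (Real.sqrt 2 * (Real.pi * c) ^ (((β : ℝ) - 1) / 2)) =
      2 * Real.pi ^ ((β : ℝ) / 2) * c ^ (((β : ℝ) - 1) / 2) := by
    rw [Real.mul_rpow Real.pi_pos.le hc.le, Real.sqrt_mul zero_le_two,
      show (β : ℝ) / 2 = 1 / 2 + ((β : ℝ) - 1) / 2 by ring, Real.rpow_add Real.pi_pos,
      ← Real.sqrt_eq_rpow]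
    linear_combination Real.sqrt Real.pi * (Real.pi ^ (((β : ℝ) - 1) / 2) *
      c ^ (((β : ℝ) - 1) / 2)) * Real.mul_self_sqrt zero_le_two
  rw [finiteHankel, h2, ← hconst, Complex.ofReal_mul (Real.sqrt _), mul_assoc (Complex.ofReal _),
    ← integral_const_mul, ← integral_const_mul, ← integral_const_mul, ← integral_const_mul]
  refine setIntegral_congr_fun measurableSet_Ioc fun y hy => ?_
  rw [show 2 * Real.pi * c * x * y = 2 * (Real.pi * c) * x * y by ring,
    sqrt_mul_besselJ hs hy.1 rfl x hx]
  push_cast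
  ring

/-- On `y ^ ((β - 1) / 2) P(y ^ 2)` the Hankel moments are the radial moments of `P`. -/
lemma hankelMoment_radial {β : ℕ} (hβ : 1 ≤ β) {P f : ℝ → ℂ}
    (hf : ∀ r ∈ Ioc (0 : ℝ) 1, f r = ((r ^ (((β : ℝ) - 1) / 2) : ℝ) : ℂ) * P (r ^ 2)) (j : ℕ) :
    hankelMoment β f j = radialMoment β P j := by
  refine setIntegral_congr_fun measurableSet_Ioc fun y hy => ?_
  rw [hf y hy, pow_mul, Complex.ofReal_pow, ← mul_assoc, ← mul_assoc, ← mul_assoc]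
  congr 1
  rw [mul_assoc, ← Complex.ofReal_mul, ← Real.rpow_add hy.1,
    show ((β : ℝ) - 1) / 2 + ((β : ℝ) - 1) / 2 = ((β - 1 : ℕ) : ℝ) by
      rw [Nat.cast_sub hβ]; push_cast; ring, Real.rpow_natCast]
  push_cast
  ring

lemma IsEntireSeq.radialMoment_powerEval {β : ℕ} (hβ : 1 ≤ β) {a : ℕ → ℂ} (ha : IsEntireSeq a)
    (j : ℕ) : radialMoment β (fun t => powerEval a t) j = seqMoment β a j := by
  have hpow : ∀ q : ℕ, ∫ y in Ioc (0 : ℝ) 1, ((y ^ q : ℝ) : ℂ) = 1 / (q + 1) := by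
    intro q
    rw [integral_complex_ofReal, ← intervalIntegral.integral_of_le zero_le_one, integral_pow]
    push_cast
    simp
  have h1 := ha.hasSum_integral (μ := volume.restrict (Ioc (0 : ℝ) 1)) (u := fun y => y ^ 2)
    (by fun_prop) (R := 1) (by
      refine (ae_restrict_mem measurableSet_Ioc).mono fun y hy => ?_
      rw [abs_of_nonneg (sq_nonneg y)]
      exact pow_le_one₀ hy.1.le hy.2) (g := fun y => ((y ^ (2 * j + (β - 1)) : ℝ) : ℂ))
    ((by fun_prop : Continuous fun y : ℝ =>
      ((y ^ (2 * j + (β - 1)) : ℝ) : ℂ)).integrableOn_Icc.mono_set Ioc_subset_Icc_self)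
  have h2 : radialMoment β (fun t => powerEval a t) j = ∫ y in Ioc (0 : ℝ) 1,
      powerEval a ((y ^ 2 : ℝ)) • ((y ^ (2 * j + (β - 1)) : ℝ) : ℂ) := by
    refine integral_congr_ae (Filter.Eventually.of_forall fun y => ?_)
    simp only [smul_eq_mul]
    rw [pow_add, Complex.ofReal_mul]
    ring
  rw [h2, ← h1.tsum_eq, seqMoment]
  refine tsum_congr fun n => ?_
  have h3 : ∀ y : ℝ, ((y ^ 2 : ℝ) : ℂ) ^ n • ((y ^ (2 * j + (β - 1)) : ℝ) : ℂ) =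
      ((y ^ (2 * n + (2 * j + (β - 1))) : ℝ) : ℂ) := by
    intro y
    rw [pow_add y (2 * n), pow_mul y 2 n, smul_eq_mul, Complex.ofReal_mul,
      Complex.ofReal_pow (y ^ 2)]
  simp only [h3]
  rw [hpow, smul_eq_mul, mul_one_div]
  congr 1
  have : ((2 * n + (2 * j + (β - 1)) : ℕ) : ℂ) + 1 = ((2 * n + 2 * j + β : ℕ) : ℂ) := by
    rw [← Nat.cast_succ]; congr 1; omega
  rw [this]
  push_cast
  ring

/-! ### Prolate eigenfunctions of the two transforms -/

section Angular

variable {m d : ℕ} {δ : ℂ} {c : ℝ} {H : EuclideanSpace ℝ (Fin m) → ComplexClifford m}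

lemma eq_mul_on_Icc_of_eq_mul {P R : ℝ → ℂ} {a : ℂ}
    (hP : ContinuousOn (fun r : ℝ => (r : ℂ) ^ d * P (r ^ 2)) (Icc 0 1))
    (hR : ContinuousOn (fun r : ℝ => (r : ℂ) ^ d * R (r ^ 2)) (Icc 0 1))
    (h : ∀ t ∈ Ioo (0 : ℝ) 1, R t = a * P t) {r : ℝ} (hr : r ∈ Icc (0 : ℝ) 1) :
    (r : ℂ) ^ d * R (r ^ 2) = a * ((r : ℂ) ^ d * P (r ^ 2)) := by
  have h1 : EqOn (fun r : ℝ => (r : ℂ) ^ d * R (r ^ 2))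
      (fun r : ℝ => a * ((r : ℂ) ^ d * P (r ^ 2))) (Ioo 0 1) := fun r hr => by
    simp only
    rw [h _ (sq_mem_Ioo hr)]
    ring
  exact h1.of_subset_closure hR (continuousOn_const.mul hP) Ioo_subset_Icc_self
    (closure_Ioo zero_ne_one).ge hr

/-- Proportionality of the radial parts passes to the functions on the closed ball; at the origin
and on the boundary it holds by continuity. -/
lemma IsAngularFactor.smul_eq_smul_of_eq_mul (hH : IsAngularFactor d δ H) {P R : ℝ → ℂ} {a : ℂ}
    (hP : ContinuousOn (fun r : ℝ => (r : ℂ) ^ d * P (r ^ 2)) (Icc 0 1))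
    (hR : ContinuousOn (fun r : ℝ => (r : ℂ) ^ d * R (r ^ 2)) (Icc 0 1))
    (h : ∀ t ∈ Ioo (0 : ℝ) 1, R t = a * P t) {x : EuclideanSpace ℝ (Fin m)}
    (hx : x ∈ Metric.closedBall (0 : EuclideanSpace ℝ (Fin m)) 1) :
    R (‖x‖ ^ 2) • H x = a • (P (‖x‖ ^ 2) • H x) := by
  rw [mem_closedBall_zero_iff] at hx
  have hx1 : ‖x‖ • (‖x‖⁻¹ • x) = x := by
    by_cases h : x = 0
    · simp [h]
    · rw [smul_smul, mul_inv_cancel₀ (norm_ne_zero_iff.2 h), one_smul]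
  have hHx : H x = (‖x‖ : ℂ) ^ d • H (‖x‖⁻¹ • x) := by
    conv_lhs => rw [← hx1, hH.homogeneous]
    rw [← Complex.ofReal_pow, Complex.coe_smul]
  have := eq_mul_on_Icc_of_eq_mul hP hR h ⟨norm_nonneg x, hx⟩
  rw [hHx, smul_smul, smul_smul, smul_smul, mul_comm (R _), this]
  congr 1
  ring

/-- Two radial multiples of `H` are proportional on the closed ball exactly when their radial parts
are proportional on `(0, 1]`; the values of the radial parts at `0` need not be, since `H` may
vanish at the origin. -/
lemma IsAngularFactor.smul_eq_smul_iff (hm : 1 ≤ m) (hH : IsAngularFactor d δ H) {P R : ℝ → ℂ}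
    {a : ℂ}
    (hP : ContinuousOn (fun r : ℝ => (r : ℂ) ^ d * P (r ^ 2)) (Icc 0 1))
    (hR : ContinuousOn (fun r : ℝ => (r : ℂ) ^ d * R (r ^ 2)) (Icc 0 1)) :
    (∀ x ∈ Metric.closedBall (0 : EuclideanSpace ℝ (Fin m)) 1,
      R (‖x‖ ^ 2) • H x = a • (P (‖x‖ ^ 2) • H x)) ↔
    ∀ r ∈ Ioc (0 : ℝ) 1, R (r ^ 2) = a * P (r ^ 2) := by
  refine ⟨fun h r hr => ?_, fun h x hx => hH.smul_eq_smul_of_eq_mul hP hR (fun t ht => ?_) hx⟩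
  · obtain ⟨ω, hω, hHω⟩ := exists_norm_eq_one_of_homogeneous hm hH.homogeneous hH.ne_zero
    have hn : ‖r • ω‖ = r := by rw [norm_smul, hω, mul_one, Real.norm_of_nonneg hr.1.le]
    have hne : H (r • ω) ≠ 0 := by
      rw [hH.homogeneous]
      exact smul_ne_zero (pow_ne_zero _ hr.1.ne') hHω
    have h1 := h (r • ω) (by rw [mem_closedBall_zero_iff, hn]; exact hr.2)
    rw [hn, smul_smul] at h1
    exact smul_left_injective ℂ hne h1
  · have := h (Real.sqrt t) ⟨Real.sqrt_pos.2 ht.1, Real.sqrt_le_one.2 ht.2.le⟩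
    rwa [Real.sq_sqrt ht.1.le] at this

lemma IsEntireSeq.continuousOn_pow_mul {a : ℕ → ℂ} (ha : IsEntireSeq a) (k : ℂ) (d : ℕ) :
    ContinuousOn (fun r : ℝ => (r : ℂ) ^ d * (k * powerEval a ((r ^ 2 : ℝ)))) (Icc 0 1) := by
  have h : Continuous fun t : ℝ => powerEval a t := (ha.contDiff_ofReal (n := 0)).continuous
  have : Continuous fun r : ℝ => powerEval a ((r ^ 2 : ℝ)) := h.comp (continuous_pow 2)
  fun_prop

/-- The radial part of a Clifford prolate function is an eigenfunction of the radial Fourier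
operator; up to explicit constants its eigenvalue `τ` is the eigenvalue of the finite Fourier
transform. -/
lemma IsAngularFactor.exists_isFourierEigenvalue (hm : 1 ≤ m) (hH : IsAngularFactor d δ H)
    {P : ℝ → ℂ} (hψ : IsCPSWF c fun x => P (‖x‖ ^ 2) • H x) :
    ∃ τ : ℂ, (∀ r ∈ Ioc (0 : ℝ) 1,
      powerEval (fun j => besselCoef (2 * d + m) ((Real.pi * c) ^ 2) j *
        radialMoment (2 * d + m) P j) ((r ^ 2 : ℝ)) = τ * P (r ^ 2)) ∧
      IsFourierEigenvalue c (fun x => P (‖x‖ ^ 2) • H x)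
        (2 * ((Real.pi ^ (m / 2 : ℝ) : ℝ) : ℂ) * (Real.pi * Complex.I * c) ^ d * τ) := by
  obtain ⟨χ, P₁, P₂, hsol, -, hint, h0, h0', ⟨t₀, ht₀, hPt₀⟩, hcont⟩ := hH.radial_of_isCPSWF hm hψ
  have hβ : 1 ≤ 2 * d + m := by omega
  obtain ⟨τ, hτ⟩ := hsol.exists_fourier_eq_mul hβ hint h0 h0' ht₀ hPt₀
  have hseq := isEntireSeq_besselCoef_mul_radialMoment hβ ((Real.pi * c) ^ 2) hint
  have hψint : IntegrableOn (fun y => P (‖y‖ ^ 2) • H y)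
      (Metric.closedBall (0 : EuclideanSpace ℝ (Fin m)) 1) :=
    hψ.contDiffOn.continuousOn.integrableOn_compact (isCompact_closedBall _ _)
  refine ⟨τ, fun r hr => ?_, fun x hx => ?_⟩
  · have h1 := eq_mul_on_Icc_of_eq_mul hcont (hseq.continuousOn_pow_mul 1 d)
      (R := fun t => 1 * powerEval _ (t : ℂ)) (fun t ht => by rw [one_mul, hτ t ht])
      (Ioc_subset_Icc_self hr)
    have hr0 : (r : ℂ) ^ d ≠ 0 := pow_ne_zero _ (by exact_mod_cast hr.1.ne')
    refine mul_left_cancel₀ hr0 ?_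
    rw [one_mul] at h1
    rw [h1]
    ring
  · rw [hH.isSolidHarmonic.finiteFourier_eq hm c hψint hseq]
    refine hH.smul_eq_smul_of_eq_mul hcont (hseq.continuousOn_pow_mul _ d)
      (R := fun t => _ * powerEval _ (t : ℂ)) (fun t ht => ?_) hx
    rw [hτ t ht]
    ring

lemma IsCPSWF.isFourierEigenvalue_unique {ψ : EuclideanSpace ℝ (Fin m) → ComplexClifford m}
    (hψ : IsCPSWF c ψ) {μ μ' : ℂ} (h : IsFourierEigenvalue c ψ μ)
    (h' : IsFourierEigenvalue c ψ μ') : μ = μ' := by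
  obtain ⟨x, hx, hne⟩ := hψ.nonzero
  exact smul_left_injective ℂ hne ((h x hx).symm.trans (h' x hx))

lemma integrableOn_rpow_mul {e : ℝ} (he : 0 ≤ e) {f : ℝ → ℂ} (hf : IntegrableOn f (Ioc 0 1)) :
    IntegrableOn (fun y : ℝ => ((y ^ e : ℝ) : ℂ) * f y) (Ioc 0 1) := by
  refine hf.bdd_mul (c := 1) ?_ ?_
  · exact (Complex.continuous_ofReal.comp (Real.continuous_rpow_const he)).aestronglyMeasurable
  · refine (ae_restrict_mem measurableSet_Ioc).mono fun y hy => ?_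
    rw [Complex.norm_real, Real.norm_of_nonneg (Real.rpow_nonneg hy.1.le _)]
    exact Real.rpow_le_one hy.1.le hy.2 he

lemma half_sub_one_eq (d m : ℕ) :
    (((2 * d + m : ℕ) : ℝ) - 1) / 2 = d + ((m : ℝ) - 1) / 2 := by push_cast; ring

lemma IsAngularFactor.isHankelEigenpair (hm : 1 ≤ m) (hc : 0 < c) (hH : IsAngularFactor d δ H)
    {P : ℝ → ℂ} (hψ : IsCPSWF c fun x => P (‖x‖ ^ 2) • H x) {μ : ℂ}
    (hμ : IsFourierEigenvalue c (fun x => P (‖x‖ ^ 2) • H x) μ) :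
    IsHankelEigenpair c (((2 * d + m : ℕ) : ℝ) / 2 - 1)
      (fun r => ((r ^ ((((2 * d + m : ℕ) : ℝ) - 1) / 2) : ℝ) : ℂ) * P (r ^ 2))
      ((-Complex.I) ^ d * ((c ^ (((m : ℝ) - 1) / 2) : ℝ) : ℂ) * μ) := by
  obtain ⟨χ, P₁, P₂, -, hPc, -, -, -, ⟨t₀, ht₀, hPt₀⟩, hcont⟩ := hH.radial_of_isCPSWF hm hψ
  obtain ⟨τ, hτ, hμτ⟩ := hH.exists_isFourierEigenvalue hm hψ
  obtain rfl := hψ.isFourierEigenvalue_unique hμ hμτ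
  have hβ : 1 ≤ 2 * d + m := by omega
  set φ : ℝ → ℂ := fun r => ((r ^ ((((2 * d + m : ℕ) : ℝ) - 1) / 2) : ℝ) : ℂ) * P (r ^ 2) with hφ
  have hm' : (1 : ℝ) ≤ m := by exact_mod_cast hm
  have he : 0 ≤ (((2 * d + m : ℕ) : ℝ) - 1) / 2 := by
    have : (1 : ℝ) ≤ (2 * d + m : ℕ) := by exact_mod_cast hβ
    linarith
  -- splitting off `r ^ d` makes the second factor continuous up to `r = 0`
  have hφ' : ∀ r ∈ Ioc (0 : ℝ) 1,
      φ r = ((r ^ (((m : ℝ) - 1) / 2) : ℝ) : ℂ) * ((r : ℂ) ^ d * P (r ^ 2)) := by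
    intro r hr
    simp only [hφ]
    rw [half_sub_one_eq, Real.rpow_add hr.1, Real.rpow_natCast]
    push_cast
    ring
  have hmem : MemLp φ 2 (volume.restrict (Ioc (0 : ℝ) 1)) := by
    have hc1 : ContinuousOn (fun r : ℝ => ((r ^ (((m : ℝ) - 1) / 2) : ℝ) : ℂ) *
        ((r : ℂ) ^ d * P (r ^ 2))) (Icc 0 1) :=
      (Complex.continuous_ofReal.comp
        (Real.continuous_rpow_const (by linarith))).continuousOn.mul hcont
    obtain ⟨C, hC⟩ := isCompact_Icc.exists_bound_of_continuousOn hc1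
    refine MemLp.ae_eq ((ae_restrict_mem measurableSet_Ioc).mono fun r hr => (hφ' r hr).symm)
      (MemLp.of_bound ((hc1.mono Ioc_subset_Icc_self).aestronglyMeasurable measurableSet_Ioc) C
        ((ae_restrict_mem measurableSet_Ioc).mono fun r hr => hC r (Ioc_subset_Icc_self hr)))
  refine ⟨hmem, fun h0 => ?_, fun x hx => ?_⟩
  · have hsq : MapsTo (fun r : ℝ => r ^ 2) (Ioc 0 1) (Ioc 0 1) := fun r hr =>
      ⟨pow_pos hr.1 2, pow_le_one₀ hr.1.le hr.2⟩
    have hφc : ContinuousOn φ (Ioc 0 1) :=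
      (Complex.continuous_ofReal.comp (Real.continuous_rpow_const he)).continuousOn.mul
        (hPc.comp (continuous_pow 2).continuousOn hsq)
    have h1 := Measure.eqOn_Ioc_of_ae_eq volume h0 hφc continuousOn_const
      (⟨Real.sqrt_pos.2 ht₀.1, Real.sqrt_le_one.2 ht₀.2.le⟩ : Real.sqrt t₀ ∈ Ioc (0 : ℝ) 1)
    simp only [hφ, Pi.zero_apply, Real.sq_sqrt ht₀.1.le, mul_eq_zero, hPt₀, or_false,
      Complex.ofReal_eq_zero] at h1
    exact (Real.rpow_pos_of_pos (Real.sqrt_pos.2 ht₀.1) _).ne' h1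
  · have hmom : hankelMoment (2 * d + m) φ = radialMoment (2 * d + m) P :=
      funext (hankelMoment_radial hβ fun r _ => rfl)
    rw [finiteHankel_eq hβ hc (integrableOn_rpow_mul he (hmem.integrable one_le_two)) hx.1, hmom,
      hτ x hx]
    have e1 : Real.pi ^ (((2 * d + m : ℕ) : ℝ) / 2) = Real.pi ^ d * Real.pi ^ ((m : ℝ) / 2) := by
      rw [← Real.rpow_natCast Real.pi d, ← Real.rpow_add Real.pi_pos]
      congr 1; push_cast; ring
    have e2 : c ^ ((((2 * d + m : ℕ) : ℝ) - 1) / 2) = c ^ d * c ^ (((m : ℝ) - 1) / 2) := by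
      rw [half_sub_one_eq, Real.rpow_add hc, Real.rpow_natCast]
    have e3 : (-Complex.I) ^ d * (Real.pi * Complex.I * c : ℂ) ^ d = Real.pi ^ d * c ^ d := by
      rw [← mul_pow, ← mul_pow]
      congr 1
      linear_combination (-Real.pi * c : ℂ) * Complex.I_mul_I
    simp only [hφ]
    rw [e1, e2, Complex.ofReal_mul, Complex.ofReal_mul, Complex.ofReal_mul, Complex.ofReal_mul,
      Complex.ofReal_pow, Complex.ofReal_pow, Complex.ofReal_ofNat]
    linear_combination (-2 * ((Real.pi ^ ((m : ℝ) / 2) : ℝ) : ℂ) *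
      ((c ^ (((m : ℝ) - 1) / 2) : ℝ) : ℂ) * τ *
      (((x ^ ((((2 * d + m : ℕ) : ℝ) - 1) / 2) : ℝ) : ℂ) * P (x ^ 2))) * e3

/-- An eigenfunction of the radial Fourier operator is the radial part of a Clifford prolate
function. -/
lemma IsAngularFactor.isCPSWF_of_isRadialEigen (hm : 1 ≤ m) (hH : IsAngularFactor d δ H) {τ : ℂ}
    (hτ : τ ≠ 0) {a : ℕ → ℂ} (ha : IsRadialEigen (2 * d + m) ((Real.pi * c) ^ 2) τ a)
    (hne : ∃ r ∈ Ioc (0 : ℝ) 1, powerEval a ((r ^ 2 : ℝ)) ≠ 0) :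
    IsCPSWF c fun x => powerEval a ((‖x‖ ^ 2 : ℝ)) • H x := by
  obtain ⟨χ, hχ⟩ := ha.exists_seqProlate_eq (by omega) hτ
  have hent := ha.entire
  refine ⟨?_, ?_, -4 * χ + 2 * δ, fun x _ => ?_⟩
  · have h1 : ContDiff ℝ 2 fun x : EuclideanSpace ℝ (Fin m) => powerEval a ((‖x‖ ^ 2 : ℝ)) :=
      (hent.contDiff_ofReal (n := 2)).comp (contDiff_norm_sq ℝ)
    exact (h1.smul (hH.contDiff.of_le (WithTop.coe_le_coe.2 (le_top : (2 : ℕ∞) ≤ ⊤)))).contDiffOn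
  · obtain ⟨r, hr, hr0⟩ := hne
    obtain ⟨ω, hω, hHω⟩ := exists_norm_eq_one_of_homogeneous hm hH.homogeneous hH.ne_zero
    have hn : ‖r • ω‖ = r := by rw [norm_smul, hω, mul_one, Real.norm_of_nonneg hr.1.le]
    refine ⟨r • ω, by rw [mem_closedBall_zero_iff, hn]; exact hr.2, ?_⟩
    rw [hn, hH.homogeneous]
    exact smul_ne_zero hr0 (smul_ne_zero (pow_ne_zero _ hr.1.ne') hHω)
  · rw [hH.cliffordL_radial_smul (P := fun t => powerEval a t) c
      (Filter.Eventually.of_forall fun s => hent.hasDerivAt_ofReal s)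
      (hent.seqDeriv.hasDerivAt_ofReal _), ← powerEval_seqProlate hent,
      show seqProlate (2 * d + m) ((Real.pi * c) ^ 2) a = fun n => χ * a n from funext hχ,
      powerEval_smul, smul_smul]
    congr 1
    ring

/-- Every eigenfunction of the finite Hankel transform comes from a Clifford prolate function: its
eigenvalue is nonzero because even moments determine a function, so it is `x ^ ((β - 1) / 2)` times
an entire function of `x ^ 2`. -/
lemma IsAngularFactor.exists_isCPSWF_of_isHankelEigenpair (hm : 1 ≤ m) (hc : 0 < c)
    (hH : IsAngularFactor d δ H) {f : ℝ → ℂ} {γ : ℂ}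
    (hf : IsHankelEigenpair c (((2 * d + m : ℕ) : ℝ) / 2 - 1) f γ) :
    ∃ R : ℝ → ℂ, (IsCPSWF c fun x => R (‖x‖ ^ 2) • H x) ∧ ∀ r ∈ Ioc (0 : ℝ) 1,
      f r = ((r ^ ((((2 * d + m : ℕ) : ℝ) - 1) / 2) : ℝ) : ℂ) * R (r ^ 2) := by
  set β := 2 * d + m with hβd
  have hβ : 1 ≤ β := by omega
  have he : 0 ≤ ((β : ℝ) - 1) / 2 := by
    have : (1 : ℝ) ≤ β := by exact_mod_cast hβ
    linarith
  have hint := integrableOn_rpow_mul he (hf.memLp.integrable one_le_two)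
  have hseq := isEntireSeq_besselCoef_mul_hankelMoment hβ ((Real.pi * c) ^ 2) hint
  set K : ℂ := ((2 * Real.pi ^ ((β : ℝ) / 2) * c ^ (((β : ℝ) - 1) / 2) : ℝ) : ℂ) with hK
  have hK0 : K ≠ 0 := by
    rw [hK, Complex.ofReal_ne_zero]
    have := Real.rpow_pos_of_pos hc (((β : ℝ) - 1) / 2)
    positivity
  have hpow : ∀ r ∈ Ioc (0 : ℝ) 1, ((r ^ (((β : ℝ) - 1) / 2) : ℝ) : ℂ) ≠ 0 := fun r hr => by
    rw [Complex.ofReal_ne_zero]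
    exact (Real.rpow_pos_of_pos hr.1 _).ne'
  have heq : ∀ r ∈ Ioc (0 : ℝ) 1, K * (((r ^ (((β : ℝ) - 1) / 2) : ℝ) : ℂ) *
      powerEval (fun j => besselCoef β ((Real.pi * c) ^ 2) j * hankelMoment β f j)
        ((r ^ 2 : ℝ))) = γ * f r := fun r hr => by
    rw [← hf.eigen r hr, finiteHankel_eq hβ hc hint hr.1]
  have hγ : γ ≠ 0 := by
    rintro rfl
    have hz : ∀ t ∈ Ioc (0 : ℝ) 1,
        powerEval (fun j => besselCoef β ((Real.pi * c) ^ 2) j * hankelMoment β f j) t = 0 := by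
      intro t ht
      have hr : Real.sqrt t ∈ Ioc (0 : ℝ) 1 := ⟨Real.sqrt_pos.2 ht.1, Real.sqrt_le_one.2 ht.2⟩
      have h1 := heq _ hr
      rw [Real.sq_sqrt ht.1.le, zero_mul] at h1
      exact ((mul_eq_zero.1 ((mul_eq_zero.1 h1).resolve_left hK0)).resolve_left (hpow _ hr))
    have hmom : ∀ j, hankelMoment β f j = 0 := fun j =>
      (mul_eq_zero.1 (hseq.eq_zero_of_eqOn hz j)).resolve_left
        (besselCoef_ne_zero hβ (by positivity) j)
    have h2 := ae_eq_zero_of_forall_even_moment hint hmom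
    refine hf.nonzero ?_
    filter_upwards [h2, ae_restrict_mem measurableSet_Ioc] with r hr hr'
    exact (mul_eq_zero.1 hr).resolve_left (hpow r hr')
  set a : ℕ → ℂ := fun j => K / γ * (besselCoef β ((Real.pi * c) ^ 2) j * hankelMoment β f j)
    with had
  have ha : IsEntireSeq a := hseq.smul _
  have hfa : ∀ r ∈ Ioc (0 : ℝ) 1,
      f r = ((r ^ (((β : ℝ) - 1) / 2) : ℝ) : ℂ) * powerEval a ((r ^ 2 : ℝ)) := by
    intro r hr
    rw [had, powerEval_smul, ← mul_right_inj' hγ, ← heq r hr]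
    field_simp
  have hmom : ∀ j, hankelMoment β f j = seqMoment β a j := fun j => by
    rw [← ha.radialMoment_powerEval hβ]
    exact hankelMoment_radial hβ hfa j
  have heig : IsRadialEigen β ((Real.pi * c) ^ 2) (γ / K) a :=
    ⟨ha, fun j => by rw [had, ← had, ← hmom]; simp only [had]; field_simp⟩
  refine ⟨fun t => powerEval a t, hH.isCPSWF_of_isRadialEigen hm (div_ne_zero hγ hK0) heig ?_, hfa⟩
  by_contra! hcon
  refine hf.nonzero ((ae_restrict_mem measurableSet_Ioc).mono fun r hr => ?_)
  rw [hfa r hr, hcon r hr, mul_zero, Pi.zero_apply]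

lemma IsAngularFactor.listsHankel (hm : 1 ≤ m) (hc : 0 < c) (hH : IsAngularFactor d δ H)
    {P : ℕ → ℝ → ℂ} (hψ : ∀ N, IsCPSWF c fun x => P N (‖x‖ ^ 2) • H x)
    (hlist : ListsCPSWF c (fun R x => R (‖x‖ ^ 2) • H x) P) :
    ListsHankel c (((2 * d + m : ℕ) : ℝ) / 2 - 1)
      (fun N r => ((r ^ ((((2 * d + m : ℕ) : ℝ) - 1) / 2) : ℝ) : ℂ) * P N (r ^ 2)) := by
  intro f γ hf
  obtain ⟨R, hR, hfR⟩ := hH.exists_isCPSWF_of_isHankelEigenpair hm hc hf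
  obtain ⟨-, -, -, -, -, -, -, -, -, hRc⟩ := hH.radial_of_isCPSWF hm hR
  refine (existsUnique_congr fun N => exists_congr fun a => ?_).1 (hlist R hR)
  obtain ⟨-, -, -, -, -, -, -, -, -, hPc⟩ := hH.radial_of_isCPSWF hm (hψ N)
  rw [hH.smul_eq_smul_iff hm hPc hRc]
  refine forall₂_congr fun r hr => ?_
  have hr0 : ((r ^ ((((2 * d + m : ℕ) : ℝ) - 1) / 2) : ℝ) : ℂ) ≠ 0 := by
    rw [Complex.ofReal_ne_zero]
    exact (Real.rpow_pos_of_pos hr.1 _).ne'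
  rw [hfR r hr, mul_left_comm, mul_right_inj' hr0]

/-- The statement for one parity, with the angular factor `Y` or `x Y` abstracted to `H`. -/
lemma IsAngularFactor.fourier_hankel (hm : 1 ≤ m) (hc : 0 < c) (hH : IsAngularFactor d δ H)
    {α e : ℝ} (hα : α = d + (m : ℝ) / 2 - 1) (he : e = d + ((m : ℝ) - 1) / 2)
    (P : ℕ → ℝ → ℂ) (hψ : ∀ N, IsCPSWF c fun x => P N (‖x‖ ^ 2) • H x) :
    (∀ N, ∃! μ : ℂ, IsFourierEigenvalue c (fun x => P N (‖x‖ ^ 2) • H x) μ) ∧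
    (∀ μ : ℕ → ℂ, (∀ N, IsFourierEigenvalue c (fun x => P N (‖x‖ ^ 2) • H x) (μ N)) →
      ∀ N, IsHankelEigenpair c α (fun r => ((r ^ e : ℝ) : ℂ) * P N (r ^ 2))
        ((-Complex.I) ^ d * ((c ^ (((m : ℝ) - 1) / 2) : ℝ) : ℂ) * μ N)) ∧
    (ListsCPSWF c (fun R x => R (‖x‖ ^ 2) • H x) P →
      ListsHankel c α (fun N r => ((r ^ e : ℝ) : ℂ) * P N (r ^ 2))) := by
  have hα' : α = ((2 * d + m : ℕ) : ℝ) / 2 - 1 := by rw [hα]; push_cast; ring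
  rw [hα', he, ← half_sub_one_eq]
  refine ⟨fun N => ?_, fun μ hμ N => hH.isHankelEigenpair hm hc (hψ N) (hμ N),
    hH.listsHankel hm hc hψ⟩
  obtain ⟨τ, -, hτ⟩ := hH.exists_isFourierEigenvalue hm (hψ N)
  exact ⟨_, hτ, fun μ hμ => (hψ N).isFourierEigenvalue_unique hμ hτ⟩

end Angular

theorem mainTheorem2 (c : ℝ) (hc : 0 < c) (k m : ℕ) (hm : 1 ≤ m)
    (Y : EuclideanSpace ℝ (Fin m) → ComplexClifford m)
    (hY : IsSphericalMonogenic k Y) (hY0 : Y ≠ 0) :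
    -- even case: `ψ_{2N} = P_N(|x| ^ 2) Y`, Hankel order `k + m/2 - 1`
    (∀ P : ℕ → ℝ → ℂ, (∀ N, IsCPSWF c (evenForm Y (P N))) →
      (∀ N, ∃! μ : ℂ, IsFourierEigenvalue c (evenForm Y (P N)) μ) ∧
      (∀ μ : ℕ → ℂ, (∀ N, IsFourierEigenvalue c (evenForm Y (P N)) (μ N)) →
        ∀ N, IsHankelEigenpair c ((k : ℝ) + (m : ℝ) / 2 - 1)
          (fun r => ((r ^ ((k : ℝ) + ((m : ℝ) - 1) / 2) : ℝ) : ℂ) * P N (r ^ 2))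
          ((-Complex.I) ^ k * ((c ^ (((m : ℝ) - 1) / 2) : ℝ) : ℂ) * μ N)) ∧
      (ListsCPSWF c (evenForm Y) P →
        ListsHankel c ((k : ℝ) + (m : ℝ) / 2 - 1)
          (fun N r => ((r ^ ((k : ℝ) + ((m : ℝ) - 1) / 2) : ℝ) : ℂ) * P N (r ^ 2)))) ∧
    -- odd case: `ψ_{2N+1} = Q_N(|x| ^ 2) x Y`, Hankel order `k + m/2`
    (∀ Q : ℕ → ℝ → ℂ, (∀ N, IsCPSWF c (oddForm Y (Q N))) →
      (∀ N, ∃! μ : ℂ, IsFourierEigenvalue c (oddForm Y (Q N)) μ) ∧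
      (∀ μ : ℕ → ℂ, (∀ N, IsFourierEigenvalue c (oddForm Y (Q N)) (μ N)) →
        ∀ N, IsHankelEigenpair c ((k : ℝ) + (m : ℝ) / 2)
          (fun r => ((r ^ ((k : ℝ) + ((m : ℝ) + 1) / 2) : ℝ) : ℂ) * Q N (r ^ 2))
          ((-Complex.I) ^ (k + 1) * ((c ^ (((m : ℝ) - 1) / 2) : ℝ) : ℂ) * μ N)) ∧
      (ListsCPSWF c (oddForm Y) Q →
        ListsHankel c ((k : ℝ) + (m : ℝ) / 2)
          (fun N r => ((r ^ ((k : ℝ) + ((m : ℝ) + 1) / 2) : ℝ) : ℂ) * Q N (r ^ 2)))) := by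
  constructor
  · exact (hY.isAngularFactor hY0).fourier_hankel hm hc rfl rfl
  · exact (hY.isAngularFactor_vec_mul hm hY0).fourier_hankel hm hc (by push_cast; ring)
      (by push_cast; ring)
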